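/- Let $n\ge 2$ and let $R_n$ be the rose with one vertex and $n$ edges. A marked graph $(G,g)$ is a finite graph $G$ together with a homotopy equivalence $g\colon R_n\to G$; a marked graph whose underlying graph is a rose is called a marked rose. Marked graphs $(G,g)$ and $(G',g')$ are equivalent if there is a graph isomorphism $h\colon G\to G'$ with $h\circ g\simeq g'$. The spine $K_n$ of Outer space is the geometric realization of the simplicial complex whose vertices are the equivalence classes of marked graphs all of whose vertices have valence at least $3$, and whose simplices are the finite nonempty chains with respect to forest collapse, i.e. passing from $(G,g)$ to $(G/F,c_F\circ g)$, where $F\subset G$ is a forest and $c_F\colon G\to G/F$ is the collapsing map. A blowup is the reverse of the collapse of a single edge. The standard rose is $\rho_0=(R_n,\mathrm{id})$. A graph morphism sends vertices to vertices and each edge to an edge or to a vertex. A marked graph with univalent or bivalent vertices represents the vertex of $K_n$ obtained from it by repeatedly collapsing edges that end in univalent vertices and ignoring bivalent vertices. **Proposition.** 1. $K_n$ is connected. 2. Let $\rho=(R,r)$ be a marked rose. After a suitable subdivision of the edges of $R$, a homotopy inverse of $r$ is represented by a graph morphism $s\colon R\to R_n$. For every such subdivision and every such $s$ there is a finite sequence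 of marked graphs $\Gamma_0,\dots,\Gamma_k$, with graph morphisms $s_i\colon\Gamma_i\to R_n$ representing homotopy inverses of their markings, such that $\Gamma_0$ is the subdivided marked rose, $s_0=s$, $s_k$ is a homeomorphism, and for each $i<k$ there is a graph morphism $q_i\colon\Gamma_i\to\Gamma_{i+1}$, compatible with the markings up to homotopy, with $s_i=s_{i+1}\circ q_i$, which is either the collapse of a single non-loop edge or the Stallings fold of two edges with a common initial vertex and distinct terminal vertices. There are vertices $x_0=\rho,\,x_1,\dots,x_k=\rho_0$ of $K_n$ such that $x_i$ is represented by $\Gamma_i$ and, for each $i<k$: if $q_i$ is an edge collapse, then $x_{i+1}$ is obtained from $x_i$ by a (possibly empty) forest collapse; if $q_i$ is a fold, then $x_{i+1}$ is obtained from $x_i$ by at most one blowup followed by a (possibly empty) forest collapse. In particular every marked rose is joined to the standard rose by a path of blowups and forest collapses. 3. If $G$ is a finite graph and $f\colon G\to R_n$ is a locally injective graph morphism that is a homotopy equivalence, then $f$ is a homeomorphism. -/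

import Mathlib

open Function Topology

/-! ## Graphs, their morphisms and their geometric realizations -/

/-- A finite graph; loops and multiple edges are allowed.  `D` is the set of oriented edges, `rev`
reverses the orientation, so that a geometric edge is a pair `{d, rev d}`. -/
structure FinGraph where
  V : Type
  D : Type
  finV : Finite V
  finD : Finite D
  src : D → V
  rev : D → D
  rev_rev : ∀ d, rev (rev d) = d
  rev_ne : ∀ d, rev d ≠ d

namespace FinGraph

instance (G : FinGraph) : Finite G.V := G.finV
instance (G : FinGraph) : Finite G.D := G.finD
instance (G : FinGraph) : TopologicalSpace G.V := ⊥
instance (G : FinGraph) : TopologicalSpace G.D := ⊥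
instance (G : FinGraph) : DiscreteTopology G.V := ⟨rfl⟩
instance (G : FinGraph) : DiscreteTopology G.D := ⟨rfl⟩

/-- Terminal vertex of an oriented edge. -/
def tgt (G : FinGraph) (d : G.D) : G.V := G.src (G.rev d)

/-- The valence of a vertex; a loop counts twice. -/
noncomputable def valence (G : FinGraph) (v : G.V) : ℕ := Nat.card {d : G.D // G.src d = v}

/-- The gluing of the vertices and of one copy of `[0,1]` for every oriented edge: the initial point
of an edge is its initial vertex, and an edge and its reverse are the same interval, run through in
opposite directions. -/
inductive Glue (G : FinGraph) : G.V ⊕ (G.D × unitInterval) → G.V ⊕ (G.D × unitInterval) → Prop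
  | src (d : G.D) : Glue G (Sum.inr (d, 0)) (Sum.inl (G.src d))
  | rev (d : G.D) (t : unitInterval) :
      Glue G (Sum.inr (d, t)) (Sum.inr (G.rev d, unitInterval.symm t))

/-- The geometric realization `|G|`, with the quotient topology. -/
def Realization (G : FinGraph) : Type := Quot G.Glue

instance (G : FinGraph) : TopologicalSpace G.Realization :=
  inferInstanceAs (TopologicalSpace (Quot G.Glue))

/-- A graph morphism sends vertices to vertices and every edge either to a single edge (`Sum.inr`)
or to a vertex (`Sum.inl`). -/
@[ext]
structure Hom (G H : FinGraph) where
  onV : G.V → H.V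
  onD : G.D → H.V ⊕ H.D
  map_src : ∀ d, Sum.elim id H.src (onD d) = onV (G.src d)
  map_rev : ∀ d, onD (G.rev d) = Sum.map id H.rev (onD d)

namespace Hom

variable {G H K : FinGraph}

/-- The identity morphism. -/
def id (G : FinGraph) : Hom G G where
  onV := fun v => v
  onD := Sum.inr
  map_src := fun _ => rfl
  map_rev := fun _ => rfl

/-- Composition of morphisms. -/
def comp (g : Hom H K) (f : Hom G H) : Hom G K where
  onV := fun v => g.onV (f.onV v)
  onD := fun d => Sum.elim (fun v => Sum.inl (g.onV v)) g.onD (f.onD d)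
  map_src := fun d => by
    have h := f.map_src d
    rcases hd : f.onD d with v | e
    · simp only [hd, Sum.elim_inl, _root_.id] at h ⊢
      rw [h]
    · simp only [hd, Sum.elim_inr] at h ⊢
      rw [g.map_src, h]
  map_rev := fun d => by
    rw [f.map_rev]
    rcases f.onD d with v | e
    · rfl
    · simpa using g.map_rev e

/-- The map on vertices and parametrized edges underlying the realization of a morphism; it is
linear on every edge. -/
def pre (f : Hom G H) : G.V ⊕ (G.D × unitInterval) → H.V ⊕ (H.D × unitInterval)
  | Sum.inl v => Sum.inl (f.onV v)
  | Sum.inr (d, t) => Sum.elim Sum.inl (fun e => Sum.inr (e, t)) (f.onD d)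

theorem continuous_pre (f : Hom G H) : Continuous f.pre := by
  refine continuous_sum_dom.2 ⟨?_, ?_⟩
  · exact continuous_inl.comp continuous_of_discreteTopology
  · rw [continuous_prod_of_discrete_left]
    intro d
    change Continuous fun t : unitInterval =>
      Sum.elim Sum.inl (fun e => Sum.inr (e, t)) (f.onD d)
    rcases f.onD d with v | e
    · exact continuous_const
    · exact continuous_inr.comp (by fun_prop)

theorem glue_pre (f : Hom G H) (a b : G.V ⊕ (G.D × unitInterval)) (h : G.Glue a b) :
    Quot.mk H.Glue (f.pre a) = Quot.mk H.Glue (f.pre b) := by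
  cases h with
  | src d =>
    have h := f.map_src d
    rcases hd : f.onD d with v | e
    · simp only [hd, Sum.elim_inl, _root_.id] at h
      simp [pre, hd, h]
    · simp only [hd, Sum.elim_inr] at h
      simp only [pre, hd, Sum.elim_inr, ← h]
      exact Quot.sound (Glue.src e)
  | rev d t =>
    have h := f.map_rev d
    rcases hd : f.onD d with v | e
    · simp [pre, hd, h]
    · simp only [pre, hd, h, Sum.elim_inr, Sum.map_inr]
      exact Quot.sound (Glue.rev e t)

/-- The continuous map `|f| : |G| → |H|` induced by a graph morphism. -/
def realize (f : Hom G H) : C(G.Realization, H.Realization) where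
  toFun := Quot.lift (fun a => Quot.mk H.Glue (f.pre a)) f.glue_pre
  continuous_toFun := continuous_quot_lift f.glue_pre (continuous_quot_mk.comp f.continuous_pre)

theorem realize_id (G : FinGraph) : (Hom.id G).realize = ContinuousMap.id _ := by
  ext x
  induction x using Quot.ind with
  | mk a => rcases a with v | ⟨d, t⟩ <;> rfl

theorem realize_comp (g : Hom H K) (f : Hom G H) :
    (g.comp f).realize = g.realize.comp f.realize := by
  ext x
  induction x using Quot.ind with
  | mk a =>
    refine congrArg (Quot.mk K.Glue) ?_
    rcases a with v | ⟨d, t⟩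
    · rfl
    · simp only [pre, comp]
      rcases f.onD d with v | e <;> rfl

end Hom

/-! ## Forests, collapses, folds -/

/-- The vertices `u` and `v` are joined by an edge path with edges in `F`. -/
def ConnectedVia (G : FinGraph) (F : Set G.D) : G.V → G.V → Prop :=
  Relation.ReflTransGen fun u v => ∃ d ∈ F, G.src d = u ∧ G.tgt d = v

/-- The subgraph with edge set `F` (closed under `rev`) contains no circuit: no edge of `F` has its
end points joined by an edge path in the rest of `F`.  In particular no edge of `F` is a loop. -/
def IsForest (G : FinGraph) (F : Set G.D) : Prop :=
  ∀ d ∈ F, ¬ G.ConnectedVia (F \ {d, G.rev d}) (G.src d) (G.tgt d)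

/-- A graph with one vertex and `n` edges. -/
def IsRose (G : FinGraph) (n : ℕ) : Prop := Nat.card G.V = 1 ∧ Nat.card G.D = 2 * n

namespace Hom

variable {G H : FinGraph}

/-- The oriented edges that are mapped to a vertex. -/
def collapsed (c : Hom G H) : Set G.D := {d | ∃ v, c.onD d = Sum.inl v}

/-- `c : G → H` is the collapse `G → G/F` of a (possibly empty) forest `F`, that is: the set `F` of
edges sent to vertices is a forest, `c` identifies vertices exactly if they lie in the same
component of `F`, and it is a bijection from the edges outside `F` onto the edges of `H`. -/
def IsForestCollapse (c : Hom G H) : Prop :=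
  G.IsForest c.collapsed ∧
  Surjective c.onV ∧
  (∀ u v, c.onV u = c.onV v ↔ G.ConnectedVia c.collapsed u v) ∧
  ∀ e : H.D, ∃! d : G.D, c.onD d = Sum.inr e

/-- `c : G → H` is the collapse of the single (non-loop) edge `a`. -/
def IsEdgeCollapse (c : Hom G H) (a : G.D) : Prop :=
  c.IsForestCollapse ∧ c.collapsed = {a, G.rev a}

/-- `q : G → H` is the Stallings fold of two different edges `a`, `b` with the same initial vertex:
the quotient map that identifies `a` with `b`, hence also `rev a` with `rev b` and the terminal
vertices of `a` and `b`, and nothing else. -/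
def IsFold (q : Hom G H) (a b : G.D) : Prop :=
  G.src a = G.src b ∧ a ≠ b ∧ b ≠ G.rev a ∧
  ∃ φ : G.D → H.D, (∀ d, q.onD d = Sum.inr (φ d)) ∧ Surjective φ ∧ Surjective q.onV ∧
    (∀ u v, q.onV u = q.onV v ↔
      u = v ∨ (u = G.tgt a ∧ v = G.tgt b) ∨ (u = G.tgt b ∧ v = G.tgt a)) ∧
    ∀ d e, φ d = φ e ↔
      d = e ∨ (d = a ∧ e = b) ∨ (d = b ∧ e = a) ∨
        (d = G.rev a ∧ e = G.rev b) ∨ (d = G.rev b ∧ e = G.rev a)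

end Hom

/-- The fixed rose `R_n`: one vertex and `n` loops, each with two orientations. -/
def rose (n : ℕ) : FinGraph where
  V := Unit
  D := Fin n × Bool
  finV := inferInstance
  finD := inferInstance
  src := fun _ => ()
  rev := fun d => (d.1, !d.2)
  rev_rev := fun d => by simp
  rev_ne := fun d h => by simpa using congrArg Prod.snd h

end FinGraph

open FinGraph

/-- The continuous map `f` is a homotopy equivalence. -/
def IsHomotopyEquivalence {X Y : Type} [TopologicalSpace X] [TopologicalSpace Y] (f : C(X, Y)) :
    Prop :=
  ∃ e : ContinuousMap.HomotopyEquiv X Y, e.toFun = f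

/-! ## Marked graphs -/

/-- A finite graph, with vertices of any valence, together with a marking, which is a homotopy
equivalence `R_n → |G|`. -/
structure MarkedGraph (n : ℕ) where
  G : FinGraph
  marking : C((rose n).Realization, G.Realization)
  isHomotopyEquivalence : IsHomotopyEquivalence marking

namespace MarkedGraph

variable {n : ℕ}

/-- The graph morphism `c` carries the marking of `Γ` to the marking of `Γ'`, up to homotopy. -/
def Carries (Γ Γ' : MarkedGraph n) (c : Hom Γ.G Γ'.G) : Prop :=
  (c.realize.comp Γ.marking).Homotopic Γ'.marking

/-- `(G, g) ~ (G', g')` if there is a graph isomorphism `h : G → G'` with `h ∘ g ≃ g'`. -/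
def Equivalent (Γ Γ' : MarkedGraph n) : Prop :=
  ∃ (h : Hom Γ.G Γ'.G) (k : Hom Γ'.G Γ.G),
    k.comp h = Hom.id Γ.G ∧ h.comp k = Hom.id Γ'.G ∧ Γ.Carries Γ' h

theorem Equivalent.refl (Γ : MarkedGraph n) : Γ.Equivalent Γ := by
  refine ⟨Hom.id _, Hom.id _, ?_, ?_, ?_⟩
  · ext <;> rfl
  · ext <;> rfl
  · unfold Carries
    rw [Hom.realize_id, ContinuousMap.id_comp]

theorem Equivalent.symm {Γ Γ' : MarkedGraph n} (h : Γ.Equivalent Γ') : Γ'.Equivalent Γ := by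
  obtain ⟨h, k, hk, kh, hm⟩ := h
  refine ⟨k, h, kh, hk, ?_⟩
  have h1 : (k.realize.comp (h.realize.comp Γ.marking)).Homotopic (k.realize.comp Γ'.marking) :=
    (ContinuousMap.Homotopic.refl k.realize).comp hm
  rw [← ContinuousMap.comp_assoc, ← Hom.realize_comp, hk, Hom.realize_id,
    ContinuousMap.id_comp] at h1
  exact h1.symm

theorem Equivalent.trans {Γ Γ' Γ'' : MarkedGraph n} (h₁ : Γ.Equivalent Γ')
    (h₂ : Γ'.Equivalent Γ'') : Γ.Equivalent Γ'' := by
  obtain ⟨h, k, hk, kh, hm⟩ := h₁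
  obtain ⟨h', k', hk', kh', hm'⟩ := h₂
  have assoc : ∀ {A B C D : FinGraph} (u : Hom C D) (v : Hom B C) (w : Hom A B),
      (u.comp v).comp w = u.comp (v.comp w) := by
    intro A B C D u v w
    refine Hom.ext rfl (funext fun d => ?_)
    simp only [Hom.comp]
    rcases w.onD d with x | e <;> rfl
  have id_comp : ∀ {A B : FinGraph} (u : Hom A B), (Hom.id B).comp u = u := by
    intro A B u
    refine Hom.ext rfl (funext fun d => ?_)
    simp only [Hom.comp, Hom.id]
    rcases u.onD d with x | e <;> rfl
  refine ⟨h'.comp h, k.comp k', ?_, ?_, ?_⟩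
  · rw [assoc, ← assoc k', hk', id_comp, hk]
  · rw [assoc, ← assoc h, kh, id_comp, kh']
  · have h1 := ((ContinuousMap.Homotopic.refl h'.realize).comp hm).trans hm'
    unfold Carries
    rw [Hom.realize_comp, ContinuousMap.comp_assoc]
    exact h1

/-- Every vertex has valence at least `3`. -/
def IsReduced (Γ : MarkedGraph n) : Prop := ∀ v, 3 ≤ Γ.G.valence v

/-- `Γ'` is obtained from `Γ` by the collapse of a non-loop edge that starts at a bivalent vertex;
that is, the bivalent vertex is removed and its two adjacent edges are merged into one. -/
def RemovesBivalent (Γ Γ' : MarkedGraph n) : Prop :=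
  ∃ (c : Hom Γ.G Γ'.G) (a : Γ.G.D),
    c.IsEdgeCollapse a ∧ Γ.G.valence (Γ.G.src a) = 2 ∧ Γ.Carries Γ' c

/-- `Γ'` is obtained from `Γ` by the collapse of an edge that starts at a univalent vertex. -/
def RemovesUnivalent (Γ Γ' : MarkedGraph n) : Prop :=
  ∃ (c : Hom Γ.G Γ'.G) (a : Γ.G.D),
    c.IsEdgeCollapse a ∧ Γ.G.valence (Γ.G.src a) = 1 ∧ Γ.Carries Γ' c

/-- `Γ'` is obtained from `Γ` by a subdivision of edges, i.e. by inserting bivalent vertices. -/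
def IsSubdivisionOf (Γ' Γ : MarkedGraph n) : Prop :=
  Relation.ReflTransGen RemovesBivalent Γ' Γ

end MarkedGraph

/-! ## The spine -/

/-- Marked graphs all of whose vertices have valence at least `3`. -/
def ReducedMarkedGraph (n : ℕ) : Type 1 := {Γ : MarkedGraph n // Γ.IsReduced}

instance spineSetoid (n : ℕ) : Setoid (ReducedMarkedGraph n) where
  r Γ Γ' := Γ.1.Equivalent Γ'.1
  iseqv := ⟨fun Γ => .refl Γ.1, fun h => h.symm, fun h h' => h.trans h'⟩

/-- The vertices of the spine `K_n`: equivalence classes of marked graphs. -/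
def SpineVertex (n : ℕ) : Type 1 := Quotient (spineSetoid n)

/-- The vertex of the spine given by a marked graph. -/
def ReducedMarkedGraph.toVertex {n : ℕ} (Γ : ReducedMarkedGraph n) : SpineVertex n :=
  Quotient.mk _ Γ

namespace SpineVertex

variable {n : ℕ}

/-- `y` is obtained from `x` by the collapse of a forest; the forest may be empty, and then
`y = x`. -/
def Collapses (x y : SpineVertex n) : Prop :=
  ∃ Γ Γ' : ReducedMarkedGraph n, Γ.toVertex = x ∧ Γ'.toVertex = y ∧
    ∃ c : Hom Γ.1.G Γ'.1.G, c.IsForestCollapse ∧ Γ.1.Carries Γ'.1 c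

/-- `y` is a blowup of `x`: a single edge collapse leads from `y` to `x`. -/
def IsBlowup (y x : SpineVertex n) : Prop :=
  ∃ Γ Γ' : ReducedMarkedGraph n, Γ.toVertex = y ∧ Γ'.toVertex = x ∧
    ∃ (c : Hom Γ.1.G Γ'.1.G) (a : Γ.1.G.D), c.IsEdgeCollapse a ∧ Γ.1.Carries Γ'.1 c

end SpineVertex

/-- The spine `K_n` as an abstract simplicial complex: the simplices are the finite nonempty sets of
vertices that are chains for the relation given by forest collapse. -/
def spine (n : ℕ) : PreAbstractSimplicialComplex (SpineVertex n) where
  faces := {s | s.Nonempty ∧ IsChain SpineVertex.Collapses (s : Set (SpineVertex n))}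
  isRelLowerSet_faces := fun _ h =>
    ⟨h.1, fun _ hts ht => ⟨ht, h.2.mono (Finset.coe_subset.2 hts)⟩⟩

/-- The points of the geometric realization of a simplicial complex, in barycentric coordinates. -/
def PreAbstractSimplicialComplex.Realization {ι : Type*} (K : PreAbstractSimplicialComplex ι) :
    Type _ :=
  {w : ι →₀ ℝ // w.support ∈ K.faces ∧ (∀ i, 0 ≤ w i) ∧ (w.sum fun _ t => t) = 1}

/-- The weak topology: a set is open exactly if its intersection with every closed simplex is open
in that simplex, which carries the topology given by the barycentric coordinates. -/
instance PreAbstractSimplicialComplex.instTopologicalSpaceRealization {ι : Type*}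
    (K : PreAbstractSimplicialComplex ι) : TopologicalSpace K.Realization :=
  ⨆ s : K.faces, TopologicalSpace.coinduced
    (fun x : {x : K.Realization // x.1.support ⊆ s.1} => x.1)
    (TopologicalSpace.induced
      (fun (x : {x : K.Realization // x.1.support ⊆ s.1}) (i : ι) => x.1.1 i) inferInstance)

/-- The standard rose: `R_n`, marked by the identity. -/
def standardRose (n : ℕ) (hn : 2 ≤ n) : ReducedMarkedGraph n :=
  ⟨⟨rose n, ContinuousMap.id _, ContinuousMap.HomotopyEquiv.refl _, rfl⟩, fun v => by
    have h : (rose n).valence v = Nat.card (Fin n × Bool) :=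
      Nat.card_congr (Equiv.subtypeUnivEquiv fun _ => rfl)
    change 3 ≤ (rose n).valence v
    rw [h, Nat.card_prod, Nat.card_eq_fintype_card, Nat.card_eq_fintype_card, Fintype.card_fin,
      Fintype.card_bool]
    omega⟩

/-- The vertex `x` of the spine is the point represented by the marked graph `Γ`, which may have
univalent and bivalent vertices: `x` is the class of the graph that is left after adjacent edges of
univalent vertices have been collapsed and bivalent vertices have been ignored. -/
def MarkedGraph.Represents {n : ℕ} (Γ : MarkedGraph n) (x : SpineVertex n) : Prop :=
  ∃ Δ : ReducedMarkedGraph n, Δ.toVertex = x ∧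
    Relation.ReflTransGen (fun A B => A.RemovesBivalent B ∨ A.RemovesUnivalent B) Γ Δ.1

/-! ## Folding sequences -/

/-- A marked graph together with a graph morphism to `R_n` that represents a homotopy inverse of the
marking. -/
structure InverseMorphism (n : ℕ) extends MarkedGraph n where
  map : Hom G (rose n)
  map_comp_marking : (map.realize.comp marking).Homotopic (ContinuousMap.id _)
  marking_comp_map : (marking.comp map.realize).Homotopic (ContinuousMap.id _)

namespace InverseMorphism

variable {n : ℕ}

/-- The morphism of `A` factors through the morphism `q`, which carries the data of `A` to those of
`B`. -/
def Factors (A B : InverseMorphism n) (q : Hom A.G B.G) : Prop :=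
  B.map.comp q = A.map ∧ A.toMarkedGraph.Carries B.toMarkedGraph q

/-- The morphism of `A` sends an edge to a point, and `B` results from the collapse of that edge. -/
def EdgeCollapseStep (A B : InverseMorphism n) : Prop :=
  ∃ (q : Hom A.G B.G) (a : A.G.D), q.IsEdgeCollapse a ∧ A.Factors B q

/-- `B` results from `A` by the Stallings fold of two edges with the same initial vertex, distinct
terminal vertices and the same image under the morphism of `A`. -/
def FoldStep (A B : InverseMorphism n) : Prop :=
  ∃ (q : Hom A.G B.G) (a b : A.G.D),
    q.IsFold a b ∧ A.G.tgt a ≠ A.G.tgt b ∧ A.Factors B q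

end InverseMorphism

/-! The proof is Stallings folding. Let `s : Γ → R_n` be a graph morphism that is a homotopy
equivalence. If `s` collapses an edge, this edge is not a loop, since otherwise it would be an
essential loop with constant image (`src_ne_tgt_of_collapsed`). If `s` identifies two edges with the
same initial vertex, their terminal vertices differ, for a similar reason
(`tgt_ne_tgt_of_identified`). So the edge can be collapsed, or the two edges folded, by a homotopy
equivalence through which `s` factors, and the number of edges drops. If neither happens, `s` is an
immersion. Its partial permutations of the vertices extend to a finite covering of the rose. Every
petal is homotopic to the image of a closed path at any given vertex `v`, so it fixes the sheet of
`v` and is covered by a loop at `v`. Hence `Γ` has one vertex and `s` is an isomorphism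
(`exists_inverse_of_immersion`). This also proves the third claim, because a locally injective
morphism is an immersion in this combinatorial sense.

To follow the sequence in the spine, vertices of valence at most two are removed. The removals are
confluent (`diamond`), so a marked graph represents only one vertex of the spine, and an edge
collapse changes this vertex by at most one edge collapse (`exists_reduced_of_collapse`). A fold of
`a` and `b` is a partial fold followed by a completion: a graph `H` with a new edge `z`, the common
initial piece of `a` and `b`, collapses onto `Γ` along `z`, and it collapses onto the folded graph
along the remainders of `a` and `b` (`exists_fold`). The class of `H` is therefore the vertex of `Γ`
or a blowup of it, and a forest collapse leads from there to the vertex of the folded graph.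

A homotopy inverse of any marking reads a word on each edge, and subdividing the edges letter by
letter makes it a graph morphism. The folding argument thus applies to every vertex of the spine,
not only to roses, and joins it to the standard rose. Every point is joined to a vertex inside its
simplex, so the spine is path connected.

The homotopy theory rests on three tools. Maps of graphs are homotopic if paths between the images
of the vertices make a square commute for every edge (`homotopic_of_squares`). Every path between
vertices is homotopic to an edge path (`isEdgeWord`). Homotopy classes of paths are told apart by
their action on the fibers of explicit coverings (`Transports.unique`). -/

/-! ## Homotopy of paths whose end points agree propositionally -/

namespace Path

variable {X Y : Type*} [TopologicalSpace X] [TopologicalSpace Y]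

/-- The paths `p` and `q` have the same end points and are homotopic relative to them. -/
def HHomotopic {a b c d : X} (p : Path a b) (q : Path c d) : Prop :=
  ∃ (h₁ : a = c) (h₂ : b = d), p.Homotopic (q.cast h₁ h₂)

infix:50 " ≈ₚ " => HHomotopic

namespace HHomotopic

variable {a b c d a' b' c' d' : X}

theorem of_homotopic {p q : Path a b} (h : p.Homotopic q) : p ≈ₚ q := ⟨rfl, rfl, h⟩

theorem homotopic {p q : Path a b} (h : p ≈ₚ q) : p.Homotopic q := by
  obtain ⟨h₁, h₂, h⟩ := h
  exact h

@[refl] theorem refl (p : Path a b) : p ≈ₚ p := of_homotopic (.refl p)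

@[symm] theorem symm {p : Path a b} {q : Path c d} (h : p ≈ₚ q) : q ≈ₚ p := by
  obtain ⟨rfl, rfl, h⟩ := h
  exact of_homotopic h.symm

theorem trans {p : Path a b} {q : Path c d} {r : Path a' b'} (h : p ≈ₚ q) (h' : q ≈ₚ r) :
    p ≈ₚ r := by
  obtain ⟨rfl, rfl, h⟩ := h
  obtain ⟨rfl, rfl, h'⟩ := h'
  exact of_homotopic (Path.Homotopic.trans h h')

theorem of_eq {p q : Path a b} (h : p = q) : p ≈ₚ q := h ▸ refl p

theorem of_forall_eq {p : Path a b} {q : Path c d} (h : ∀ t, p t = q t) : p ≈ₚ q := by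
  obtain rfl : a = c := by simpa using h 0
  obtain rfl : b = d := by simpa using h 1
  exact of_eq (Path.ext (funext h))

theorem cast_left (p : Path a b) (h₁ : c = a) (h₂ : d = b) : p.cast h₁ h₂ ≈ₚ p :=
  of_forall_eq fun _ => rfl

theorem congr_trans {p : Path a b} {q : Path b c} {p' : Path a' b'} {q' : Path b' c'}
    (h : p ≈ₚ p') (h' : q ≈ₚ q') : p.trans q ≈ₚ p'.trans q' := by
  obtain ⟨rfl, rfl, h⟩ := h
  obtain ⟨_, rfl, h'⟩ := h'
  exact of_homotopic (Path.Homotopic.hcomp h h')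

theorem congr_symm {p : Path a b} {q : Path c d} (h : p ≈ₚ q) : p.symm ≈ₚ q.symm := by
  obtain ⟨rfl, rfl, h⟩ := h
  exact of_homotopic h.symm₂

theorem map {p : Path a b} {q : Path c d} (h : p ≈ₚ q) (f : C(X, Y)) :
    p.map f.continuous ≈ₚ q.map f.continuous := by
  obtain ⟨rfl, rfl, h⟩ := h
  exact of_homotopic (h.map f)

theorem trans_refl (p : Path a b) : p.trans (Path.refl b) ≈ₚ p :=
  of_homotopic (Path.Homotopic.trans_refl p)

theorem refl_trans (p : Path a b) : (Path.refl a).trans p ≈ₚ p :=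
  of_homotopic (Path.Homotopic.refl_trans p)

theorem trans_symm (p : Path a b) : p.trans p.symm ≈ₚ Path.refl a :=
  of_homotopic (Path.Homotopic.trans_symm p)

theorem symm_trans (p : Path a b) : p.symm.trans p ≈ₚ Path.refl b :=
  of_homotopic (Path.Homotopic.symm_trans p)

theorem assoc (p : Path a b) (q : Path b c) (r : Path c d) :
    (p.trans q).trans r ≈ₚ p.trans (q.trans r) :=
  of_homotopic (Path.Homotopic.trans_assoc p q r)

theorem refl_of_eq (h : a = b) : Path.refl a ≈ₚ Path.refl b := by
  subst h
  rfl

theorem trans_of_right {p : Path a b} {q : Path b c} (h : q ≈ₚ Path.refl c') : p.trans q ≈ₚ p := by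
  obtain ⟨rfl, rfl, h⟩ := h
  exact (congr_trans (refl p) (of_homotopic h)).trans (trans_refl p)

theorem trans_of_left {p : Path a b} {q : Path b c} (h : p ≈ₚ Path.refl c') : p.trans q ≈ₚ q := by
  obtain ⟨rfl, rfl, h⟩ := h
  exact (congr_trans (of_homotopic h) (refl q)).trans (refl_trans q)

/-- If `p · q ≈ r` then `q ≈ p⁻¹ · r`. -/
theorem eq_symm_trans {p : Path a b} {q : Path b c} {r : Path a d} (h : p.trans q ≈ₚ r) :
    q ≈ₚ p.symm.trans r :=
  ((refl_trans q).symm.trans (congr_trans (symm_trans p).symm (refl q))).trans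
    ((assoc _ _ _).trans (congr_trans (refl _) h))

theorem trans_symm_cancel (p : Path a b) (q : Path b c) : (p.trans q).trans q.symm ≈ₚ p :=
  (assoc _ _ _).trans (trans_of_right (trans_symm q))

theorem symm_trans_cancel (p : Path a b) (q : Path c b) : (p.trans q.symm).trans q ≈ₚ p :=
  (assoc _ _ _).trans (trans_of_right (symm_trans q))

theorem cancel_left {p : Path a b} {q r : Path b c} (h : p.trans q ≈ₚ p.trans r) : q ≈ₚ r :=
  (eq_symm_trans h).trans
    ((assoc _ _ _).symm.trans ((congr_trans (symm_trans p) (refl r)).trans (refl_trans r)))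

end HHomotopic

/-- Paths in the unit interval are determined up to homotopy by their end points. -/
theorem homotopic_unitInterval {s t : unitInterval} (p q : Path s t) : p.Homotopic q :=
  have : ContractibleSpace unitInterval :=
    (convex_Icc (0 : ℝ) 1).contractibleSpace ⟨0, by simp⟩
  SimplyConnectedSpace.paths_homotopic p q

theorem nonempty_unitInterval (s t : unitInterval) : Nonempty (Path s t) :=
  have : ContractibleSpace unitInterval :=
    (convex_Icc (0 : ℝ) 1).contractibleSpace ⟨0, by simp⟩
  PathConnectedSpace.joined s t

end Path

open Path

/-! ## Homotopy equivalences -/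

section HomotopyEquivalence

variable {X Y : Type} [TopologicalSpace X] [TopologicalSpace Y]

theorem isHomotopyEquivalence_iff {f : C(X, Y)} :
    IsHomotopyEquivalence f ↔
      ∃ g : C(Y, X), (g.comp f).Homotopic (.id X) ∧ (f.comp g).Homotopic (.id Y) :=
  ⟨by rintro ⟨e, rfl⟩; exact ⟨e.invFun, e.left_inv, e.right_inv⟩,
    fun ⟨g, h, h'⟩ => ⟨⟨f, g, h, h'⟩, rfl⟩⟩

theorem IsHomotopyEquivalence.comp {Z : Type} [TopologicalSpace Z] {g : C(Y, Z)} {f : C(X, Y)}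
    (hg : IsHomotopyEquivalence g) (hf : IsHomotopyEquivalence f) :
    IsHomotopyEquivalence (g.comp f) := by
  obtain ⟨e, rfl⟩ := hg
  obtain ⟨e', rfl⟩ := hf
  exact ⟨e'.trans e, rfl⟩

theorem IsHomotopyEquivalence.congr {f g : C(X, Y)} (hf : IsHomotopyEquivalence f)
    (h : f.Homotopic g) : IsHomotopyEquivalence g := by
  rw [isHomotopyEquivalence_iff] at *
  obtain ⟨k, h₁, h₂⟩ := hf
  exact ⟨k, ((ContinuousMap.Homotopic.refl k).comp h.symm).trans h₁,
    (h.symm.comp (ContinuousMap.Homotopic.refl k)).trans h₂⟩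

/-- A left homotopy inverse of a homotopy equivalence is a right homotopy inverse. -/
theorem IsHomotopyEquivalence.right_inv_of_left_inv {f : C(X, Y)} (hf : IsHomotopyEquivalence f)
    {g : C(Y, X)} (h : (g.comp f).Homotopic (.id X)) : (f.comp g).Homotopic (.id Y) := by
  obtain ⟨k, -, h₂⟩ := isHomotopyEquivalence_iff.1 hf
  have h₃ : g.Homotopic k := by
    have := ((ContinuousMap.Homotopic.refl g).comp h₂).symm.trans
      (h.comp (ContinuousMap.Homotopic.refl k))
    simpa using this
  exact ((ContinuousMap.Homotopic.refl f).comp h₃).trans h₂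

/-- If `g ∘ f` and `f` are homotopy equivalences then so is `g`. -/
theorem IsHomotopyEquivalence.of_comp {Z : Type} [TopologicalSpace Z] {g : C(Y, Z)} {f : C(X, Y)}
    (hgf : IsHomotopyEquivalence (g.comp f)) (hf : IsHomotopyEquivalence f) :
    IsHomotopyEquivalence g := by
  obtain ⟨k, h₁, h₂⟩ := isHomotopyEquivalence_iff.1 hf
  have hk : IsHomotopyEquivalence k := isHomotopyEquivalence_iff.2 ⟨f, h₂, h₁⟩
  refine (hgf.comp hk).congr ?_
  rw [ContinuousMap.comp_assoc]
  simpa using (ContinuousMap.Homotopic.refl g).comp h₂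

/-- The homotopy from `g ∘ f` to the identity does not fix base points. By naturality, `g ∘ f ∘ r`
followed by the trace of `b` is homotopic to the trace of `a` followed by `r`, so `f ∘ r` determines
`r`. -/
theorem IsHomotopyEquivalence.injective_path {f : C(X, Y)} (hf : IsHomotopyEquivalence f)
    {a b : X} {p q : Path a b} (h : p.map f.continuous ≈ₚ q.map f.continuous) : p ≈ₚ q := by
  obtain ⟨g, ⟨H⟩, -⟩ := isHomotopyEquivalence_iff.1 hf
  have key : ∀ r : Path a b, ((r.map f.continuous).map g.continuous).trans (H.evalAt b) ≈ₚ
      (H.evalAt a).trans r := fun r => .of_homotopic (Path.Homotopic.map_trans_evalAt H r)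
  exact .cancel_left ((key p).symm.trans
    ((Path.HHomotopic.congr_trans (h.map g) (.refl _)).trans (key q)))

/-- The candidate is `g ∘ r` conjugated by the traces of the homotopy. It is correct because its
image under `g ∘ f` is homotopic to `g ∘ r`, and `g` is injective on homotopy classes of paths. -/
theorem IsHomotopyEquivalence.exists_path {f : C(X, Y)} (hf : IsHomotopyEquivalence f)
    {a b : X} (r : Path (f a) (f b)) : ∃ p : Path a b, p.map f.continuous ≈ₚ r := by
  obtain ⟨g, ⟨H⟩, h⟩ := isHomotopyEquivalence_iff.1 hf
  have hg : IsHomotopyEquivalence g := isHomotopyEquivalence_iff.2 ⟨f, h, ⟨H⟩⟩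
  let p : Path a b := (H.evalAt a).symm.trans ((r.map g.continuous).trans (H.evalAt b))
  refine ⟨p, hg.injective_path ?_⟩
  have h₁ : ((p.map f.continuous).map g.continuous).trans (H.evalAt b) ≈ₚ
      (H.evalAt a).trans p := .of_homotopic (Path.Homotopic.map_trans_evalAt H p)
  have h₂ : (H.evalAt a).trans p ≈ₚ (r.map g.continuous).trans (H.evalAt b) :=
    (HHomotopic.assoc _ _ _).symm.trans (.trans_of_left (.trans_symm _))
  exact (HHomotopic.trans_symm_cancel _ (H.evalAt b)).symm.trans
    ((HHomotopic.congr_trans (h₁.trans h₂) (.refl _)).trans (.trans_symm_cancel _ _))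

end HomotopyEquivalence

/-! ## Points, edges and maps of the realization of a graph -/

namespace FinGraph

variable (G : FinGraph)

/-- The point of the realization given by a vertex. -/
def vtx (v : G.V) : G.Realization := Quot.mk _ (Sum.inl v)

/-- The point with parameter `t` on an oriented edge. -/
def pt (d : G.D) (t : unitInterval) : G.Realization := Quot.mk _ (Sum.inr (d, t))

theorem pt_zero (d : G.D) : G.pt d 0 = G.vtx (G.src d) := Quot.sound (Glue.src d)

theorem pt_rev (d : G.D) (t : unitInterval) : G.pt (G.rev d) t = G.pt d (unitInterval.symm t) := by
  have h := Quot.sound (r := G.Glue) (Glue.rev d (unitInterval.symm t))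
  rw [unitInterval.symm_symm] at h
  exact h.symm

theorem pt_one (d : G.D) : G.pt d 1 = G.vtx (G.tgt d) := by
  rw [← unitInterval.symm_zero, ← pt_rev, pt_zero, tgt]

theorem tgt_rev (d : G.D) : G.tgt (G.rev d) = G.src d := by rw [tgt, rev_rev]

theorem src_rev (d : G.D) : G.src (G.rev d) = G.tgt d := rfl

theorem rev_injective : Injective G.rev := fun a b h => by rw [← G.rev_rev a, h, G.rev_rev]

theorem rev_eq_iff {a b : G.D} : G.rev a = b ↔ a = G.rev b :=
  ⟨fun h => by rw [← h, G.rev_rev], fun h => by rw [h, G.rev_rev]⟩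

theorem continuous_pt (d : G.D) : Continuous (G.pt d) :=
  continuous_quot_mk.comp (continuous_inr.comp (by fun_prop))

/-- An oriented edge as a path. -/
def edge (d : G.D) : Path (G.vtx (G.src d)) (G.vtx (G.tgt d)) where
  toFun := G.pt d
  continuous_toFun := G.continuous_pt d
  source' := G.pt_zero d
  target' := G.pt_one d

theorem edge_rev (d : G.D) : G.edge (G.rev d) ≈ₚ (G.edge d).symm :=
  .of_forall_eq fun t => G.pt_rev d t

/-- A choice of one orientation of every geometric edge. -/
def Pos (d : G.D) : Prop := Finite.equivFin G.D d < Finite.equivFin G.D (G.rev d)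

theorem pos_rev (d : G.D) : G.Pos (G.rev d) ↔ ¬ G.Pos d := by
  unfold Pos
  rw [rev_rev, not_lt, le_iff_lt_or_eq, or_iff_left]
  exact fun h => G.rev_ne d ((Finite.equivFin G.D).injective h)

variable {G}

theorem realization_ind {p : G.Realization → Prop} (hv : ∀ v, p (G.vtx v))
    (hd : ∀ d, G.Pos d → ∀ t, p (G.pt d t)) (x : G.Realization) : p x := by
  induction x using Quot.ind with
  | mk a =>
    rcases a with v | ⟨d, t⟩
    · exact hv v
    · by_cases h : G.Pos d
      · exact hd d h t
      · have := hd (G.rev d) ((G.pos_rev d).2 h) (unitInterval.symm t)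
        rwa [pt_rev, unitInterval.symm_symm] at this

theorem realization_cases (x : G.Realization) :
    (∃ v, x = G.vtx v) ∨ ∃ d t, G.Pos d ∧ 0 < t ∧ t < 1 ∧ x = G.pt d t := by
  induction x using realization_ind with
  | hv v => exact .inl ⟨v, rfl⟩
  | hd d h t =>
    rcases eq_or_ne t 0 with rfl | h₀
    · exact .inl ⟨_, G.pt_zero d⟩
    rcases eq_or_ne t 1 with rfl | h₁
    · exact .inl ⟨_, G.pt_one d⟩
    exact .inr ⟨d, t, h, unitInterval.pos_iff_ne_zero.2 h₀, unitInterval.lt_one_iff_ne_one.2 h₁,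
      rfl⟩

section Lift

variable {Y : Type*} [TopologicalSpace Y]

open Classical in
/-- The map on vertices and parametrized edges given by paths for the positive edges. -/
noncomputable def liftPre (y : G.V → Y) (P : G.D → C(unitInterval, Y)) :
    G.V ⊕ (G.D × unitInterval) → Y
  | Sum.inl v => y v
  | Sum.inr (d, t) => if G.Pos d then P d t else P (G.rev d) (unitInterval.symm t)

/-- The map of the realization given by points for the vertices and paths for the positively
oriented edges. -/
noncomputable def lift (y : G.V → Y) (P : G.D → C(unitInterval, Y))
    (h₀ : ∀ d, P d 0 = y (G.src d)) (h₁ : ∀ d, P d 1 = y (G.tgt d)) : C(G.Realization, Y) where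
  toFun := Quot.lift (liftPre y P) fun a b h => by
    cases h with
    | src d =>
      by_cases hd : G.Pos d
      · simp [liftPre, hd, h₀]
      · simp [liftPre, hd, h₁, tgt_rev]
    | rev d t =>
      by_cases hd : G.Pos d
      · have := (G.pos_rev d).not.2 (not_not.2 hd)
        simp [liftPre, hd, this, rev_rev]
      · have := (G.pos_rev d).2 hd
        simp [liftPre, hd, this]
  continuous_toFun := by
    refine continuous_quot_lift _ (continuous_sum_dom.2 ⟨continuous_of_discreteTopology, ?_⟩)
    rw [continuous_prod_of_discrete_left]
    intro d
    by_cases hd : G.Pos d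
    · simpa [liftPre, hd, Function.comp_def] using (P d).continuous
    · simp only [liftPre, hd, Function.comp_def, if_false]
      fun_prop

variable {y : G.V → Y} {P : G.D → C(unitInterval, Y)} {h₀ : ∀ d, P d 0 = y (G.src d)}
  {h₁ : ∀ d, P d 1 = y (G.tgt d)}

theorem lift_pt {d : G.D} (hd : G.Pos d) (t : unitInterval) :
    lift y P h₀ h₁ (G.pt d t) = P d t := if_pos hd

/-- The map of the realization given by points for the vertices and paths for the edges. -/
noncomputable def ofPaths (y : G.V → Y) (P : ∀ d, Path (y (G.src d)) (y (G.tgt d))) :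
    C(G.Realization, Y) :=
  lift y (fun d => (P d).toContinuousMap) (fun d => (P d).source) fun d => (P d).target

/-- `ofPaths` uses `P` on positive edges only. The hypothesis makes the value on a negative edge
agree with `P` too. -/
theorem edge_map_ofPaths {P : ∀ d, Path (y (G.src d)) (y (G.tgt d))} {d : G.D}
    (h : P (G.rev d) ≈ₚ (P d).symm) : (G.edge d).map (ofPaths y P).continuous ≈ₚ P d := by
  by_cases hd : G.Pos d
  · exact .of_forall_eq fun t =>
      lift_pt (P := fun d => (P d).toContinuousMap) (h₀ := fun d => (P d).source)
        (h₁ := fun d => (P d).target) hd t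
  · have h₁ : (G.edge d).map (ofPaths y P).continuous ≈ₚ (P (G.rev d)).symm :=
      .of_forall_eq fun t => if_neg hd
    exact h₁.trans (h.congr_symm.trans (.of_eq (Path.symm_symm _)))

/-- Two maps of a graph that agree on the vertices and are homotopic on every edge relative to its
end points are homotopic relative to the vertices. -/
theorem exists_homotopy_rel {f g : C(G.Realization, Y)} (hv : ∀ v, f (G.vtx v) = g (G.vtx v))
    (hd : ∀ d, G.Pos d → (G.edge d).map f.continuous ≈ₚ (G.edge d).map g.continuous) :
    ∃ H : f.Homotopy g, ∀ v t, H (t, G.vtx v) = f (G.vtx v) := by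
  classical
  have hF : ∀ d, ∃ F : C(unitInterval × unitInterval, Y), G.Pos d →
      (∀ t, F (t, 0) = f (G.pt d t)) ∧ (∀ t, F (t, 1) = g (G.pt d t)) ∧
      (∀ s, F (0, s) = f (G.vtx (G.src d))) ∧ ∀ s, F (1, s) = f (G.vtx (G.tgt d)) := by
    intro d
    by_cases h : G.Pos d
    · obtain ⟨_, _, ⟨F⟩⟩ := hd d h
      refine ⟨F.toContinuousMap.comp .prodSwap, fun _ => ⟨fun t => ?_, fun t => ?_, fun s => ?_,
        fun s => ?_⟩⟩
      · exact F.apply_zero t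
      · exact F.apply_one t
      · exact F.source s
      · exact F.target s
    · exact ⟨.const _ (f (G.pt d 0)), fun h' => absurd h' h⟩
  choose F hF using hF
  -- The homotopy is a map into the path space of `Y`, so that `lift` yields its continuity and the
  -- product of the quotient with the interval need not be studied.
  let K : C(G.Realization, C(unitInterval, Y)) :=
    lift (fun v => .const _ (f (G.vtx v)))
      (fun d => if G.Pos d then (F d).curry else
        ((F (G.rev d)).curry).comp ⟨unitInterval.symm, unitInterval.continuous_symm⟩)
      (fun d => by
        ext s
        by_cases h : G.Pos d
        · simpa [h] using (hF d h).2.2.1 s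
        · simpa [h, tgt_rev] using (hF (G.rev d) ((G.pos_rev d).2 h)).2.2.2 s)
      (fun d => by
        ext s
        by_cases h : G.Pos d
        · simpa [h] using (hF d h).2.2.2 s
        · simpa [h, src_rev] using (hF (G.rev d) ((G.pos_rev d).2 h)).2.2.1 s)
  have hKp : ∀ d, G.Pos d → ∀ t s, K (G.pt d t) s = F d (t, s) := by
    intro d h t s
    rw [show K (G.pt d t) = _ from lift_pt h t]
    simp [h]
  refine ⟨⟨K.uncurry.comp .prodSwap, ?_, ?_⟩, fun v t => rfl⟩
  · intro x
    change K x 0 = f x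
    induction x using realization_ind with
    | hv v => rfl
    | hd d h t => rw [hKp d h, (hF d h).1]
  · intro x
    change K x 1 = g x
    induction x using realization_ind with
    | hv v => exact hv v
    | hd d h t => rw [hKp d h, (hF d h).2.1]

/-- The square condition for an edge is equivalent to the one for the reverse edge. -/
theorem square_rev {f g : C(G.Realization, Y)} {p : ∀ v, Path (f (G.vtx v)) (g (G.vtx v))}
    {d : G.D}
    (h : ((G.edge d).map f.continuous).trans (p (G.tgt d)) ≈ₚ
      (p (G.src d)).trans ((G.edge d).map g.continuous)) :
    ((G.edge (G.rev d)).map f.continuous).trans (p (G.tgt (G.rev d))) ≈ₚ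
      (p (G.src (G.rev d))).trans ((G.edge (G.rev d)).map g.continuous) := by
  have key : ∀ {a b c e : Y} {α : Path a b} {β : Path b e} {γ : Path a c} {δ : Path c e},
      α.trans β ≈ₚ γ.trans δ → α.symm.trans γ ≈ₚ β.trans δ.symm := by
    intro a b c e α β γ δ h
    have h₁ := HHomotopic.eq_symm_trans h
    refine (HHomotopic.trans ?_ (HHomotopic.congr_trans h₁ (.refl δ.symm)).symm)
    exact (HHomotopic.congr_trans (.refl _) (HHomotopic.trans_symm_cancel γ δ).symm).trans
      (HHomotopic.assoc _ _ _).symm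
  have h' := key h
  have e : ∀ k : C(G.Realization, Y), (G.edge (G.rev d)).map k.continuous ≈ₚ
      ((G.edge d).map k.continuous).symm := fun k => (G.edge_rev d).map k
  have hp : p (G.tgt (G.rev d)) ≈ₚ p (G.src d) := by rw [tgt_rev]
  exact (HHomotopic.congr_trans (e f) hp).trans (h'.trans (.congr_trans (.refl _) (e g).symm))

/-- The path from `p s` to `q s` along `p` to its start, along `r`, and along `q` to `q s`. -/
noncomputable def slide {a b c d : Y} (p : Path a c) (r : Path a b) (q : Path b d)
    (s : unitInterval) : Path (p s) (q s) :=
  ((p.subpath s 0).trans (r.cast p.source q.source)).trans (q.subpath 0 s)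

theorem continuous_slide {a b c d : Y} (p : Path a c) (r : Path a b) (q : Path b d) :
    Continuous fun x : unitInterval × unitInterval => slide p r q x.1 x.2 := by
  have h₁ : Continuous fun x : unitInterval × unitInterval => p.subpath x.1 0 x.2 :=
    p.subpath_continuous_family.comp
      (continuous_fst.prodMk (continuous_const.prodMk continuous_snd))
  have h₂ : Continuous fun x : unitInterval × unitInterval => q.subpath 0 x.1 x.2 :=
    q.subpath_continuous_family.comp (continuous_const.prodMk continuous_id)
  have h₃ : Continuous fun x : unitInterval × unitInterval => r.cast p.source q.source x.2 :=
    r.continuous.comp continuous_snd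
  exact Path.trans_continuous_family
    (fun s => (p.subpath s 0).trans (r.cast p.source q.source))
    (Path.trans_continuous_family (fun s => p.subpath s 0) h₁
      (fun _ => r.cast p.source q.source) h₃) (fun s => q.subpath 0 s) h₂

theorem slide_zero {a b c d : Y} (p : Path a c) (r : Path a b) (q : Path b d) :
    slide p r q 0 ≈ₚ r := by
  unfold slide
  rw [subpath_self, subpath_self]
  exact (HHomotopic.trans_refl _).trans ((HHomotopic.refl_trans _).trans (.cast_left _ _ _))

theorem slide_one {a b c d : Y} (p : Path a c) (r : Path a b) (q : Path b d) :
    slide p r q 1 ≈ₚ (p.symm.trans r).trans q := by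
  unfold slide
  rw [← symm_subpath, subpath_zero_one, subpath_zero_one]
  exact .congr_trans (.congr_trans (HHomotopic.cast_left _ _ _).congr_symm (.cast_left _ _ _))
    (.cast_left _ _ _)

/-- A continuous family of paths for every edge gives a homotopy. -/
theorem exists_family (y : G.V → C(unitInterval, Y))
    (fam : ∀ d, ∀ s : unitInterval, Path (y (G.src d) s) (y (G.tgt d) s))
    (hfam : ∀ d, Continuous fun x : unitInterval × unitInterval => fam d x.1 x.2) :
    ∃ K : unitInterval → C(G.Realization, Y), (K 0).Homotopic (K 1) ∧
      (∀ v s, K s (G.vtx v) = y v s) ∧ ∀ d, G.Pos d → ∀ s t, K s (G.pt d t) = fam d s t := by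
  let P : G.D → C(unitInterval, C(unitInterval, Y)) := fun d =>
    ContinuousMap.curry ⟨fun x => fam d x.2 x.1, (hfam d).comp continuous_swap⟩
  let K : C(G.Realization, C(unitInterval, Y)) :=
    lift y P (fun d => by ext s; exact (fam d s).source) (fun d => by ext s; exact (fam d s).target)
  have hK : Continuous fun x : unitInterval × G.Realization => K x.2 x.1 := by fun_prop
  refine ⟨fun s => ⟨fun x => K x s, by fun_prop⟩, ⟨⟨⟨_, hK⟩, fun x => rfl, fun x => rfl⟩⟩,
    fun v s => rfl, fun d hd s t => ?_⟩
  change K (G.pt d t) s = P d t s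
  exact congrArg (fun k : C(unitInterval, Y) => k s) (lift_pt hd t)

/-- Maps of graphs are homotopic if there are paths between the images of the vertices that are
compatible with the images of the edges. -/
theorem homotopic_of_squares {f g : C(G.Realization, Y)}
    (p : ∀ v, Path (f (G.vtx v)) (g (G.vtx v)))
    (h : ∀ d, ((G.edge d).map f.continuous).trans (p (G.tgt d)) ≈ₚ
        (p (G.src d)).trans ((G.edge d).map g.continuous) ∨
      ((G.edge (G.rev d)).map f.continuous).trans (p (G.tgt (G.rev d))) ≈ₚ
        (p (G.src (G.rev d))).trans ((G.edge (G.rev d)).map g.continuous)) :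
    f.Homotopic g := by
  have h : ∀ d, ((G.edge d).map f.continuous).trans (p (G.tgt d)) ≈ₚ
      (p (G.src d)).trans ((G.edge d).map g.continuous) := by
    intro d
    rcases h d with h | h
    · exact h
    · have := square_rev h
      rwa [G.rev_rev] at this
  -- At time `s` the vertices have moved along `p` up to `s`, and an edge runs back along `p`, over
  -- its image under `f`, and out again. At time `1` this is the conjugate of `f` by `p`, which the
  -- square identifies with `g`. The remaining errors at times `0` and `1` are homotopies relative
  -- to the vertices.
  obtain ⟨K, hev, hKv, hKp⟩ := exists_family (fun v => (p v).toContinuousMap)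
    (fun d s => slide (p (G.src d)) ((G.edge d).map f.continuous) (p (G.tgt d)) s)
    (fun d => continuous_slide _ _ _)
  have h0 : f.Homotopic (K 0) := by
    refine (exists_homotopy_rel (fun v => ((hKv v 0).trans (p v).source).symm)
      fun d hd => ?_).elim fun H _ => ⟨H⟩
    · have h1 : (G.edge d).map (K 0).continuous ≈ₚ slide (p (G.src d))
          ((G.edge d).map f.continuous) (p (G.tgt d)) 0 :=
        .of_forall_eq fun t => hKp d hd 0 t
      exact (h1.trans (slide_zero _ _ _)).symm
  have h1 : (K 1).Homotopic g := by
    refine (exists_homotopy_rel (fun v => (hKv v 1).trans (p v).target)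
      fun d hd => ?_).elim fun H _ => ⟨H⟩
    · have h1 : (G.edge d).map (K 1).continuous ≈ₚ slide (p (G.src d))
          ((G.edge d).map f.continuous) (p (G.tgt d)) 1 :=
        .of_forall_eq fun t => hKp d hd 1 t
      refine (h1.trans (slide_one _ _ _)).trans ?_
      exact (HHomotopic.assoc _ _ _).trans ((HHomotopic.congr_trans (.refl _) (h d)).trans
        ((HHomotopic.assoc _ _ _).symm.trans (.trans_of_left (.symm_trans _))))
  exact h0.trans (hev.trans h1)

end Lift

/-! ### Morphisms on points and edges -/

namespace Hom

variable {G H : FinGraph} (f : Hom G H)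

theorem realize_vtx (v : G.V) : f.realize (G.vtx v) = H.vtx (f.onV v) := rfl

theorem realize_pt_inr {d : G.D} {e : H.D} (h : f.onD d = Sum.inr e) (t : unitInterval) :
    f.realize (G.pt d t) = H.pt e t := by
  change Quot.mk H.Glue (f.pre (Sum.inr (d, t))) = _
  simp only [pre, h, Sum.elim_inr]
  rfl

theorem realize_pt_inl {d : G.D} {v : H.V} (h : f.onD d = Sum.inl v) (t : unitInterval) :
    f.realize (G.pt d t) = H.vtx v := by
  change Quot.mk H.Glue (f.pre (Sum.inr (d, t))) = _
  simp only [pre, h, Sum.elim_inl]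
  rfl

theorem map_edge_inr {d : G.D} {e : H.D} (h : f.onD d = Sum.inr e) :
    (G.edge d).map f.realize.continuous ≈ₚ H.edge e :=
  .of_forall_eq fun t => f.realize_pt_inr h t

theorem map_edge_inl {d : G.D} {v : H.V} (h : f.onD d = Sum.inl v) :
    (G.edge d).map f.realize.continuous ≈ₚ Path.refl (H.vtx v) :=
  .of_forall_eq fun t => f.realize_pt_inl h t

theorem onD_rev_inr {d : G.D} {e : H.D} (h : f.onD d = Sum.inr e) :
    f.onD (G.rev d) = Sum.inr (H.rev e) := by rw [f.map_rev, h]; rfl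

theorem onD_rev_inl {d : G.D} {v : H.V} (h : f.onD d = Sum.inl v) :
    f.onD (G.rev d) = Sum.inl v := by rw [f.map_rev, h]; rfl

theorem src_inr {d : G.D} {e : H.D} (h : f.onD d = Sum.inr e) :
    H.src e = f.onV (G.src d) := by simpa [h] using f.map_src d

theorem tgt_inr {d : G.D} {e : H.D} (h : f.onD d = Sum.inr e) :
    H.tgt e = f.onV (G.tgt d) := f.src_inr (f.onD_rev_inr h)

theorem src_inl {d : G.D} {v : H.V} (h : f.onD d = Sum.inl v) :
    f.onV (G.src d) = v := by simpa [h] using (f.map_src d).symm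

theorem tgt_inl {d : G.D} {v : H.V} (h : f.onD d = Sum.inl v) :
    f.onV (G.tgt d) = v := f.src_inl (f.onD_rev_inl h)

end Hom

end FinGraph

/-! ## Every path between vertices is homotopic to an edge path -/

namespace FinGraph

variable {G : FinGraph}

/-! ### Functions that separate the points of a graph -/

open Classical in
/-- The piecewise linear function with value `1` at the vertex `v` and `0` at all others. -/
noncomputable def hat (v : G.V) : C(G.Realization, ℝ) :=
  lift (fun u => if u = v then 1 else 0)
    (fun d => ⟨fun t => (1 - (t : ℝ)) * (if G.src d = v then 1 else 0) +
      t * (if G.tgt d = v then 1 else 0), by fun_prop⟩) (fun d => by simp) (fun d => by simp)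

theorem hat_self (v : G.V) : hat v (G.vtx v) = 1 := if_pos rfl

theorem hat_of_ne {u v : G.V} (h : u ≠ v) : hat v (G.vtx u) = 0 := if_neg h

theorem vtx_injective : Injective G.vtx := fun u v h => by
  by_contra huv
  have := congrArg (hat v) h
  rw [hat_self, hat_of_ne huv] at this
  exact zero_ne_one this

open Classical in
/-- The function `t ↦ t ^ k * (1 - t)` on the edge `d`, extended by zero. -/
noncomputable def bump (k : ℕ) (d : G.D) : C(G.Realization, ℝ) :=
  lift (fun _ => 0)
    (fun e => if e = d then ⟨fun t => (t : ℝ) ^ (k + 1) * (1 - t), by fun_prop⟩ else 0)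
    (fun e => by split_ifs <;> simp) (fun e => by split_ifs <;> simp)

theorem bump_vtx (k : ℕ) (d : G.D) (v : G.V) : bump k d (G.vtx v) = 0 := rfl

theorem bump_pt (k : ℕ) {d : G.D} (hd : G.Pos d) (t : unitInterval) :
    bump k d (G.pt d t) = (t : ℝ) ^ (k + 1) * (1 - t) := by
  unfold bump
  rw [lift_pt hd, if_pos rfl]
  rfl

theorem bump_pt_of_ne (k : ℕ) {d e : G.D} (he : G.Pos e) (h : e ≠ d) (t : unitInterval) :
    bump k d (G.pt e t) = 0 := by
  unfold bump
  rw [lift_pt he, if_neg h]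
  rfl

theorem bump_pos {k : ℕ} {d : G.D} (hd : G.Pos d) {t : unitInterval} (h₀ : 0 < t) (h₁ : t < 1) :
    0 < bump k d (G.pt d t) := by
  rw [bump_pt k hd]
  have h₀ : (0 : ℝ) < t := h₀
  have h₁ : (t : ℝ) < 1 := h₁
  have : (0 : ℝ) < 1 - t := by linarith
  positivity

theorem bump_ne_zero {k : ℕ} {d : G.D} {x : G.Realization} (h : bump k d x ≠ 0) (hd : G.Pos d) :
    ∃ t, 0 < t ∧ t < 1 ∧ x = G.pt d t := by
  rcases realization_cases x with ⟨v, rfl⟩ | ⟨e, t, he, h₀, h₁, rfl⟩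
  · exact absurd (bump_vtx k d v) h
  · by_cases hed : e = d
    · subst hed
      exact ⟨t, h₀, h₁, rfl⟩
    · exact absurd (bump_pt_of_ne k he hed t) h

/-- This recovers the parameter of a point inside an edge as a quotient of continuous functions on
the whole graph, hence as a continuous function of the point. -/
theorem bump_div {d : G.D} (hd : G.Pos d) {t : unitInterval} (h₀ : 0 < t) (h₁ : t < 1) :
    bump 1 d (G.pt d t) / bump 0 d (G.pt d t) = t := by
  have h := bump_pos (k := 0) hd h₀ h₁
  rw [div_eq_iff h.ne', bump_pt _ hd, bump_pt _ hd]
  ring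

theorem pt_ne_vtx {d : G.D} (hd : G.Pos d) {t : unitInterval} (h₀ : 0 < t) (h₁ : t < 1)
    (v : G.V) : G.pt d t ≠ G.vtx v := fun h => by
  have := bump_pos (k := 0) hd h₀ h₁
  rw [h, bump_vtx] at this
  exact this.false

theorem pt_eq_pt {d e : G.D} (hd : G.Pos d) (he : G.Pos e) {s t : unitInterval} (h₀ : 0 < s)
    (h₁ : s < 1) (h : G.pt d s = G.pt e t) : d = e ∧ s = t := by
  have hb := bump_pos (k := 0) hd h₀ h₁
  obtain rfl : e = d := by
    by_contra hed
    rw [h, bump_pt_of_ne 0 he hed] at hb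
    exact hb.false
  refine ⟨rfl, ?_⟩
  rcases eq_or_ne t 0 with rfl | ht₀
  · rw [pt_zero] at h
    exact absurd h (pt_ne_vtx hd h₀ h₁ _)
  rcases eq_or_ne t 1 with rfl | ht₁
  · rw [pt_one] at h
    exact absurd h (pt_ne_vtx hd h₀ h₁ _)
  have h₂ := bump_div hd h₀ h₁
  rw [h, bump_div hd (unitInterval.pos_iff_ne_zero.2 ht₀)
    (unitInterval.lt_one_iff_ne_one.2 ht₁)] at h₂
  exact (Subtype.ext h₂).symm

/-! ### Stretching, which pushes neighborhoods of the vertices into the vertices -/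

/-- The map of the unit interval that stretches the middle third. -/
noncomputable def stretchAux (t : unitInterval) : unitInterval :=
  Set.projIcc (0 : ℝ) 1 zero_le_one (3 * t - 1)

theorem continuous_stretchAux : Continuous stretchAux :=
  continuous_projIcc.comp (by fun_prop)

theorem stretchAux_of_le {t : unitInterval} (h : (t : ℝ) ≤ 1 / 3) : stretchAux t = 0 :=
  Set.projIcc_of_le_left _ (by linarith)

theorem stretchAux_of_ge {t : unitInterval} (h : 2 / 3 ≤ (t : ℝ)) : stretchAux t = 1 :=
  Set.projIcc_of_right_le _ (by linarith)

theorem stretchAux_zero : stretchAux 0 = 0 := stretchAux_of_le (by simp)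

theorem stretchAux_one : stretchAux 1 = 1 := stretchAux_of_ge (by simp; norm_num)

variable (G) in
/-- The map of a graph that stretches the middle third of every edge. -/
noncomputable def stretch : C(G.Realization, G.Realization) :=
  lift G.vtx (fun d => ⟨fun t => G.pt d (stretchAux t),
      (G.continuous_pt d).comp continuous_stretchAux⟩)
    (fun d => by
      change G.pt d (stretchAux 0) = _
      rw [stretchAux_zero, pt_zero])
    (fun d => by
      change G.pt d (stretchAux 1) = _
      rw [stretchAux_one, pt_one])

theorem stretch_vtx (v : G.V) : stretch G (G.vtx v) = G.vtx v := rfl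

theorem stretch_pt {d : G.D} (hd : G.Pos d) (t : unitInterval) :
    stretch G (G.pt d t) = G.pt d (stretchAux t) := lift_pt hd t

/-- On each edge the stretched parametrization and the original one are homotopic relative to the
end points, so the stretching is homotopic to the identity relative to the vertices. -/
theorem map_stretch {u v : G.V} (γ : Path (G.vtx u) (G.vtx v)) :
    γ.map (stretch G).continuous ≈ₚ γ := by
  obtain ⟨H, hH⟩ := exists_homotopy_rel (f := stretch G) (g := .id _) stretch_vtx (fun d hd => by
    let σ : Path (0 : unitInterval) 1 :=
      ⟨⟨stretchAux, continuous_stretchAux⟩, stretchAux_zero, stretchAux_one⟩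
    let τ : Path (0 : unitInterval) 1 := ⟨.id _, rfl, rfl⟩
    have h : σ.map (G.continuous_pt d) ≈ₚ τ.map (G.continuous_pt d) :=
      HHomotopic.map (.of_homotopic (homotopic_unitInterval σ τ)) ⟨_, G.continuous_pt d⟩
    have h₁ : (G.edge d).map (stretch G).continuous ≈ₚ σ.map (G.continuous_pt d) :=
      .of_forall_eq fun t => stretch_pt hd t
    have h₂ : (G.edge d).map (ContinuousMap.id _).continuous ≈ₚ τ.map (G.continuous_pt d) :=
      .of_forall_eq fun t => rfl
    exact h₁.trans (h.trans h₂.symm))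
  have hev : ∀ w, H.evalAt (G.vtx w) ≈ₚ Path.refl (G.vtx w) := fun w =>
    .of_forall_eq fun t => hH w t
  have h := HHomotopic.of_homotopic (Path.Homotopic.map_trans_evalAt H γ)
  exact (HHomotopic.trans_of_right (hev v)).symm.trans (h.trans (.trans_of_left (hev u)))

/-! ### Edge words, and paths between arbitrary points moved to the vertices -/

/-- Paths that are homotopic to a concatenation of edges. -/
inductive IsEdgeWord (G : FinGraph) : ∀ {a b : G.Realization}, Path a b → Prop
  | refl (v : G.V) : IsEdgeWord G (Path.refl (G.vtx v))
  | edge (d : G.D) : IsEdgeWord G (G.edge d)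
  | trans {a b c : G.Realization} {p : Path a b} {q : Path b c} :
      IsEdgeWord G p → IsEdgeWord G q → IsEdgeWord G (p.trans q)
  | congr {a b c d : G.Realization} {p : Path a b} {q : Path c d} :
      p ≈ₚ q → IsEdgeWord G p → IsEdgeWord G q

theorem IsEdgeWord.symm {a b : G.Realization} {p : Path a b} (h : IsEdgeWord G p) :
    IsEdgeWord G p.symm := by
  induction h with
  | refl v => exact .congr (.of_eq (by simp)) (.refl v)
  | edge d => exact .congr (G.edge_rev d) (.edge (G.rev d))
  | trans _ _ h₁ h₂ => exact .congr (.of_eq (by simp)) (h₂.trans h₁)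
  | congr e _ h => exact .congr e.congr_symm h

/-- Each point is linked to a vertex, an interior point of a positive edge to the initial vertex of
that edge. The two clauses determine the link up to homotopy, so the choice made in `tail` is
harmless. -/
theorem exists_tail (x : G.Realization) :
    ∃ (u : G.V) (κ : Path (G.vtx u) x), (∀ v, x = G.vtx v → κ ≈ₚ Path.refl (G.vtx v)) ∧
      ∀ d, G.Pos d → ∀ t, 0 < t → t < 1 → x = G.pt d t →
        ∀ σ : Path 0 t, κ ≈ₚ σ.map (G.continuous_pt d) := by
  rcases realization_cases x with ⟨v, rfl⟩ | ⟨d, t, hd, h₀, h₁, rfl⟩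
  · exact ⟨v, .refl _, fun w h => .refl_of_eq h, fun d hd t h₀ h₁ h =>
      absurd h.symm (pt_ne_vtx hd h₀ h₁ v)⟩
  · obtain ⟨σ⟩ : Nonempty (Path (0 : unitInterval) t) := Path.nonempty_unitInterval 0 t
    refine ⟨G.src d, (σ.map (G.continuous_pt d)).cast (G.pt_zero d).symm rfl, fun v h =>
      absurd h (pt_ne_vtx hd h₀ h₁ v), fun e he s hs₀ hs₁ h τ => ?_⟩
    obtain ⟨rfl, rfl⟩ := pt_eq_pt hd he h₀ h₁ h
    exact (HHomotopic.cast_left _ _ _).trans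
      (HHomotopic.map (.of_homotopic (homotopic_unitInterval σ τ)) ⟨_, G.continuous_pt d⟩)

/-- A vertex near the point `x`. -/
noncomputable def tailVertex (x : G.Realization) : G.V := (exists_tail x).choose

/-- A path along an edge from a nearby vertex to the point `x`. -/
noncomputable def tail (x : G.Realization) : Path (G.vtx (tailVertex x)) x :=
  (exists_tail x).choose_spec.choose

theorem tail_vtx {x : G.Realization} {v : G.V} (h : x = G.vtx v) :
    tail x ≈ₚ Path.refl (G.vtx v) :=
  (exists_tail x).choose_spec.choose_spec.1 v h

theorem tail_pt {d : G.D} (hd : G.Pos d) {t : unitInterval} (h₀ : 0 < t) (h₁ : t < 1)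
    (σ : Path 0 t) : tail (G.pt d t) ≈ₚ σ.map (G.continuous_pt d) :=
  (exists_tail (G.pt d t)).choose_spec.choose_spec.2 d hd t h₀ h₁ rfl σ

/-- Paths that become edge words when their end points are moved to nearby vertices. -/
def IsNearEdgeWord {x y : G.Realization} (p : Path x y) : Prop :=
  IsEdgeWord G (((tail x).trans p).trans (tail y).symm)

namespace IsNearEdgeWord

variable {x y z x' y' : G.Realization}

theorem congr {p : Path x y} {q : Path x' y'} (h : p ≈ₚ q) (hp : IsNearEdgeWord p) :
    IsNearEdgeWord q := by
  obtain ⟨rfl, rfl, h⟩ := h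
  exact IsEdgeWord.congr (.congr_trans (.congr_trans (.refl _) (.of_homotopic h)) (.refl _)) hp

theorem refl (x : G.Realization) : IsNearEdgeWord (Path.refl x) :=
  IsEdgeWord.congr (HHomotopic.trans (.congr_trans (.trans_refl _) (.refl _)) (.trans_symm _)).symm
    (IsEdgeWord.refl (tailVertex x))

theorem trans {p : Path x y} {q : Path y z} (hp : IsNearEdgeWord p) (hq : IsNearEdgeWord q) :
    IsNearEdgeWord (p.trans q) := by
  refine IsEdgeWord.congr ?_ (IsEdgeWord.trans hp hq)
  have h : (((tail x).trans p).trans (tail y).symm).trans ((tail y).trans q) ≈ₚ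
      (tail x).trans (p.trans q) :=
    (HHomotopic.assoc _ _ _).symm.trans
      ((HHomotopic.congr_trans (.symm_trans_cancel _ _) (.refl _)).trans (.assoc _ _ _))
  exact (HHomotopic.assoc _ _ _).symm.trans (.congr_trans h (.refl _))

theorem symm {p : Path x y} (hp : IsNearEdgeWord p) : IsNearEdgeWord p.symm :=
  IsEdgeWord.congr (HHomotopic.trans (.of_eq (by simp)) (HHomotopic.assoc _ _ _).symm)
    (IsEdgeWord.symm hp)

/-- Moved to vertices, an initial segment cancels against the tail of its end point and becomes
constant, unless `t = 1`, when it is the whole edge. -/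
theorem segment_zero {d : G.D} (hd : G.Pos d) {t : unitInterval} (σ : Path 0 t) :
    IsNearEdgeWord (σ.map (G.continuous_pt d)) := by
  have h₀ := tail_vtx (G.pt_zero d)
  rcases eq_or_ne t 0 with rfl | ht₀
  · have : σ.map (G.continuous_pt d) ≈ₚ Path.refl (G.pt d 0) :=
      HHomotopic.map (.of_homotopic (homotopic_unitInterval σ (.refl 0))) ⟨_, G.continuous_pt d⟩
    exact (IsNearEdgeWord.refl _).congr this.symm
  rcases eq_or_ne t 1 with rfl | ht₁
  · have h₁ := tail_vtx (G.pt_one d)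
    have : σ.map (G.continuous_pt d) ≈ₚ G.edge d :=
      (HHomotopic.map (.of_homotopic (homotopic_unitInterval σ ⟨.id _, rfl, rfl⟩))
        ⟨_, G.continuous_pt d⟩).trans (.of_forall_eq fun t => rfl)
    refine IsEdgeWord.congr (HHomotopic.symm ?_) (.edge d)
    exact (HHomotopic.trans_of_right (h₁.congr_symm.trans (.of_eq (by simp)))).trans
      ((HHomotopic.trans_of_left h₀).trans this)
  · have h₁ := tail_pt hd (unitInterval.pos_iff_ne_zero.2 ht₀)
      (unitInterval.lt_one_iff_ne_one.2 ht₁) σ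
    refine IsEdgeWord.congr (HHomotopic.symm ?_) (.refl (tailVertex (G.pt d 0)))
    exact (HHomotopic.congr_trans ((HHomotopic.trans_of_left h₀).trans h₁.symm) (.refl _)).trans
      ((HHomotopic.trans_symm _).trans
        (.refl_of_eq (h₁.1.trans ((G.pt_zero d).trans h₀.1.symm))))

theorem segment {d : G.D} (hd : G.Pos d) {s t : unitInterval} (σ : Path s t) :
    IsNearEdgeWord (σ.map (G.continuous_pt d)) := by
  obtain ⟨α⟩ : Nonempty (Path (0 : unitInterval) s) := Path.nonempty_unitInterval 0 s
  have h := (segment_zero hd α).symm.trans (segment_zero hd (α.trans σ))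
  refine h.congr ?_
  rw [Path.map_trans]
  exact (HHomotopic.assoc _ _ _).symm.trans (.trans_of_left (.symm_trans _))

end IsNearEdgeWord

/-- A path that stays in the set of vertices is constant. -/
theorem path_eq_refl_of_forall_vtx {x y : G.Realization} (γ : Path x y)
    (h : ∀ t, ∃ v, γ t = G.vtx v) : γ ≈ₚ Path.refl x := by
  obtain ⟨u, hu⟩ := h 0
  have hx : x = G.vtx u := by simpa using hu
  refine .of_forall_eq fun t => ?_
  obtain ⟨v, hv⟩ := h t
  rw [hv, Path.refl_apply, hx]
  by_contra hne
  have hvu : v ≠ u := fun e => hne (by rw [e])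
  have hc : Continuous fun s => hat u (γ s) := (hat u).continuous.comp γ.continuous
  -- On vertices `hat u` takes only the values `0` and `1`, so the intermediate value `1 / 2` is
  -- impossible.
  have hmem : (1 / 2 : ℝ) ∈ Set.Icc (hat u (γ t)) (hat u (γ 0)) := by
    rw [hu, hv, hat_self, hat_of_ne hvu]
    constructor <;> norm_num
  obtain ⟨s, hs⟩ := mem_range_of_exists_le_of_exists_ge hc ⟨t, hmem.1⟩ ⟨0, hmem.2⟩
  obtain ⟨w, hw⟩ := h s
  by_cases hwu : w = u
  · simp only [hw, hwu, hat_self] at hs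
    norm_num at hs
  · simp only [hw, hat_of_ne hwu] at hs
    norm_num at hs

/-- Every path between vertices is homotopic to an edge path. -/
theorem isEdgeWord {u v : G.V} (γ : Path (G.vtx u) (G.vtx v)) : IsEdgeWord G γ := by
  -- The set `none` consists of the times spent outside all closed middle thirds, as `2 / 9` is the
  -- value of `t * (1 - t)` at both ends of the middle third; `some d` consists of the times spent
  -- inside the edge `d`.
  let c : Option G.D → Set unitInterval
    | none => {s | ∀ d, G.Pos d → bump 0 d (γ s) < 2 / 9}
    | some d => {s | G.Pos d ∧ 0 < bump 0 d (γ s)}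
  have hb : ∀ d, Continuous fun s => bump 0 d (γ s) := fun d =>
    (bump 0 d).continuous.comp γ.continuous
  have hc₁ : ∀ i, IsOpen (c i) := by
    rintro (_ | d)
    · simp only [c, Set.ofPred_forall]
      exact isOpen_iInter_of_finite fun d => isOpen_iInter_of_finite fun _ =>
        isOpen_lt (hb d) continuous_const
    · exact isOpen_const.inter (isOpen_lt continuous_const (hb d))
  have hc₂ : Set.univ ⊆ ⋃ i, c i := by
    intro s _
    rw [Set.mem_iUnion]
    rcases realization_cases (γ s) with ⟨w, h⟩ | ⟨d, t, hd, h₀, h₁, h⟩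
    · refine ⟨none, fun d _ => ?_⟩
      rw [h, bump_vtx]
      norm_num
    · refine ⟨some d, hd, ?_⟩
      rw [h]
      exact bump_pos hd h₀ h₁
  obtain ⟨t, ht₀, ht, ⟨m, hm⟩, htc⟩ :=
    exists_monotone_Icc_subset_open_cover_unitInterval hc₁ hc₂
  let γ' := γ.map (stretch G).continuous
  -- After stretching, a piece of type `none` lies in the discrete set of vertices and is constant,
  -- and a piece of type `some d` is the image of a path in the parameter interval of `d`.
  have piece : ∀ n, IsNearEdgeWord (γ'.subpath (t n) (t (n + 1))) := by
    intro n
    obtain ⟨i, hi⟩ := htc n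
    have hmem : ∀ s, ∃ r ∈ c i, γ.subpath (t n) (t (n + 1)) s = γ r := by
      intro s
      obtain ⟨r, hr, h⟩ : γ.subpath (t n) (t (n + 1)) s ∈ γ '' Set.Icc (t n) (t (n + 1)) := by
        rw [← γ.range_subpath_of_le _ _ (ht (Nat.le_succ n))]
        exact Set.mem_range_self s
      exact ⟨r, hi hr, h.symm⟩
    rcases i with _ | d
    · refine (IsNearEdgeWord.refl _).congr (path_eq_refl_of_forall_vtx _ fun s => ?_).symm
      obtain ⟨r, hs, hr⟩ := hmem s
      change ∃ v, stretch G (γ.subpath (t n) (t (n + 1)) s) = G.vtx v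
      rw [hr]
      rcases realization_cases (γ r) with
        ⟨w, h⟩ | ⟨d, τ, hd, h₀, h₁, h⟩
      · exact ⟨w, by rw [h, stretch_vtx]⟩
      · have hs := hs d hd
        rw [h, bump_pt 0 hd] at hs
        rw [h, stretch_pt hd]
        rcases le_or_gt (τ : ℝ) (1 / 3) with h₃ | h₃
        · exact ⟨_, by rw [stretchAux_of_le h₃, pt_zero]⟩
        · exact ⟨_, by rw [stretchAux_of_ge (by nlinarith), pt_one]⟩
    · have hd : G.Pos d := (hmem 0).choose_spec.1.1
      have hpos : ∀ s, 0 < bump 0 d (γ.subpath (t n) (t (n + 1)) s) := fun s => by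
        obtain ⟨r, hs, hr⟩ := hmem s
        rw [hr]
        exact hs.2
      have hτ : ∀ s, ∃ τ : unitInterval, γ.subpath (t n) (t (n + 1)) s = G.pt d τ ∧
          (τ : ℝ) = bump 1 d (γ.subpath (t n) (t (n + 1)) s) /
            bump 0 d (γ.subpath (t n) (t (n + 1)) s) := by
        intro s
        obtain ⟨τ, h₀, h₁, h⟩ := bump_ne_zero (hpos s).ne' hd
        exact ⟨τ, h, by rw [h, bump_div hd h₀ h₁]⟩
      choose τ hτ₁ hτ₂ using hτ
      have hτc : Continuous τ := by
        refine continuous_induced_rng.2 ?_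
        have : (Subtype.val ∘ τ) = fun s => bump 1 d (γ.subpath (t n) (t (n + 1)) s) /
            bump 0 d (γ.subpath (t n) (t (n + 1)) s) := funext hτ₂
        rw [this]
        exact Continuous.div ((bump 1 d).continuous.comp (γ.subpath _ _).continuous)
          ((bump 0 d).continuous.comp (γ.subpath _ _).continuous) fun s => (hpos s).ne'
      let σ : Path (stretchAux (τ 0)) (stretchAux (τ 1)) :=
        ⟨⟨fun s => stretchAux (τ s), continuous_stretchAux.comp hτc⟩, rfl, rfl⟩
      refine (IsNearEdgeWord.segment hd σ).congr (.of_forall_eq fun s => ?_)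
      change _ = stretch G (γ.subpath (t n) (t (n + 1)) s)
      rw [hτ₁, stretch_pt hd]
      rfl
  have all : ∀ n, IsNearEdgeWord (γ'.subpath 0 (t n)) := by
    intro n
    induction n with
    | zero =>
      rw [ht₀, subpath_self]
      exact .refl _
    | succ n ih =>
      exact (ih.trans (piece n)).congr (.of_homotopic ⟨Path.Homotopy.subpathTransSubpath _ _ _ _⟩)
  have h := all m
  rw [hm m le_rfl, subpath_zero_one] at h
  have h : IsNearEdgeWord γ := h.congr ((HHomotopic.cast_left _ _ _).trans (map_stretch γ))
  exact .congr ((HHomotopic.trans_of_right ((tail_vtx rfl).congr_symm.trans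
    (.of_eq (by simp)))).trans (.trans_of_left (tail_vtx rfl))) h

end FinGraph

/-! ## Coverings of graphs and the action of paths on their fibers -/

namespace FinGraph

variable {G : FinGraph} {S : Type}

/-- The points in the second half of a positive edge `d`, seen through the bump functions. -/
def InSecondHalf (d : G.D) (x : G.Realization) : Prop :=
  G.Pos d ∧ 0 < bump 0 d x ∧ bump 0 d x < 2 * bump 1 d x

theorem inSecondHalf_pt {d : G.D} (hd : G.Pos d) {t : unitInterval} (h₀ : 0 < t) (h₁ : t < 1) :
    InSecondHalf d (G.pt d t) ↔ 1 / 2 < (t : ℝ) := by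
  have h := bump_pos (k := 0) hd h₀ h₁
  have h₀ : (0 : ℝ) < t := h₀
  have h₁ : (t : ℝ) < 1 := h₁
  have hp : (0 : ℝ) < t * (1 - t) := mul_pos h₀ (by linarith)
  have e : bump 1 d (G.pt d t) = t * bump 0 d (G.pt d t) := by
    rw [bump_pt _ hd, bump_pt _ hd]
    ring
  unfold InSecondHalf
  rw [e]
  constructor
  · rintro ⟨-, -, h'⟩
    nlinarith
  · intro h'
    exact ⟨hd, h, by nlinarith⟩

theorem InSecondHalf.unique {d e : G.D} {x : G.Realization} (hd : InSecondHalf d x)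
    (he : InSecondHalf e x) : d = e := by
  obtain ⟨t, h₀, h₁, rfl⟩ := bump_ne_zero hd.2.1.ne' hd.1
  obtain ⟨s, h₀', h₁', h⟩ := bump_ne_zero he.2.1.ne' he.1
  exact (pt_eq_pt hd.1 he.1 h₀ h₁ h).1

theorem isOpen_inSecondHalf (d : G.D) : IsOpen {x | InSecondHalf d x} :=
  isOpen_const.inter ((isOpen_lt continuous_const (bump 0 d).continuous).inter
    (isOpen_lt (bump 0 d).continuous (continuous_const.mul (bump 1 d).continuous)))

open Classical in
/-- The permutation by which the trivialization at the end of an edge differs from the one along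
the edge. -/
noncomputable def twist (Λ : G.D → Equiv.Perm S) (x : G.Realization) : Equiv.Perm S :=
  if h : ∃ d, InSecondHalf d x then Λ h.choose else 1

theorem twist_of_mem (Λ : G.D → Equiv.Perm S) {d : G.D} {x : G.Realization}
    (h : InSecondHalf d x) : twist Λ x = Λ d := by
  have hx : ∃ d, InSecondHalf d x := ⟨d, h⟩
  unfold twist
  rw [dif_pos hx, hx.choose_spec.unique h]

theorem twist_of_forall_not_mem (Λ : G.D → Equiv.Perm S) {x : G.Realization}
    (h : ∀ d, ¬ InSecondHalf d x) : twist Λ x = 1 :=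
  dif_neg fun ⟨d, hd⟩ => h d hd

/-- The interiors of the edges (`true`) and the complement of the midpoints (`false`). -/
def chartSet (G : FinGraph) : Bool → Set G.Realization
  | true => {x | ∃ d, G.Pos d ∧ 0 < bump 0 d x}
  | false => {x | ∀ d, G.Pos d → bump 0 d x ≠ 1 / 4}

/-- The change from the trivialization near the vertices to the given one. -/
noncomputable def chartTwist (Λ : G.D → Equiv.Perm S) : Bool → G.Realization → Equiv.Perm S
  | true => fun x => (twist Λ x)⁻¹
  | false => fun _ => 1

theorem isOpen_chartSet (G : FinGraph) (i : Bool) : IsOpen (chartSet G i) := by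
  cases i
  · simp only [chartSet, Set.ofPred_forall]
    exact isOpen_iInter_of_finite fun d => isOpen_iInter_of_finite fun _ =>
      isOpen_ne_fun (bump 0 d).continuous continuous_const
  · simp only [chartSet, Set.ofPred_exists]
    exact isOpen_iUnion fun d =>
      isOpen_const.inter (isOpen_lt continuous_const (bump 0 d).continuous)

theorem pt_mem_chartSet_true {d : G.D} (hd : G.Pos d) {t : unitInterval} (h₀ : 0 < t)
    (h₁ : t < 1) : G.pt d t ∈ chartSet G true := ⟨d, hd, bump_pos hd h₀ h₁⟩

theorem vtx_notMem_chartSet_true (v : G.V) : G.vtx v ∉ chartSet G true := fun ⟨d, _, h⟩ => by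
  rw [bump_vtx] at h
  exact h.false

theorem vtx_mem_chartSet_false (v : G.V) : G.vtx v ∈ chartSet G false := fun d _ => by
  rw [bump_vtx]
  norm_num

/-- The two charts overlap in the open edges without their midpoints, since `1 / 4` is the value of
`t * (1 - t)` at `1 / 2` only. The twist jumps only at midpoints and vertices, so it is locally
constant there, which is what continuity of the coordinate changes needs. -/
theorem twist_eventually (Λ : G.D → Equiv.Perm S) {x : G.Realization}
    (h₁ : x ∈ chartSet G true) (h₂ : x ∈ chartSet G false) :
    ∀ᶠ y in 𝓝 x, twist Λ y = twist Λ x := by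
  obtain ⟨d, hd, hb⟩ := h₁
  obtain ⟨t, h₀, h₁, rfl⟩ := bump_ne_zero hb.ne' hd
  have ht : (t : ℝ) ≠ 1 / 2 := by
    intro ht
    have := h₂ d hd
    rw [bump_pt _ hd, ht] at this
    norm_num at this
  rcases lt_or_gt_of_ne ht with h | h
  · have hn : ∀ y, 0 < bump 0 d y ∧ 2 * bump 1 d y < bump 0 d y → twist Λ y = 1 := by
      rintro y ⟨hy₁, hy₂⟩
      refine twist_of_forall_not_mem Λ fun e he => ?_
      obtain ⟨s, h₀', h₁', rfl⟩ := bump_ne_zero hy₁.ne' hd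
      obtain ⟨s', -, -, h'⟩ := bump_ne_zero he.2.1.ne' he.1
      obtain ⟨rfl, -⟩ := pt_eq_pt hd he.1 h₀' h₁' h'
      exact hy₂.not_gt he.2.2
    have ho : IsOpen {y | 0 < bump 0 d y ∧ 2 * bump 1 d y < bump 0 d y} :=
      (isOpen_lt continuous_const (bump 0 d).continuous).inter
        (isOpen_lt (continuous_const.mul (bump 1 d).continuous) (bump 0 d).continuous)
    have hx : 0 < bump 0 d (G.pt d t) ∧ 2 * bump 1 d (G.pt d t) < bump 0 d (G.pt d t) := by
      refine ⟨hb, ?_⟩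
      have e : bump 1 d (G.pt d t) = t * bump 0 d (G.pt d t) := by
        rw [bump_pt _ hd, bump_pt _ hd]
        ring
      rw [e]
      nlinarith
    filter_upwards [ho.mem_nhds hx] with y hy
    rw [hn y hy, hn _ hx]
  · have hx := (inSecondHalf_pt hd h₀ h₁).2 h
    filter_upwards [(isOpen_inSecondHalf d).mem_nhds hx] with y hy
    rw [twist_of_mem Λ hy, twist_of_mem Λ hx]

variable [TopologicalSpace S] [DiscreteTopology S]

open Classical in
/-- The covering with fiber `S` in which the edge `d` acts by the permutation `Λ d`. -/
noncomputable def cover (Λ : G.D → Equiv.Perm S) : FiberBundleCore Bool G.Realization S where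
  baseSet := chartSet G
  isOpen_baseSet := isOpen_chartSet G
  indexAt x := decide (x ∈ chartSet G true)
  mem_baseSet_at x := by
    by_cases hx : x ∈ chartSet G true
    · simp [hx]
    · rcases realization_cases x with ⟨v, rfl⟩ | ⟨d, t, hd, h₀, h₁, rfl⟩
      · simpa [hx] using vtx_mem_chartSet_false v
      · exact absurd (pt_mem_chartSet_true hd h₀ h₁) hx
  coordChange i j x := chartTwist Λ j x * (chartTwist Λ i x)⁻¹
  coordChange_self i x _ v := by simp
  continuousOn_coordChange i j := by
    rintro ⟨x, s⟩ ⟨⟨hi, hj⟩, -⟩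
    have key : ∀ᶠ y in 𝓝 x, chartTwist Λ j y * (chartTwist Λ i y)⁻¹ =
        chartTwist Λ j x * (chartTwist Λ i x)⁻¹ := by
      cases i <;> cases j
      · exact .of_forall fun y => rfl
      · filter_upwards [twist_eventually Λ hj hi] with y hy
        simp [chartTwist, hy]
      · filter_upwards [twist_eventually Λ hi hj] with y hy
        simp [chartTwist, hy]
      · exact .of_forall fun y => by simp
    refine ContinuousAt.continuousWithinAt ?_
    have h : (fun p : G.Realization × S => (chartTwist Λ j p.1 * (chartTwist Λ i p.1)⁻¹) p.2)
        =ᶠ[𝓝 (x, s)] fun p => (chartTwist Λ j x * (chartTwist Λ i x)⁻¹) p.2 := by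
      filter_upwards [continuous_fst.continuousAt.eventually key] with p hp
      rw [hp]
    refine (ContinuousAt.congr_of_eventuallyEq ?_ h)
    exact (continuous_of_discreteTopology.comp continuous_snd).continuousAt
  coordChange_comp i j k x _ v := by
    rw [← Equiv.Perm.mul_apply]
    simp [mul_assoc]

theorem isCoveringMap_cover (Λ : G.D → Equiv.Perm S) : IsCoveringMap (cover Λ).proj :=
  FiberBundle.isCoveringMap (F := S) (E := (cover Λ).Fiber)

/-- The point of the covering over `x` with coordinate `s` in the preferred trivialization. -/
def coverPt (Λ : G.D → Equiv.Perm S) (x : G.Realization) (s : S) : (cover Λ).TotalSpace := ⟨x, s⟩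

theorem coverPt_injective (Λ : G.D → Equiv.Perm S) (x : G.Realization) :
    Injective (coverPt Λ x) := fun s t h => by
  unfold coverPt at h
  exact eq_of_heq (Bundle.TotalSpace.mk.inj h).2

/-- The path `p` lifts to a path from the point `s` of the fiber to the point `t`. -/
def Transports (Λ : G.D → Equiv.Perm S) {a b : G.Realization} (p : Path a b) (s t : S) : Prop :=
  ∃ P : Path (coverPt Λ a s) (coverPt Λ b t),
    p ≈ₚ P.map (isCoveringMap_cover Λ).continuous

namespace Transports

variable {Λ : G.D → Equiv.Perm S} {a b c a' b' : G.Realization} {s t r : S}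

theorem congr {p : Path a b} {q : Path a' b'} (h : p ≈ₚ q) (hp : Transports Λ p s t) :
    Transports Λ q s t := by
  obtain ⟨rfl, rfl, h⟩ := h
  obtain ⟨P, hP⟩ := hp
  exact ⟨P, (HHomotopic.of_homotopic h).symm.trans hP⟩

theorem refl (x : G.Realization) (s : S) : Transports Λ (Path.refl x) s s := ⟨.refl _, .refl _⟩

theorem trans {p : Path a b} {q : Path b c} (hp : Transports Λ p s t) (hq : Transports Λ q t r) :
    Transports Λ (p.trans q) s r := by
  obtain ⟨P, hP⟩ := hp
  obtain ⟨Q, hQ⟩ := hq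
  refine ⟨P.trans Q, ?_⟩
  rw [Path.map_trans]
  exact .congr_trans hP hQ

theorem symm {p : Path a b} (hp : Transports Λ p s t) : Transports Λ p.symm t s := by
  obtain ⟨P, hP⟩ := hp
  exact ⟨P.symm, hP.congr_symm⟩

/-- The end of a lift depends only on the homotopy class of the path. All later statements that two
paths are not homotopic come from here. -/
theorem unique {p : Path a b} (h : Transports Λ p s t) (h' : Transports Λ p s r) : t = r := by
  obtain ⟨P, hP⟩ := h
  obtain ⟨Q, hQ⟩ := h'
  have hPQ : (P.map (isCoveringMap_cover Λ).continuous).Homotopic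
      (Q.map (isCoveringMap_cover Λ).continuous) := (hP.symm.trans hQ).homotopic
  have h₁ := (isCoveringMap_cover Λ).monodromy_map (.mk P)
  have h₂ := (isCoveringMap_cover Λ).monodromy_map (.mk Q)
  have h₃ : (Path.Homotopic.Quotient.mk P).map ⟨_, (isCoveringMap_cover Λ).continuous⟩ =
      (Path.Homotopic.Quotient.mk Q).map ⟨_, (isCoveringMap_cover Λ).continuous⟩ :=
    Path.Homotopic.Quotient.eq.2 hPQ
  have h₄ := h₁.symm.trans ((congrArg (fun γ => (isCoveringMap_cover Λ).monodromy γ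
    ⟨coverPt Λ a s, rfl⟩) h₃).trans h₂)
  exact coverPt_injective Λ b (congrArg Subtype.val h₄)

/-- In the chart of the open edge the lift has the constant coordinate `s`. This chart agrees with
the chart of the vertices on the first half and differs from it by `Λ d` on the second, so the
preferred coordinate jumps to `Λ d s` at `t = 1` although the lift is continuous. -/
theorem edge_of_pos {d : G.D} (hd : G.Pos d) (s : S) :
    Transports Λ (G.edge d) s (Λ d s) := by
  classical
  let c : unitInterval → S := fun t => if t = 1 then Λ d s else s
  let f : unitInterval → (cover Λ).TotalSpace := fun t => coverPt Λ (G.pt d t) (c t)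
  have hf : Continuous f := by
    refine continuous_iff_continuousAt.2 fun t₀ => ?_
    refine (FiberBundle.continuousAt_totalSpace S f).2 ⟨(G.continuous_pt d).continuousAt, ?_⟩
    change ContinuousAt (fun t => (cover Λ).coordChange ((cover Λ).indexAt (G.pt d t))
      ((cover Λ).indexAt (G.pt d t₀)) (G.pt d t) (c t)) t₀
    have idx : ∀ t, 0 < t → t < 1 → (cover Λ).indexAt (G.pt d t) = true := fun t h₀ h₁ =>
      decide_eq_true (pt_mem_chartSet_true hd h₀ h₁)
    have idv : ∀ v, (cover Λ).indexAt (G.vtx v) = false := fun v =>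
      decide_eq_false (vtx_notMem_chartSet_true v)
    have id₀ : (cover Λ).indexAt (G.pt d 0) = false := by rw [pt_zero, idv]
    have id₁ : (cover Λ).indexAt (G.pt d 1) = false := by rw [pt_one, idv]
    have cc : ∀ i j x r, (cover Λ).coordChange i j x r =
      (chartTwist Λ j x * (chartTwist Λ i x)⁻¹) r := fun _ _ _ _ => rfl
    have conv : ∀ k : S, (∀ᶠ t in 𝓝 t₀, (cover Λ).coordChange ((cover Λ).indexAt (G.pt d t))
        ((cover Λ).indexAt (G.pt d t₀)) (G.pt d t) (c t) = k) → ContinuousAt (fun t =>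
        (cover Λ).coordChange ((cover Λ).indexAt (G.pt d t))
        ((cover Λ).indexAt (G.pt d t₀)) (G.pt d t) (c t)) t₀ := fun k hk =>
      continuousAt_const.congr_of_eventuallyEq hk
    rcases eq_or_ne t₀ 0 with rfl | h₀
    · refine conv s ?_
      have ho : IsOpen {t : unitInterval | (t : ℝ) < 1 / 2} :=
        isOpen_lt continuous_subtype_val continuous_const
      filter_upwards [ho.mem_nhds (by simp)] with t ht
      have ht₁ : t < 1 := by
        have ht : (t : ℝ) < 1 / 2 := ht
        exact show (t : ℝ) < 1 by linarith
      have hc : c t = s := if_neg ht₁.ne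
      rw [id₀, cc, hc]
      rcases eq_or_ne t 0 with rfl | h₀
      · rw [id₀]
        simp
      · have h₀ := unitInterval.pos_iff_ne_zero.2 h₀
        have : twist Λ (G.pt d t) = 1 := twist_of_forall_not_mem Λ fun e he => by
          obtain ⟨r, -, -, h⟩ := bump_ne_zero he.2.1.ne' he.1
          obtain ⟨rfl, -⟩ := pt_eq_pt hd he.1 h₀ ht₁ h
          exact absurd ((inSecondHalf_pt hd h₀ ht₁).1 he) (not_lt.2 (le_of_lt ht))
        rw [idx t h₀ ht₁]
        simp [chartTwist, this]
    rcases eq_or_ne t₀ 1 with rfl | h₁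
    · refine conv (Λ d s) ?_
      have ho : IsOpen {t : unitInterval | 1 / 2 < (t : ℝ)} :=
        isOpen_lt continuous_const continuous_subtype_val
      filter_upwards [ho.mem_nhds (by simp; norm_num)] with t ht
      have ht₀ : 0 < t := by
        have ht : 1 / 2 < (t : ℝ) := ht
        exact show (0 : ℝ) < t by linarith
      rw [id₁, cc]
      rcases eq_or_ne t 1 with rfl | h₁
      · rw [id₁]
        simp [c]
      · have hc : c t = s := if_neg h₁
        have h₁ := unitInterval.lt_one_iff_ne_one.2 h₁
        rw [idx t ht₀ h₁, hc]
        simp [chartTwist, twist_of_mem Λ ((inSecondHalf_pt hd ht₀ h₁).2 ht)]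
    · have h₀ := unitInterval.pos_iff_ne_zero.2 h₀
      have h₁ := unitInterval.lt_one_iff_ne_one.2 h₁
      refine conv s ?_
      filter_upwards [isOpen_Ioo.mem_nhds ⟨h₀, h₁⟩] with t ht
      rw [idx t ht.1 ht.2, idx t₀ h₀ h₁, cc, show c t = s from if_neg ht.2.ne]
      simp
  have e₀ : f 0 = coverPt Λ (G.vtx (G.src d)) s := by
    simp only [f, c]
    rw [pt_zero, if_neg (by simp)]
  have e₁ : f 1 = coverPt Λ (G.vtx (G.tgt d)) (Λ d s) := by
    simp only [f, c]
    rw [pt_one, if_pos trivial]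
  exact ⟨⟨⟨f, hf⟩, e₀, e₁⟩, .of_forall_eq fun t => rfl⟩

theorem edge (hΛ : ∀ d, Λ (G.rev d) = (Λ d)⁻¹) (d : G.D) (s : S) :
    Transports Λ (G.edge d) s (Λ d s) := by
  by_cases hd : G.Pos d
  · exact edge_of_pos hd s
  · have h := (edge_of_pos (Λ := Λ) ((G.pos_rev d).2 hd) (Λ d s)).symm
    have hs : (Λ d)⁻¹ (Λ d s) = s := (Λ d).symm_apply_apply s
    rw [hΛ, hs] at h
    exact h.congr ((G.edge_rev d).congr_symm.trans (.of_eq (Path.symm_symm _)))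

end Transports

end FinGraph

/-! ## Morphisms that are homotopy equivalences -/

namespace FinGraph

/-! ### Detecting a single edge by a double covering -/

section Detection

variable {G : FinGraph}

open Classical in
/-- The permutations of two points that detect passages through the edge `a`. -/
noncomputable def flip (a d : G.D) : Equiv.Perm Bool :=
  if d = a ∨ d = G.rev a then Equiv.boolNot else 1

theorem flip_rev (a d : G.D) : flip a (G.rev d) = (flip a d)⁻¹ := by
  have h : (G.rev d = a ∨ G.rev d = G.rev a) ↔ (d = a ∨ d = G.rev a) := by
    rw [G.rev_eq_iff, G.rev_injective.eq_iff, or_comm]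
  unfold flip
  by_cases hd : d = a ∨ d = G.rev a
  · rw [if_pos hd, if_pos (h.2 hd)]
    rfl
  · rw [if_neg hd, if_neg (mt h.1 hd)]
    rfl

/-- In the double covering in which only `a` and its reverse exchange the sheets, `a` changes the
sheet and a constant path does not. -/
theorem not_edge_homotopic_refl (a : G.D) (x : G.Realization) :
    ¬ G.edge a ≈ₚ Path.refl x := fun h => by
  have h₁ := (Transports.edge (flip_rev a) a false).congr h
  have h₂ := h₁.unique (Transports.refl x false)
  simp [flip] at h₂

/-- The double covering that detects `a` is trivial along `b`. -/
theorem not_edge_homotopic_edge {a b : G.D} (h₁ : b ≠ a) (h₂ : b ≠ G.rev a) :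
    ¬ G.edge a ≈ₚ G.edge b := fun h => by
  have h₃ := (Transports.edge (flip_rev a) a false).congr h
  have h₄ := h₃.unique (Transports.edge (flip_rev a) b false)
  simp [flip, h₁, h₂] at h₄

variable {H : FinGraph} {f : Hom G H}

/-- An edge that is collapsed by a homotopy equivalence is not a loop. -/
theorem src_ne_tgt_of_collapsed (hf : IsHomotopyEquivalence f.realize) {a : G.D} {v : H.V}
    (ha : f.onD a = Sum.inl v) : G.src a ≠ G.tgt a := by
  intro h
  let p : Path (G.vtx (G.src a)) (G.vtx (G.src a)) := (G.edge a).cast rfl (by rw [h])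
  have hp : p ≈ₚ G.edge a := .cast_left _ _ _
  have h₁ : p.map f.realize.continuous ≈ₚ
      (Path.refl (G.vtx (G.src a))).map f.realize.continuous := by
    refine (hp.map f.realize).trans ((f.map_edge_inl ha).trans ?_)
    exact .of_forall_eq fun t => congrArg H.vtx (f.src_inl ha).symm
  exact not_edge_homotopic_refl a _ (hp.symm.trans (hf.injective_path h₁))

/-- Edges that are identified by a homotopy equivalence have distinct end points. -/
theorem tgt_ne_tgt_of_identified (hf : IsHomotopyEquivalence f.realize) {a b : G.D} {e : H.D}
    (hab : G.src a = G.src b) (ha : f.onD a = Sum.inr e) (hb : f.onD b = Sum.inr e)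
    (h₁ : b ≠ a) (h₂ : b ≠ G.rev a) : G.tgt a ≠ G.tgt b := by
  intro h
  let p : Path (G.vtx (G.src a)) (G.vtx (G.tgt a)) := (G.edge b).cast (by rw [hab]) (by rw [h])
  have hp : p ≈ₚ G.edge b := .cast_left _ _ _
  have h₃ : (G.edge a).map f.realize.continuous ≈ₚ p.map f.realize.continuous :=
    (f.map_edge_inr ha).trans ((hp.map f.realize).trans (f.map_edge_inr hb)).symm
  exact not_edge_homotopic_edge h₁ h₂ ((hf.injective_path h₃).trans hp)

end Detection

/-! ### Collapses of single edges -/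

namespace Hom

variable {G H : FinGraph} {c : Hom G H} {a : G.D}

theorem connectedVia_pair_iff {u v : G.V} : G.ConnectedVia {a, G.rev a} u v ↔
    u = v ∨ (u = G.src a ∧ v = G.tgt a) ∨ (u = G.tgt a ∧ v = G.src a) := by
  constructor
  · intro h
    induction h with
    | refl => exact .inl rfl
    | tail _ hd ih =>
      obtain ⟨d, hd, rfl, rfl⟩ := hd
      rcases hd with rfl | rfl
      · rcases ih with rfl | ⟨rfl, h⟩ | ⟨rfl, h⟩
        · exact .inr (.inl ⟨rfl, rfl⟩)
        · exact .inr (.inl ⟨rfl, rfl⟩)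
        · exact .inl rfl
      · rw [tgt_rev]
        rw [src_rev] at ih
        rcases ih with rfl | ⟨rfl, h⟩ | ⟨rfl, h⟩
        · exact .inr (.inr ⟨rfl, rfl⟩)
        · exact .inl rfl
        · exact .inr (.inr ⟨rfl, rfl⟩)
  · rintro (rfl | ⟨rfl, rfl⟩ | ⟨rfl, rfl⟩)
    · exact .refl
    · exact .single ⟨a, by simp, rfl, rfl⟩
    · exact .single ⟨G.rev a, by simp, rfl, G.tgt_rev a⟩

theorem isForest_pair_iff : G.IsForest {a, G.rev a} ↔ G.src a ≠ G.tgt a := by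
  have h₀ : ∀ u v, G.ConnectedVia ∅ u v ↔ u = v := by
    intro u v
    refine ⟨fun h => ?_, fun h => h ▸ .refl⟩
    induction h with
    | refl => rfl
    | tail _ hd _ => exact absurd hd.choose_spec.1 (Set.notMem_empty _)
  constructor
  · intro h e
    refine h a (by simp) ?_
    rw [Set.sdiff_self]
    exact (h₀ _ _).2 e
  · rintro h d (rfl | rfl)
    · rw [Set.sdiff_self]
      exact fun e => h ((h₀ _ _).1 e)
    · rw [G.rev_rev, Set.pair_comm, Set.sdiff_self, tgt_rev, src_rev]
      exact fun e => h ((h₀ _ _).1 e).symm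

/-- For one geometric edge the conditions on forests and components turn into explicit conditions on
its end points. -/
theorem isEdgeCollapse_iff : c.IsEdgeCollapse a ↔
    G.src a ≠ G.tgt a ∧ (∀ d, (∃ v, c.onD d = Sum.inl v) ↔ d = a ∨ d = G.rev a) ∧
    Surjective c.onV ∧
    (∀ u v, c.onV u = c.onV v ↔
      u = v ∨ (u = G.src a ∧ v = G.tgt a) ∨ (u = G.tgt a ∧ v = G.src a)) ∧
    ∀ e : H.D, ∃! d : G.D, c.onD d = Sum.inr e := by
  have hc : c.collapsed = {a, G.rev a} ↔
      ∀ d, (∃ v, c.onD d = Sum.inl v) ↔ d = a ∨ d = G.rev a := Set.ext_iff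
  constructor
  · rintro ⟨⟨h₁, h₂, h₃, h₄⟩, h₅⟩
    rw [h₅] at h₁ h₃
    exact ⟨isForest_pair_iff.1 h₁, hc.1 h₅, h₂,
      fun u v => (h₃ u v).trans connectedVia_pair_iff, h₄⟩
  · rintro ⟨h₁, h₅, h₂, h₃, h₄⟩
    have h₅ := hc.2 h₅
    refine ⟨⟨?_, h₂, fun u v => ?_, h₄⟩, h₅⟩
    · rw [h₅]
      exact isForest_pair_iff.2 h₁
    · rw [h₅, h₃, connectedVia_pair_iff]

namespace IsEdgeCollapse

theorem ne (h : c.IsEdgeCollapse a) : G.src a ≠ G.tgt a := (isEdgeCollapse_iff.1 h).1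

theorem inl_iff (h : c.IsEdgeCollapse a) (d : G.D) :
    (∃ v, c.onD d = Sum.inl v) ↔ d = a ∨ d = G.rev a := (isEdgeCollapse_iff.1 h).2.1 d

theorem surjective (h : c.IsEdgeCollapse a) : Surjective c.onV := (isEdgeCollapse_iff.1 h).2.2.1

theorem onV_eq_iff (h : c.IsEdgeCollapse a) (u v : G.V) : c.onV u = c.onV v ↔
    u = v ∨ (u = G.src a ∧ v = G.tgt a) ∨ (u = G.tgt a ∧ v = G.src a) :=
  (isEdgeCollapse_iff.1 h).2.2.2.1 u v

theorem existsUnique (h : c.IsEdgeCollapse a) (e : H.D) : ∃! d : G.D, c.onD d = Sum.inr e :=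
  (isEdgeCollapse_iff.1 h).2.2.2.2 e

theorem exists_inl (h : c.IsEdgeCollapse a) : ∃ v, c.onD a = Sum.inl v :=
  (h.inl_iff a).2 (.inl rfl)

theorem onD_self (h : c.IsEdgeCollapse a) : c.onD a = Sum.inl (c.onV (G.src a)) := by
  obtain ⟨v, hv⟩ := h.exists_inl
  rw [hv, c.src_inl hv]

theorem exists_inr (h : c.IsEdgeCollapse a) {d : G.D} (h₁ : d ≠ a) (h₂ : d ≠ G.rev a) :
    ∃ e, c.onD d = Sum.inr e := by
  rcases hd : c.onD d with v | e
  · exact absurd ((h.inl_iff d).1 ⟨v, hd⟩) (by tauto)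
  · exact ⟨e, rfl⟩

theorem ne_of_inr (h : c.IsEdgeCollapse a) {d : G.D} {e : H.D} (hd : c.onD d = Sum.inr e) :
    d ≠ a ∧ d ≠ G.rev a := by
  rw [← not_or, ← h.inl_iff, hd]
  simp

theorem rev (h : c.IsEdgeCollapse a) : c.IsEdgeCollapse (G.rev a) := by
  refine ⟨h.1, ?_⟩
  rw [h.2, G.rev_rev, Set.pair_comm]

/-- The edge of the original graph that corresponds to an edge of the collapsed graph. -/
noncomputable def liftEdge (h : c.IsEdgeCollapse a) (e : H.D) : G.D := (h.existsUnique e).choose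

theorem onD_liftEdge (h : c.IsEdgeCollapse a) (e : H.D) : c.onD (h.liftEdge e) = Sum.inr e :=
  (h.existsUnique e).choose_spec.1

theorem liftEdge_eq (h : c.IsEdgeCollapse a) {d : G.D} {e : H.D} (hd : c.onD d = Sum.inr e) :
    h.liftEdge e = d := ((h.existsUnique e).choose_spec.2 d hd).symm

theorem liftEdge_rev (h : c.IsEdgeCollapse a) (e : H.D) :
    h.liftEdge (H.rev e) = G.rev (h.liftEdge e) :=
  h.liftEdge_eq (c.onD_rev_inr (h.onD_liftEdge e))

/-- A section on the vertices, with value `src a` at the image of `a`, and paths from the vertices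
of the section to all vertices. -/
theorem exists_section (h : c.IsEdgeCollapse a) : ∃ (σ : H.V → G.V)
    (κ : ∀ v, Path (G.vtx (σ (c.onV v))) (G.vtx v)), (∀ w, c.onV (σ w) = w) ∧
    (∀ v, v ≠ G.tgt a → κ v ≈ₚ Path.refl (G.vtx v)) ∧ κ (G.tgt a) ≈ₚ G.edge a := by
  classical
  obtain ⟨g, hg⟩ := h.surjective.hasRightInverse
  let σ : H.V → G.V := fun w => if g w = G.tgt a then G.src a else g w
  have hσ : ∀ w, c.onV (σ w) = w := by
    intro w
    by_cases hw : g w = G.tgt a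
    · simp only [σ, hw, if_true]
      rw [(h.onV_eq_iff _ _).2 (.inr (.inl ⟨rfl, rfl⟩)), ← hw, hg]
    · simp only [σ, hw, if_false]
      exact hg w
  have hne : ∀ w, σ w ≠ G.tgt a := by
    intro w
    by_cases hw : g w = G.tgt a
    · simp only [σ, hw, if_true]
      exact h.ne
    · simp only [σ, hw, if_false]
      exact hw
  have h₁ : ∀ v, v ≠ G.tgt a → σ (c.onV v) = v := by
    intro v hv
    rcases (h.onV_eq_iff _ _).1 (hσ (c.onV v)) with h₁ | h₁ | h₁
    · exact h₁
    · exact absurd h₁.2 hv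
    · exact absurd h₁.1 (hne _)
  have h₂ : σ (c.onV (G.tgt a)) = G.src a := by
    rw [← (h.onV_eq_iff (G.src a) (G.tgt a)).2 (.inr (.inl ⟨rfl, rfl⟩))]
    exact h₁ _ h.ne
  have hκ : ∀ v, ∃ κ : Path (G.vtx (σ (c.onV v))) (G.vtx v),
      (v ≠ G.tgt a → κ ≈ₚ Path.refl (G.vtx v)) ∧ (v = G.tgt a → κ ≈ₚ G.edge a) := by
    intro v
    by_cases hv : v = G.tgt a
    · subst hv
      exact ⟨(G.edge a).cast (by rw [h₂]) rfl, fun h => absurd rfl h, fun _ => .cast_left _ _ _⟩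
    · exact ⟨(Path.refl _).cast (by rw [h₁ v hv]) rfl, fun _ => .cast_left _ _ _,
        fun h => absurd h hv⟩
  choose κ hκ₁ hκ₂ using hκ
  exact ⟨σ, κ, hσ, hκ₁, hκ₂ _ rfl⟩

/-- The collapse of a single edge with distinct end points is a homotopy equivalence. -/
theorem isHomotopyEquivalence (h : c.IsEdgeCollapse a) : IsHomotopyEquivalence c.realize := by
  obtain ⟨σ, κ, hσ, hκ₁, hκ₂⟩ := h.exists_section
  have hκe : ∀ {u v : G.V}, u = v → κ u ≈ₚ κ v := by rintro u _ rfl; rfl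
  have hcκ : ∀ v, (κ v).map c.realize.continuous ≈ₚ Path.refl (H.vtx (c.onV v)) := by
    intro v
    by_cases hv : v = G.tgt a
    · subst hv
      obtain ⟨w, hw⟩ := h.exists_inl
      refine (hκ₂.map c.realize).trans ((c.map_edge_inl hw).trans ?_)
      rw [c.tgt_inl hw]
    · exact ((hκ₁ v hv).map c.realize).trans (.of_forall_eq fun t => rfl)
  -- The homotopy inverse sends an edge to its preimage, extended by the paths `κ` along `a` so that
  -- it starts and ends at vertices of the section.
  let P₀ : ∀ d, Path (G.vtx (σ (c.onV (G.src d)))) (G.vtx (σ (c.onV (G.tgt d)))) := fun d =>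
    ((κ (G.src d)).trans (G.edge d)).trans (κ (G.tgt d)).symm
  let P : ∀ e, Path (G.vtx (σ (H.src e))) (G.vtx (σ (H.tgt e))) := fun e =>
    (P₀ (h.liftEdge e)).cast (by rw [c.src_inr (h.onD_liftEdge e)])
      (by rw [c.tgt_inr (h.onD_liftEdge e)])
  have hP₀ : ∀ d, P₀ (G.rev d) ≈ₚ (P₀ d).symm := by
    intro d
    have h₁ : (P₀ d).symm ≈ₚ (κ (G.tgt d)).trans ((G.edge d).symm.trans (κ (G.src d)).symm) :=
      .of_eq (by simp [P₀])
    refine HHomotopic.trans ?_ h₁.symm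
    exact (HHomotopic.congr_trans (.congr_trans (.refl _) (G.edge_rev d))
      (hκe (G.tgt_rev d)).congr_symm).trans (.assoc _ _ _)
  have hPlift : ∀ {d e}, c.onD d = Sum.inr e → P e ≈ₚ P₀ d := by
    intro d e hd
    refine (HHomotopic.cast_left _ _ _).trans ?_
    rw [h.liftEdge_eq hd]
  let j : C(H.Realization, G.Realization) := ofPaths (fun w => G.vtx (σ w)) P
  have hj : ∀ e, (H.edge e).map j.continuous ≈ₚ P e := by
    intro e
    refine edge_map_ofPaths ?_
    have h₁ := hPlift (c.onD_rev_inr (h.onD_liftEdge e))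
    exact h₁.trans ((hP₀ _).trans (HHomotopic.cast_left _ _ _).symm.congr_symm)
  refine isHomotopyEquivalence_iff.2 ⟨j, ?_, ?_⟩
  -- The paths `κ` themselves give the homotopy from `j ∘ c` to the identity; they become constant
  -- under `c`, which settles the other composition.
  · refine homotopic_of_squares (fun v => κ v) fun d => ?_
    have hid : (G.edge d).map (ContinuousMap.id _).continuous ≈ₚ G.edge d :=
      .of_forall_eq fun t => rfl
    by_cases hd : d = a ∨ d = G.rev a
    · have key : ((G.edge a).map (j.comp c.realize).continuous).trans (κ (G.tgt a)) ≈ₚ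
        (κ (G.src a)).trans ((G.edge a).map (ContinuousMap.id _).continuous) := by
        obtain ⟨w, hw⟩ := h.exists_inl
        have h₁ : (G.edge a).map (j.comp c.realize).continuous ≈ₚ
            (Path.refl (H.vtx w)).map j.continuous := (c.map_edge_inl hw).map j
        have h₂ : (Path.refl (H.vtx w)).map j.continuous ≈ₚ Path.refl (j (H.vtx w)) :=
          .of_forall_eq fun t => rfl
        refine (HHomotopic.trans_of_left (h₁.trans h₂)).trans (hκ₂.trans ?_)
        exact ((HHomotopic.trans_of_left (hκ₁ _ h.ne)).trans (.of_forall_eq fun t => rfl)).symm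
      rcases hd with rfl | rfl
      · exact .inl key
      · refine .inr ?_
        rw [G.rev_rev]
        exact key
    · rw [not_or] at hd
      obtain ⟨e, he⟩ := h.exists_inr hd.1 hd.2
      have h₁ : (G.edge d).map (j.comp c.realize).continuous ≈ₚ P₀ d :=
        ((c.map_edge_inr he).map j).trans ((hj e).trans (hPlift he))
      exact .inl ((HHomotopic.congr_trans h₁ (.refl _)).trans
        ((HHomotopic.symm_trans_cancel _ _).trans (.congr_trans (.refl _) hid.symm)))
  · refine homotopic_of_squares (fun w => (Path.refl (H.vtx w)).cast
      (congrArg H.vtx (hσ w)) rfl) fun e => .inl ?_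
    have hd := h.onD_liftEdge e
    have h₁ : (H.edge e).map (c.realize.comp j).continuous ≈ₚ
        (P₀ (h.liftEdge e)).map c.realize.continuous :=
      ((hj e).map c.realize).trans ((hPlift hd).map c.realize)
    have h₂ : (P₀ (h.liftEdge e)).map c.realize.continuous ≈ₚ H.edge e := by
      simp only [P₀, Path.map_trans]
      refine (HHomotopic.trans_of_right (c' := _)
        ((hcκ _).congr_symm.trans (.of_eq (Path.refl_symm)))).trans ?_
      exact (HHomotopic.trans_of_left (hcκ _)).trans (c.map_edge_inr hd)
    have h₃ : (H.edge e).map (ContinuousMap.id _).continuous ≈ₚ H.edge e :=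
      .of_forall_eq fun t => rfl
    exact (HHomotopic.trans_of_right (.cast_left _ _ _)).trans (h₁.trans (h₂.trans
      ((HHomotopic.trans_of_left (.cast_left _ _ _)).trans h₃).symm))

end IsEdgeCollapse

end Hom

end FinGraph

/-! ## Constructions of graphs -/

namespace FinGraph

namespace Hom

variable {A B C D G H K : FinGraph}

theorem comp_assoc (u : Hom C D) (v : Hom B C) (w : Hom A B) :
    (u.comp v).comp w = u.comp (v.comp w) := by
  refine Hom.ext rfl (funext fun d => ?_)
  simp only [Hom.comp]
  rcases w.onD d with x | e <;> rfl

theorem id_comp (u : Hom A B) : (Hom.id B).comp u = u := by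
  refine Hom.ext rfl (funext fun d => ?_)
  simp only [Hom.comp, Hom.id]
  rcases u.onD d with x | e <;> rfl

theorem comp_onD_inr (u : Hom B C) {w : Hom A B} {d : A.D} {e : B.D} (h : w.onD d = Sum.inr e) :
    (u.comp w).onD d = u.onD e := by
  simp only [Hom.comp, h, Sum.elim_inr]

theorem comp_onD_inl (u : Hom B C) {w : Hom A B} {d : A.D} {v : B.V} (h : w.onD d = Sum.inl v) :
    (u.comp w).onD d = Sum.inl (u.onV v) := by
  simp only [Hom.comp, h, Sum.elim_inl]

theorem comp_onV (u : Hom B C) (w : Hom A B) (v : A.V) :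
    (u.comp w).onV v = u.onV (w.onV v) := rfl

namespace IsEdgeCollapse

variable {c : Hom G H} {a : G.D}

theorem hom_ext (h : c.IsEdgeCollapse a) {f g : Hom H K} (hfg : f.comp c = g.comp c) : f = g := by
  refine Hom.ext (funext fun w => ?_) (funext fun e => ?_)
  · obtain ⟨v, rfl⟩ := h.surjective w
    exact congrFun (congrArg Hom.onV hfg) v
  · rw [← comp_onD_inr f (h.onD_liftEdge e), ← comp_onD_inr g (h.onD_liftEdge e), hfg]

/-- A morphism that collapses `a` factors through the collapse of `a`. -/
theorem exists_factor (h : c.IsEdgeCollapse a) (f : Hom G K) {x : K.V}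
    (hf : f.onD a = Sum.inl x) : ∃ g : Hom H K, g.comp c = f := by
  obtain ⟨s, hs⟩ := h.surjective.hasRightInverse
  have hst : f.onV (G.src a) = f.onV (G.tgt a) := (f.src_inl hf).trans (f.tgt_inl hf).symm
  have hV : ∀ v, f.onV (s (c.onV v)) = f.onV v := by
    intro v
    rcases (h.onV_eq_iff _ _).1 (hs (c.onV v)) with h₁ | ⟨h₁, h₂⟩ | ⟨h₁, h₂⟩
    · rw [h₁]
    · rw [h₁, h₂, hst]
    · rw [h₁, h₂, hst]
  refine ⟨⟨fun w => f.onV (s w), fun e => f.onD (h.liftEdge e), fun e => ?_, fun e => ?_⟩, ?_⟩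
  · rw [f.map_src, c.src_inr (h.onD_liftEdge e), hV]
  · rw [h.liftEdge_rev, f.map_rev]
  · refine Hom.ext (funext hV) (funext fun d => ?_)
    rcases hd : c.onD d with v | e
    · rw [comp_onD_inl _ hd]
      rw [← c.src_inl hd, hV]
      rcases (h.inl_iff d).1 ⟨v, hd⟩ with rfl | rfl
      · rw [hf, f.src_inl hf]
      · rw [f.onD_rev_inl hf, f.src_inl (f.onD_rev_inl hf)]
    · rw [comp_onD_inr _ hd]
      change f.onD (h.liftEdge e) = f.onD d
      rw [h.liftEdge_eq hd]

/-- Two collapses of the same edge differ by an isomorphism. -/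
theorem exists_iso (h : c.IsEdgeCollapse a) {c' : Hom G K} (h' : c'.IsEdgeCollapse a) :
    ∃ (f : Hom H K) (g : Hom K H), g.comp f = Hom.id H ∧ f.comp g = Hom.id K ∧ f.comp c = c' := by
  obtain ⟨f, hf⟩ := h.exists_factor c' h'.onD_self
  obtain ⟨g, hg⟩ := h'.exists_factor c h.onD_self
  refine ⟨f, g, h.hom_ext ?_, h'.hom_ext ?_, hf⟩
  · rw [comp_assoc, hf, hg, id_comp]
  · rw [comp_assoc, hg, hf, id_comp]

end IsEdgeCollapse

/-- The bijection of edges given by an isomorphism of graphs. -/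
theorem exists_equiv_of_iso {f : Hom G H} {g : Hom H G} (h₁ : g.comp f = Hom.id G)
    (h₂ : f.comp g = Hom.id H) : Bijective f.onV ∧
      ∃ φ : G.D ≃ H.D, ∀ d, f.onD d = Sum.inr (φ d) := by
  have key : ∀ {A B : FinGraph} {u : Hom A B} {v : Hom B A}, v.comp u = Hom.id A →
      ∀ d, ∃ e, u.onD d = Sum.inr e ∧ v.onD e = Sum.inr d := by
    intro A B u v h d
    have hd : (v.comp u).onD d = Sum.inr d := by rw [h]; rfl
    rcases hu : u.onD d with x | e
    · rw [comp_onD_inl _ hu] at hd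
      exact absurd hd (by simp)
    · exact ⟨e, rfl, by rwa [comp_onD_inr _ hu] at hd⟩
  choose φ hφ hφ' using key h₁
  choose ψ hψ hψ' using key h₂
  refine ⟨Function.bijective_iff_has_inverse.2 ⟨g.onV, fun v => congrFun (congrArg Hom.onV h₁) v,
    fun v => congrFun (congrArg Hom.onV h₂) v⟩, ⟨φ, ψ, fun d => ?_, fun e => ?_⟩, hφ⟩
  · exact Sum.inr_injective ((hψ (φ d)).symm.trans (hφ' d))
  · exact Sum.inr_injective ((hφ (ψ e)).symm.trans (hψ' e))

end Hom

section Collapse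

variable (G : FinGraph)

open Classical in
/-- The collapse of the edge `a`; the terminal vertex of `a` is removed. -/
noncomputable abbrev collapse (a : G.D) (ha : G.src a ≠ G.tgt a) : FinGraph where
  V := {v // v ≠ G.tgt a}
  D := {d // d ≠ a ∧ d ≠ G.rev a}
  finV := inferInstance
  finD := inferInstance
  src d := if h : G.src d.1 = G.tgt a then ⟨G.src a, ha⟩ else ⟨G.src d.1, h⟩
  rev d := ⟨G.rev d.1, fun h => d.2.2 (G.rev_eq_iff.1 h), fun h => d.2.1 (G.rev_injective h)⟩
  rev_rev d := Subtype.ext (G.rev_rev d.1)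
  rev_ne d h := G.rev_ne d.1 (congrArg Subtype.val h)

variable {G}

/-- Every edge with distinct end points can be collapsed. -/
theorem exists_isEdgeCollapse {a : G.D} (ha : G.src a ≠ G.tgt a) :
    ∃ (H : FinGraph) (c : Hom G H), c.IsEdgeCollapse a := by
  classical
  let r : G.V → (G.collapse a ha).V := fun v =>
    if h : v = G.tgt a then ⟨G.src a, ha⟩ else ⟨v, h⟩
  have hr₁ : r (G.tgt a) = ⟨G.src a, ha⟩ := dif_pos rfl
  have hr₂ : ∀ v (h : v ≠ G.tgt a), r v = ⟨v, h⟩ := fun v h => dif_neg h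
  let c : Hom G (G.collapse a ha) :=
    { onV := r
      onD := fun d => if h : d ≠ a ∧ d ≠ G.rev a then Sum.inr ⟨d, h⟩ else Sum.inl (r (G.src a))
      map_src := fun d => by
        by_cases h : d ≠ a ∧ d ≠ G.rev a
        · simp only [h, dif_pos, and_self, ne_eq, not_false_eq_true, Sum.elim_inr]
          rfl
        · simp only [h, dif_neg, not_false_eq_true, Sum.elim_inl, id_eq]
          by_cases h' : d = a
          · rw [h']
          · have : d = G.rev a := by tauto
            rw [this, src_rev, hr₁, hr₂ _ ha]
      map_rev := fun d => by
        have e : (G.rev d ≠ a ∧ G.rev d ≠ G.rev a) ↔ (d ≠ a ∧ d ≠ G.rev a) := by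
          rw [ne_eq, G.rev_eq_iff, ne_eq, G.rev_injective.eq_iff, and_comm]
        by_cases h : d ≠ a ∧ d ≠ G.rev a
        · rw [dif_pos (e.2 h), dif_pos h]
          rfl
        · rw [dif_neg (mt e.1 h), dif_neg h]
          rfl }
  have hD₁ : ∀ d (h : d ≠ a ∧ d ≠ G.rev a), c.onD d = Sum.inr ⟨d, h⟩ := fun d h => dif_pos h
  have hD₂ : ∀ d, ¬(d ≠ a ∧ d ≠ G.rev a) → c.onD d = Sum.inl (r (G.src a)) := fun d h => dif_neg h
  refine ⟨G.collapse a ha, c, Hom.isEdgeCollapse_iff.2 ⟨ha, fun d => ?_, fun w => ?_,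
    fun u v => ?_, fun e => ?_⟩⟩
  · by_cases h : d ≠ a ∧ d ≠ G.rev a
    · rw [hD₁ d h]
      simp [h]
    · rw [hD₂ d h]
      simp only [Sum.inl.injEq, exists_eq', true_iff]
      tauto
  · exact ⟨w.1, hr₂ w.1 w.2⟩
  · change r u = r v ↔ _
    by_cases hu : u = G.tgt a <;> by_cases hv : v = G.tgt a
    · simp [hu, hv]
    · rw [hu, hr₁, hr₂ v hv, Subtype.mk.injEq]
      have := Ne.symm ha
      grind
    · rw [hv, hr₁, hr₂ u hu, Subtype.mk.injEq]
      grind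
    · rw [hr₂ u hu, hr₂ v hv, Subtype.mk.injEq]
      grind
  · refine ⟨e.1, hD₁ e.1 e.2, fun d hd => ?_⟩
    change c.onD d = Sum.inr e at hd
    by_cases h : d ≠ a ∧ d ≠ G.rev a
    · rw [hD₁ d h] at hd
      exact congrArg Subtype.val (Sum.inr_injective hd)
    · rw [hD₂ d h] at hd
      exact absurd hd (by simp)

end Collapse

section Split

variable (G : FinGraph)

open Classical in
/-- The graph in which the initial end points of the edges in `P` are moved from the vertex `v` to a
new vertex, which is joined to `v` by a new edge. -/
noncomputable abbrev split (v : G.V) (P : Set G.D) : FinGraph where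
  V := Option G.V
  D := G.D ⊕ Bool
  finV := inferInstance
  finD := inferInstance
  src
    | Sum.inl d => if d ∈ P then none else some (G.src d)
    | Sum.inr true => some v
    | Sum.inr false => none
  rev := Sum.map G.rev not
  rev_rev d := by rcases d with d | b <;> simp [G.rev_rev]
  rev_ne d := by rcases d with d | b <;> simp [G.rev_ne]

variable {G} {v : G.V} {P : Set G.D}

theorem split_src_of_mem {d : G.D} (h : d ∈ P) : (G.split v P).src (Sum.inl d) = none := if_pos h

theorem split_src_of_notMem {d : G.D} (h : d ∉ P) :
    (G.split v P).src (Sum.inl d) = some (G.src d) := if_neg h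

/-- The collapse of the new edge of a split graph. -/
def splitHom (hP : ∀ d ∈ P, G.src d = v) : Hom (G.split v P) G where
  onV
    | none => v
    | some u => u
  onD
    | Sum.inl d => Sum.inr d
    | Sum.inr _ => Sum.inl v
  map_src d := by
    rcases d with d | _ | _
    · by_cases h : d ∈ P
      · rw [split_src_of_mem h]
        exact hP d h
      · rw [split_src_of_notMem h]
        rfl
    · rfl
    · rfl
  map_rev d := by
    rcases d with d | _ | _ <;> rfl

theorem isEdgeCollapse_splitHom (hP : ∀ d ∈ P, G.src d = v) :
    (splitHom hP).IsEdgeCollapse (Sum.inr true) := by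
  have hs : (G.split v P).src (Sum.inr true) = some v := rfl
  have ht : (G.split v P).tgt (Sum.inr true) = none := rfl
  have hr : (G.split v P).rev (Sum.inr true) = Sum.inr false := rfl
  refine Hom.isEdgeCollapse_iff.2 ⟨by rw [hs, ht]; simp, fun d => ?_, fun u => ⟨some u, rfl⟩,
    fun u w => ?_, fun e => ⟨Sum.inl e, rfl, fun d hd => ?_⟩⟩
  · rw [hr]
    rcases d with d | _ | _ <;> simp [splitHom]
  · rw [hs, ht]
    rcases u with _ | u <;> rcases w with _ | w <;> simp [splitHom, eq_comm]
  · rcases d with d | b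
    · rw [Sum.inr_injective hd]
    · exact absurd hd (by simp [splitHom])

/-- The initial end points of the edges in `P` can be moved to a new vertex `H.tgt z`. -/
theorem exists_split (hP : ∀ d ∈ P, G.src d = v) :
    ∃ (H : FinGraph) (c : Hom H G) (z : H.D) (h : c.IsEdgeCollapse z), c.onV (H.src z) = v ∧
      ∀ d, H.src (h.liftEdge d) = H.tgt z ↔ d ∈ P := by
  refine ⟨G.split v P, splitHom hP, Sum.inr true, isEdgeCollapse_splitHom hP, rfl, fun d => ?_⟩
  rw [(isEdgeCollapse_splitHom hP).liftEdge_eq (d := Sum.inl d) rfl]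
  by_cases hd : d ∈ P
  · rw [split_src_of_mem hd]
    exact iff_of_true rfl hd
  · rw [split_src_of_notMem hd]
    exact iff_of_false (Option.some_ne_none _) hd

end Split

/-! ### Valences -/

theorem valence_eq_ncard (G : FinGraph) (v : G.V) : G.valence v = {d | G.src d = v}.ncard := rfl

namespace Hom.IsEdgeCollapse

variable {G H : FinGraph} {c : Hom G H} {a : G.D}

theorem valence_onV (h : c.IsEdgeCollapse a) (v : G.V) :
    H.valence (c.onV v) = ({d | c.onV (G.src d) = c.onV v} \ {a, G.rev a}).ncard := by
  have hi : Injective h.liftEdge := fun e e' he => Sum.inr_injective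
    ((h.onD_liftEdge e).symm.trans ((congrArg c.onD he).trans (h.onD_liftEdge e')))
  rw [valence_eq_ncard, ← Set.ncard_image_of_injective _ hi]
  congr 1
  ext d
  constructor
  · rintro ⟨e, he, rfl⟩
    have hd := h.onD_liftEdge e
    refine ⟨(c.src_inr hd).symm.trans he, ?_⟩
    have := h.ne_of_inr hd
    simp [this]
  · rintro ⟨hd, hne⟩
    simp only [Set.mem_insert_iff, Set.mem_singleton_iff, not_or] at hne
    obtain ⟨e, he⟩ := h.exists_inr hne.1 hne.2
    exact ⟨e, (c.src_inr he).trans hd, h.liftEdge_eq he⟩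

theorem valence_of_ne (h : c.IsEdgeCollapse a) {v : G.V} (h₁ : v ≠ G.src a) (h₂ : v ≠ G.tgt a) :
    H.valence (c.onV v) = G.valence v := by
  rw [h.valence_onV, valence_eq_ncard]
  congr 1
  ext d
  simp only [Set.mem_sdiff, Set.mem_ofPred_eq, Set.mem_insert_iff, Set.mem_singleton_iff,
    h.onV_eq_iff, not_or]
  constructor
  · rintro ⟨h₃ | h₃ | h₃, -⟩
    · exact h₃
    · exact absurd h₃.2 h₂
    · exact absurd h₃.2 h₁
  · intro h₃
    refine ⟨.inl h₃, ?_, ?_⟩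
    · rintro rfl
      exact h₁ h₃.symm
    · rintro rfl
      exact h₂ h₃.symm

/-- The stars of the two ends of `a` are disjoint because `a` is not a loop. The merged vertex keeps
all their edges except the two orientations of `a`. -/
theorem valence_src (h : c.IsEdgeCollapse a) :
    H.valence (c.onV (G.src a)) + 2 = G.valence (G.src a) + G.valence (G.tgt a) := by
  have hu : {d | c.onV (G.src d) = c.onV (G.src a)} =
      {d | G.src d = G.src a} ∪ {d | G.src d = G.tgt a} := by
    ext d
    simp only [Set.mem_union, Set.mem_ofPred_eq, h.onV_eq_iff]
    have := h.ne
    grind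
  have hd : Disjoint {d | G.src d = G.src a} {d | G.src d = G.tgt a} :=
    Set.disjoint_left.2 fun d h₁ h₂ => h.ne (h₁.symm.trans h₂)
  have hs : {a, G.rev a} ⊆ {d | G.src d = G.src a} ∪ {d | G.src d = G.tgt a} := by
    rintro d (rfl | rfl)
    · exact .inl rfl
    · exact .inr rfl
  rw [h.valence_onV, hu, valence_eq_ncard, valence_eq_ncard, ← Set.ncard_union_eq hd,
    ← Set.ncard_pair (G.rev_ne a).symm, Set.ncard_sdiff_add_ncard_of_subset hs]

/-- The merged vertex has valence at least `3 + 3 - 2`, and all others keep their valence. -/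
theorem three_le_valence (h : c.IsEdgeCollapse a) (hG : ∀ v, 3 ≤ G.valence v) (w : H.V) :
    3 ≤ H.valence w := by
  obtain ⟨v, rfl⟩ := h.surjective w
  have hs := h.valence_src
  have h₁ := hG (G.src a)
  have h₂ := hG (G.tgt a)
  by_cases hv₁ : v = G.src a
  · subst hv₁
    omega
  by_cases hv₂ : v = G.tgt a
  · have : c.onV v = c.onV (G.src a) := by
      rw [h.onV_eq_iff]
      exact .inr (.inr ⟨hv₂, rfl⟩)
    rw [this]
    omega
  rw [h.valence_of_ne hv₁ hv₂]
  exact hG v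

theorem liftEdge_injective (h : c.IsEdgeCollapse a) : Injective h.liftEdge := fun e e' he =>
  Sum.inr_injective ((h.onD_liftEdge e).symm.trans ((congrArg c.onD he).trans (h.onD_liftEdge e')))

theorem eq_or_exists_liftEdge (h : c.IsEdgeCollapse a) (d : G.D) :
    d = a ∨ d = G.rev a ∨ ∃ e, d = h.liftEdge e := by
  by_cases h₁ : d = a
  · exact .inl h₁
  by_cases h₂ : d = G.rev a
  · exact .inr (.inl h₂)
  obtain ⟨e, he⟩ := h.exists_inr h₁ h₂
  exact .inr (.inr ⟨e, (h.liftEdge_eq he).symm⟩)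

/-- The extra `1` counts `G.rev a`, the only edge at `G.tgt a` that does not come from `H`. -/
theorem valence_tgt (h : c.IsEdgeCollapse a) {P : Set H.D}
    (hP : ∀ e, G.src (h.liftEdge e) = G.tgt a ↔ e ∈ P) : G.valence (G.tgt a) = P.ncard + 1 := by
  have hs : {d | G.src d = G.tgt a} = insert (G.rev a) (h.liftEdge '' P) := by
    ext d
    simp only [Set.mem_ofPred_eq, Set.mem_insert_iff, Set.mem_image]
    rcases h.eq_or_exists_liftEdge d with rfl | rfl | ⟨e, rfl⟩
    · refine iff_of_false h.ne ?_
      rintro (h₁ | ⟨e, -, he⟩)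
      · exact G.rev_ne d h₁.symm
      · exact (h.ne_of_inr (h.onD_liftEdge e)).1 he
    · exact iff_of_true rfl (.inl rfl)
    · rw [hP]
      constructor
      · exact fun he => .inr ⟨e, he, rfl⟩
      · rintro (h₁ | ⟨e', he', h₁⟩)
        · exact absurd h₁ (h.ne_of_inr (h.onD_liftEdge e)).2
        · rwa [← h.liftEdge_injective h₁]
  have hn : G.rev a ∉ h.liftEdge '' P := by
    rintro ⟨e, -, he⟩
    exact (h.ne_of_inr (h.onD_liftEdge e)).2 he
  rw [valence_eq_ncard, hs, Set.ncard_insert_of_notMem hn,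
    Set.ncard_image_of_injective _ h.liftEdge_injective]

end Hom.IsEdgeCollapse

theorem Hom.valence_of_iso {G H : FinGraph} {f : Hom G H} {g : Hom H G}
    (h₁ : g.comp f = Hom.id G) (h₂ : f.comp g = Hom.id H) (v : G.V) :
    H.valence (f.onV v) = G.valence v := by
  obtain ⟨hV, φ, hφ⟩ := Hom.exists_equiv_of_iso h₁ h₂
  rw [valence_eq_ncard, valence_eq_ncard, ← Set.ncard_image_of_injective _ φ.injective]
  congr 1
  ext e
  obtain ⟨d, rfl⟩ := φ.surjective e
  rw [φ.injective.mem_set_image]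
  simp only [Set.mem_ofPred_eq, f.src_inr (hφ d), hV.1.eq_iff]

theorem Hom.IsEdgeCollapse.comp_of_iso {G G' H : FinGraph} {c : Hom G H} {a : G.D}
    (hc : c.IsEdgeCollapse a) {f : Hom G' G} {g : Hom G G'} (h₁ : g.comp f = Hom.id G')
    (h₂ : f.comp g = Hom.id G) : ∃ b, (c.comp f).IsEdgeCollapse b ∧ f.onD b = Sum.inr a := by
  obtain ⟨hV, φ, hφ⟩ := Hom.exists_equiv_of_iso h₁ h₂
  have hsrc : ∀ d, G.src (φ d) = f.onV (G'.src d) := fun d => f.src_inr (hφ d)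
  have htgt : ∀ d, G.tgt (φ d) = f.onV (G'.tgt d) := fun d => f.tgt_inr (hφ d)
  have hrev : ∀ d, φ (G'.rev d) = G.rev (φ d) := fun d =>
    Sum.inr_injective ((hφ _).symm.trans (f.onD_rev_inr (hφ d)))
  obtain ⟨b, rfl⟩ := φ.surjective a
  refine ⟨b, Hom.isEdgeCollapse_iff.2 ⟨?_, fun d => ?_, ?_, fun u v => ?_, fun e => ?_⟩, hφ b⟩
  · have := hc.ne
    rw [hsrc, htgt] at this
    exact fun h => this (by rw [h])
  · rw [Hom.comp_onD_inr _ (hφ d), hc.inl_iff, φ.injective.eq_iff, ← hrev, φ.injective.eq_iff]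
  · exact hc.surjective.comp hV.2
  · rw [Hom.comp_onV, Hom.comp_onV, hc.onV_eq_iff, hsrc, htgt]
    simp only [hV.1.eq_iff]
  · obtain ⟨d, hd, hu⟩ := hc.existsUnique e
    obtain ⟨d, rfl⟩ := φ.surjective d
    refine ⟨d, (Hom.comp_onD_inr _ (hφ d)).trans hd, fun d' hd' => φ.injective (hu _ ?_)⟩
    exact (Hom.comp_onD_inr c (hφ d')).symm.trans hd'

end FinGraph

/-! ## Removal of univalent and bivalent vertices -/

namespace FinGraph.Hom.IsEdgeCollapse

variable {G H K : FinGraph} {c₁ : Hom G H} {c₂ : Hom G K} {e a : G.D}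

/-- Two edges with different pairs of end points can be collapsed in either order. -/
theorem exists_square (h₁ : c₁.IsEdgeCollapse e) (h₂ : c₂.IsEdgeCollapse a) (hne : a ≠ e)
    (hne' : a ≠ G.rev e) (hp : ¬(G.src a = G.src e ∧ G.tgt a = G.tgt e))
    (hp' : ¬(G.src a = G.tgt e ∧ G.tgt a = G.src e)) :
    ∃ (L : FinGraph) (c₃ : Hom H L) (c₄ : Hom K L) (a₁ : H.D) (e₂ : K.D),
      c₁.onD a = Sum.inr a₁ ∧ c₂.onD e = Sum.inr e₂ ∧ c₃.IsEdgeCollapse a₁ ∧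
      c₄.IsEdgeCollapse e₂ ∧ c₃.comp c₁ = c₄.comp c₂ := by
  obtain ⟨a₁, ha₁⟩ := h₁.exists_inr hne hne'
  obtain ⟨e₂, he₂⟩ := h₂.exists_inr hne.symm fun h => hne' (by rw [h, G.rev_rev])
  -- Collapsing `e` could turn `a` into a loop only if `a` had the same end points as `e`.
  have hl : H.src a₁ ≠ H.tgt a₁ := by
    rw [c₁.src_inr ha₁, c₁.tgt_inr ha₁, ne_eq, h₁.onV_eq_iff]
    have := h₂.ne
    tauto
  obtain ⟨L, c₃, h₃⟩ := exists_isEdgeCollapse hl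
  have hf : (c₃.comp c₁).onD a = Sum.inl (c₃.onV (H.src a₁)) := by
    rw [comp_onD_inr _ ha₁, h₃.onD_self]
  obtain ⟨c₄, h₄⟩ := h₂.exists_factor _ hf
  refine ⟨L, c₃, c₄, a₁, e₂, ha₁, he₂, h₃, isEdgeCollapse_iff.2 ⟨?_, fun d => ?_, fun w => ?_,
    fun u v => ?_, fun x => ?_⟩, h₄.symm⟩
  · rw [c₂.src_inr he₂, c₂.tgt_inr he₂, ne_eq, h₂.onV_eq_iff]
    have := h₁.ne
    tauto
  · have hd := h₂.onD_liftEdge d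
    have hdn := h₂.ne_of_inr hd
    have hde : d = e₂ ∨ d = K.rev e₂ ↔ h₂.liftEdge d = e ∨ h₂.liftEdge d = G.rev e := by
      constructor
      · rintro (rfl | rfl)
        · exact .inl (h₂.liftEdge_eq he₂)
        · exact .inr (h₂.liftEdge_eq (c₂.onD_rev_inr he₂))
      · rintro (h | h)
        · rw [h, he₂] at hd
          exact .inl (Sum.inr_injective hd).symm
        · rw [h, c₂.onD_rev_inr he₂] at hd
          exact .inr (Sum.inr_injective hd).symm
    rw [hde, ← comp_onD_inr c₄ hd, h₄, ← h₁.inl_iff]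
    rcases hx : c₁.onD (h₂.liftEdge d) with v | x
    · rw [comp_onD_inl _ hx]
      simp
    · rw [comp_onD_inr _ hx, h₃.inl_iff]
      simp only [reduceCtorEq, exists_false, iff_false, not_or]
      constructor
      · rintro rfl
        exact hdn.1 ((h₁.liftEdge_eq hx).symm.trans (h₁.liftEdge_eq ha₁))
      · rintro rfl
        exact hdn.2 ((h₁.liftEdge_eq hx).symm.trans (h₁.liftEdge_eq (c₁.onD_rev_inr ha₁)))
  · obtain ⟨v, rfl⟩ := h₃.surjective w
    obtain ⟨v, rfl⟩ := h₁.surjective v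
    exact ⟨c₂.onV v, congrFun (congrArg Hom.onV h₄) v⟩
  · obtain ⟨u, rfl⟩ := h₂.surjective u
    obtain ⟨v, rfl⟩ := h₂.surjective v
    rw [← comp_onV c₄, ← comp_onV c₄, h₄, comp_onV, comp_onV, h₃.onV_eq_iff, c₁.src_inr ha₁,
      c₁.tgt_inr ha₁, c₂.src_inr he₂, c₂.tgt_inr he₂]
    simp only [h₁.onV_eq_iff, h₂.onV_eq_iff]
    have := h₁.ne
    have := h₂.ne
    grind
  · have hx := h₁.onD_liftEdge (h₃.liftEdge x)
    have hx' : (c₃.comp c₁).onD (h₁.liftEdge (h₃.liftEdge x)) = Sum.inr x := by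
      rw [comp_onD_inr _ hx, h₃.onD_liftEdge]
    rcases hy : c₂.onD (h₁.liftEdge (h₃.liftEdge x)) with v | y
    · rw [← h₄, comp_onD_inl _ hy] at hx'
      exact absurd hx' (by simp)
    · refine ⟨y, ?_, fun d hd => ?_⟩
      · change c₄.onD y = _
        rw [← comp_onD_inr c₄ hy, h₄, hx']
      · change c₄.onD d = _ at hd
        rw [← comp_onD_inr c₄ (h₂.onD_liftEdge d), h₄] at hd
        rcases hz : c₁.onD (h₂.liftEdge d) with v | z
        · rw [comp_onD_inl _ hz] at hd
          exact absurd hd (by simp)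
        · rw [comp_onD_inr _ hz] at hd
          have h₅ : h₁.liftEdge (h₃.liftEdge x) = h₂.liftEdge d := by
            rw [h₃.liftEdge_eq hd, h₁.liftEdge_eq hz]
          rw [h₅, h₂.onD_liftEdge] at hy
          exact Sum.inr_injective hy

/-- If `e` and `a` are the only edges at their common initial vertex, then the graph obtained by
the collapse of `e` is also obtained by the collapse of `a`. -/
theorem exists_slide (h : c₁.IsEdgeCollapse e) (hsrc : G.src a = G.src e) (hne : a ≠ e)
    (ha : G.src a ≠ G.tgt a) (hv : G.valence (G.src e) ≤ 2) :
    ∃ f : Hom G H, f.IsEdgeCollapse a ∧ c₁.realize.Homotopic f.realize := by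
  classical
  -- The bound on the valence leaves no room for an edge besides `e` and `a`.
  have hstar : ∀ d, G.src d = G.src e → d = e ∨ d = a := by
    have hs : {e, a} = {d | G.src d = G.src e} := by
      refine Set.eq_of_subset_of_ncard_le ?_ ?_ (Set.toFinite _)
      · rintro d (rfl | rfl)
        · rfl
        · exact hsrc
      · rw [Set.ncard_pair hne.symm]
        exact hv
    intro d hd
    have : d ∈ ({e, a} : Set G.D) := by rw [hs]; exact hd
    exact this
  have hne' : a ≠ G.rev e := fun h' => h.ne (by rw [← hsrc, h', src_rev])
  have hre : G.rev e ≠ a := fun h' => hne' h'.symm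
  have hea : e ≠ G.rev a := fun h' => hne' (by rw [h', G.rev_rev])
  have hee := h.ne
  obtain ⟨a₁, ha₁⟩ := h.exists_inr hne hne'
  have hsa₁ := c₁.src_inr ha₁
  have hta₁ := c₁.tgt_inr ha₁
  have hce : c₁.onV (G.src e) = c₁.onV (G.tgt e) :=
    (h.onV_eq_iff _ _).2 (.inr (.inl ⟨rfl, rfl⟩))
  -- The collapse of `a` is given the same target `H`: the common initial vertex goes to the far end
  -- of `a₁`, and the reverse of `e` takes over the role of `a`. All other edges avoid that vertex
  -- and are left alone.
  let fV : G.V → H.V := fun u => if u = G.src e then H.tgt a₁ else c₁.onV u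
  let fD : G.D → H.V ⊕ H.D := fun d => if d = a ∨ d = G.rev a then Sum.inl (H.tgt a₁) else
    if d = e then Sum.inr (H.rev a₁) else if d = G.rev e then Sum.inr a₁ else c₁.onD d
  have hV₁ : fV (G.src e) = H.tgt a₁ := if_pos rfl
  have hV₂ : ∀ u, u ≠ G.src e → fV u = c₁.onV u := fun u hu => if_neg hu
  have hD₁ : fD a = Sum.inl (H.tgt a₁) := if_pos (.inl rfl)
  have hD₂ : fD (G.rev a) = Sum.inl (H.tgt a₁) := if_pos (.inr rfl)
  have hD₃ : fD e = Sum.inr (H.rev a₁) := by simp [fD, hne.symm, hea]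
  have hD₄ : fD (G.rev e) = Sum.inr a₁ := by
    have h₁ : G.rev e ≠ G.rev a := fun h' => hne (G.rev_injective h').symm
    simp [fD, h₁, hre, G.rev_ne]
  have hD₅ : ∀ d, d ≠ a → d ≠ G.rev a → d ≠ e → d ≠ G.rev e → fD d = c₁.onD d := by
    intro d h₁ h₂ h₃ h₄
    simp [fD, h₁, h₂, h₃, h₄]
  have cases : ∀ d, d = a ∨ d = G.rev a ∨ d = e ∨ d = G.rev e ∨
      (d ≠ a ∧ d ≠ G.rev a ∧ d ≠ e ∧ d ≠ G.rev e) := by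
    intro d
    tauto
  let f : Hom G H :=
    { onV := fV
      onD := fD
      map_src := fun d => by
        rcases cases d with rfl | rfl | rfl | rfl | ⟨h₁, h₂, h₃, h₄⟩
        · rw [hD₁, hsrc, hV₁]
          rfl
        · rw [hD₂, src_rev, hV₂ _ (by rw [← hsrc]; exact ha.symm), ← hta₁]
          rfl
        · rw [hD₃, hV₁]
          rfl
        · rw [hD₄, src_rev, hV₂ _ hee.symm, ← hce, ← hsrc]
          exact hsa₁
        · rw [hD₅ d h₁ h₂ h₃ h₄, c₁.map_src, hV₂]
          intro h'
          rcases hstar d h' with h' | h' <;> contradiction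
      map_rev := fun d => by
        rcases cases d with rfl | rfl | rfl | rfl | ⟨h₁, h₂, h₃, h₄⟩
        · rw [hD₂, hD₁]
          rfl
        · rw [G.rev_rev, hD₂, hD₁]
          rfl
        · rw [hD₄, hD₃, Sum.map_inr, H.rev_rev]
        · rw [G.rev_rev, hD₃, hD₄]
          rfl
        · rw [hD₅ d h₁ h₂ h₃ h₄, hD₅, c₁.map_rev]
          · exact fun h' => h₂ (G.rev_eq_iff.1 h')
          · exact fun h' => h₁ (G.rev_injective h')
          · exact fun h' => h₄ (G.rev_eq_iff.1 h')
          · exact fun h' => h₃ (G.rev_injective h') }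
  have hc₅ : ∀ d, d ≠ e → d ≠ G.rev e → ∃ x, c₁.onD d = Sum.inr x := fun d h₁ h₂ =>
    h.exists_inr h₁ h₂
  refine ⟨f, isEdgeCollapse_iff.2 ⟨ha, fun d => ?_, fun w => ?_, fun u v => ?_, fun x => ?_⟩, ?_⟩
  · change (∃ v, fD d = Sum.inl v) ↔ _
    rcases cases d with rfl | rfl | rfl | rfl | ⟨h₁, h₂, h₃, h₄⟩
    · simp [hD₁]
    · simp [hD₂]
    · simp [hD₃, hne.symm, hea]
    · have h₁ : G.rev e ≠ G.rev a := fun h' => hne (G.rev_injective h').symm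
      rw [hD₄]
      simp [hre, h₁]
    · rw [hD₅ d h₁ h₂ h₃ h₄]
      obtain ⟨x, hx⟩ := hc₅ d h₃ h₄
      simp [hx, h₁, h₂]
  · obtain ⟨u, rfl⟩ := h.surjective w
    by_cases hu : u = G.src e
    · exact ⟨G.tgt e, (hV₂ _ hee.symm).trans (by rw [hu, hce])⟩
    · exact ⟨u, hV₂ u hu⟩
  · change fV u = fV v ↔ _
    rw [hsrc]
    have hta : G.tgt a ≠ G.src e := by rw [← hsrc]; exact ha.symm
    by_cases hu : u = G.src e <;> by_cases hv : v = G.src e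
    · simp [hu, hv]
    · rw [hu, hV₁, hV₂ v hv, hta₁, h.onV_eq_iff]
      grind
    · rw [hv, hV₁, hV₂ u hu, hta₁, h.onV_eq_iff]
      grind
    · rw [hV₂ u hu, hV₂ v hv, h.onV_eq_iff]
      grind
  · change ∃! d, fD d = Sum.inr x
    have ha₁' := c₁.onD_rev_inr ha₁
    have hra : H.rev a₁ ≠ a₁ := H.rev_ne a₁
    have key : ∀ d y, d ≠ a → d ≠ G.rev a → c₁.onD d = Sum.inr y → y ≠ a₁ ∧ y ≠ H.rev a₁ := by
      intro d y h₁ h₂ hy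
      refine ⟨fun h' => h₁ ?_, fun h' => h₂ ?_⟩
      · rw [← h.liftEdge_eq hy, h', h.liftEdge_eq ha₁]
      · rw [← h.liftEdge_eq hy, h', h.liftEdge_eq ha₁']
    by_cases hx₁ : x = a₁
    · subst hx₁
      refine ⟨G.rev e, hD₄, fun d hd => ?_⟩
      change fD d = _ at hd
      rcases cases d with rfl | rfl | rfl | rfl | ⟨h₁, h₂, h₃, h₄⟩
      · simp [hD₁] at hd
      · simp [hD₂] at hd
      · rw [hD₃] at hd
        exact absurd (Sum.inr_injective hd) hra
      · rfl
      · rw [hD₅ d h₁ h₂ h₃ h₄] at hd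
        exact absurd rfl (key d _ h₁ h₂ hd).1
    by_cases hx₂ : x = H.rev a₁
    · subst hx₂
      refine ⟨e, hD₃, fun d hd => ?_⟩
      change fD d = _ at hd
      rcases cases d with rfl | rfl | rfl | rfl | ⟨h₁, h₂, h₃, h₄⟩
      · simp [hD₁] at hd
      · simp [hD₂] at hd
      · rfl
      · rw [hD₄] at hd
        exact absurd (Sum.inr_injective hd).symm hra
      · rw [hD₅ d h₁ h₂ h₃ h₄] at hd
        exact absurd rfl (key d _ h₁ h₂ hd).2
    · have hx := h.onD_liftEdge x
      have hxe := h.ne_of_inr hx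
      have h₁ : h.liftEdge x ≠ a := fun h' => by
        rw [h', ha₁] at hx
        exact hx₁ (Sum.inr_injective hx).symm
      have h₂ : h.liftEdge x ≠ G.rev a := fun h' => by
        rw [h', ha₁'] at hx
        exact hx₂ (Sum.inr_injective hx).symm
      refine ⟨h.liftEdge x, ?_, fun d hd => ?_⟩
      · change fD _ = _
        rw [hD₅ _ h₁ h₂ hxe.1 hxe.2, hx]
      · change fD d = _ at hd
        rcases cases d with rfl | rfl | rfl | rfl | ⟨h₁, h₂, h₃, h₄⟩
        · simp [hD₁] at hd
        · simp [hD₂] at hd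
        · rw [hD₃] at hd
          exact absurd (Sum.inr_injective hd).symm hx₂
        · rw [hD₄] at hd
          exact absurd (Sum.inr_injective hd).symm hx₁
        · rw [hD₅ d h₁ h₂ h₃ h₄] at hd
          exact (h.liftEdge_eq hd).symm
  -- The homotopy drags the common initial vertex along `a₁` and fixes all other vertices.
  · have hκ : ∀ u, ∃ p : Path (c₁.realize (G.vtx u)) (f.realize (G.vtx u)),
        (u ≠ G.src e → p ≈ₚ Path.refl (H.vtx (c₁.onV u))) ∧ (u = G.src e → p ≈ₚ H.edge a₁) := by
      intro u
      by_cases hu : u = G.src e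
      · subst hu
        refine ⟨(H.edge a₁).cast ?_ ?_, fun h' => absurd rfl h', fun _ => .cast_left _ _ _⟩
        · rw [hsa₁, hsrc]
          rfl
        · exact congrArg H.vtx hV₁
      · exact ⟨(Path.refl (H.vtx (c₁.onV u))).cast rfl (congrArg H.vtx (hV₂ u hu)),
          fun _ => .cast_left _ _ _, fun h' => absurd h' hu⟩
    choose p hp₁ hp₂ using hκ
    refine homotopic_of_squares p fun d => ?_
    have hta : G.tgt a ≠ G.src e := by rw [← hsrc]; exact ha.symm
    have keya : ((G.edge a).map c₁.realize.continuous).trans (p (G.tgt a)) ≈ₚ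
        (p (G.src a)).trans ((G.edge a).map f.realize.continuous) :=
      (HHomotopic.trans_of_right (hp₁ _ hta)).trans ((c₁.map_edge_inr ha₁).trans
        ((HHomotopic.trans_of_right (f.map_edge_inl hD₁)).trans (hp₂ _ hsrc)).symm)
    have keye : ((G.edge e).map c₁.realize.continuous).trans (p (G.tgt e)) ≈ₚ
        (p (G.src e)).trans ((G.edge e).map f.realize.continuous) := by
      obtain ⟨w, hw⟩ := h.exists_inl
      have h₁ : (G.edge e).map c₁.realize.continuous ≈ₚ Path.refl (H.vtx w) := c₁.map_edge_inl hw
      have h₂ : (G.edge e).map f.realize.continuous ≈ₚ (H.edge a₁).symm :=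
        (f.map_edge_inr hD₃).trans (H.edge_rev a₁)
      refine ((HHomotopic.trans_of_right (hp₁ _ hee.symm)).trans h₁).trans ?_
      refine ((HHomotopic.congr_trans (hp₂ _ rfl) h₂).trans ((HHomotopic.trans_symm _).trans
        (.refl_of_eq ?_))).symm
      rw [hsa₁, hsrc, c₁.src_inl hw]
    rcases cases d with rfl | rfl | rfl | rfl | ⟨h₁, h₂, h₃, h₄⟩
    · exact .inl keya
    · refine .inr ?_
      rw [G.rev_rev]
      exact keya
    · exact .inl keye
    · refine .inr ?_
      rw [G.rev_rev]
      exact keye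
    · obtain ⟨x, hx⟩ := hc₅ d h₃ h₄
      have hs : G.src d ≠ G.src e := fun h' => by
        rcases hstar d h' with h' | h' <;> contradiction
      have ht : G.tgt d ≠ G.src e := fun h' => by
        rcases hstar (G.rev d) h' with h' | h'
        · exact h₄ (G.rev_eq_iff.1 h')
        · exact h₂ (G.rev_eq_iff.1 h')
      exact .inl ((HHomotopic.trans_of_right (hp₁ _ ht)).trans ((c₁.map_edge_inr hx).trans
        ((HHomotopic.trans_of_left (hp₁ _ hs)).trans
          (f.map_edge_inr ((hD₅ d h₁ h₂ h₃ h₄).trans hx))).symm))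

end FinGraph.Hom.IsEdgeCollapse

/-! ### Confluence of the removal of vertices of valence at most two -/

namespace MarkedGraph

variable {n : ℕ}

/-- `Γ'` is obtained from `Γ` by the collapse of an edge. -/
def CollapsesEdge (Γ Γ' : MarkedGraph n) : Prop :=
  ∃ (c : Hom Γ.G Γ'.G) (a : Γ.G.D), c.IsEdgeCollapse a ∧ Γ.Carries Γ' c

/-- `Γ'` is obtained from `Γ` by the collapse of an edge that starts at a vertex of valence at
most `2`. -/
def Removes (Γ Γ' : MarkedGraph n) : Prop :=
  ∃ (c : Hom Γ.G Γ'.G) (a : Γ.G.D),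
    c.IsEdgeCollapse a ∧ Γ.G.valence (Γ.G.src a) ≤ 2 ∧ Γ.Carries Γ' c

/-- Valence zero does not occur, since `a` starts at the vertex. -/
theorem removes_iff (Γ Γ' : MarkedGraph n) :
    Γ.Removes Γ' ↔ Γ.RemovesBivalent Γ' ∨ Γ.RemovesUnivalent Γ' := by
  constructor
  · rintro ⟨c, a, hc, hv, hm⟩
    have h₁ : 0 < Γ.G.valence (Γ.G.src a) :=
      (Set.ncard_pos (Set.toFinite {d | Γ.G.src d = Γ.G.src a})).2 ⟨a, rfl⟩
    rcases (by omega : Γ.G.valence (Γ.G.src a) = 2 ∨ Γ.G.valence (Γ.G.src a) = 1) with h | h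
    · exact .inl ⟨c, a, hc, h, hm⟩
    · exact .inr ⟨c, a, hc, h, hm⟩
  · rintro (⟨c, a, hc, hv, hm⟩ | ⟨c, a, hc, hv, hm⟩)
    · exact ⟨c, a, hc, hv.le, hm⟩
    · exact ⟨c, a, hc, by omega, hm⟩

theorem represents_iff (Γ : MarkedGraph n) (x : SpineVertex n) : Γ.Represents x ↔
    ∃ Δ : ReducedMarkedGraph n, Δ.toVertex = x ∧ Relation.ReflTransGen Removes Γ Δ.1 := by
  have h : (fun A B : MarkedGraph n => A.RemovesBivalent B ∨ A.RemovesUnivalent B) = Removes :=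
    funext fun A => funext fun B => propext (removes_iff A B).symm
  unfold Represents
  rw [h]

theorem Carries.comp {Γ₁ Γ₂ Γ₃ : MarkedGraph n} {c : Hom Γ₁.G Γ₂.G} {c' : Hom Γ₂.G Γ₃.G}
    (h : Γ₁.Carries Γ₂ c) (h' : Γ₂.Carries Γ₃ c') : Γ₁.Carries Γ₃ (c'.comp c) := by
  unfold Carries
  rw [Hom.realize_comp, ContinuousMap.comp_assoc]
  exact ((ContinuousMap.Homotopic.refl _).comp h).trans h'

theorem Carries.congr {Γ₁ Γ₂ : MarkedGraph n} {c c' : Hom Γ₁.G Γ₂.G}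
    (h : Γ₁.Carries Γ₂ c) (hc : c.realize.Homotopic c'.realize) : Γ₁.Carries Γ₂ c' :=
  (hc.symm.comp (ContinuousMap.Homotopic.refl _)).trans h

/-- If the composition with `c` carries the marking and `c` does, then so does the second map. -/
theorem Carries.of_comp {Γ₁ Γ₂ Γ₃ : MarkedGraph n} {c : Hom Γ₁.G Γ₂.G} {c' : Hom Γ₂.G Γ₃.G}
    (h : Γ₁.Carries Γ₂ c) (h' : Γ₁.Carries Γ₃ (c'.comp c)) : Γ₂.Carries Γ₃ c' := by
  unfold Carries at h'
  rw [Hom.realize_comp, ContinuousMap.comp_assoc] at h'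
  exact ((ContinuousMap.Homotopic.refl _).comp h.symm).trans h'

/-- The marked graph that results from a homotopy equivalence of graphs. -/
noncomputable def push (Γ : MarkedGraph n) {H : FinGraph} (c : Hom Γ.G H)
    (hc : IsHomotopyEquivalence c.realize) : MarkedGraph n :=
  ⟨H, c.realize.comp Γ.marking, hc.comp Γ.isHomotopyEquivalence⟩

theorem carries_push (Γ : MarkedGraph n) {H : FinGraph} (c : Hom Γ.G H)
    (hc : IsHomotopyEquivalence c.realize) : Γ.Carries (Γ.push c hc) c :=
  ContinuousMap.Homotopic.refl _

/-- A marking can be lifted along a homotopy equivalence of graphs. -/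
theorem exists_pull (Γ : MarkedGraph n) {H : FinGraph} (c : Hom H Γ.G)
    (hc : IsHomotopyEquivalence c.realize) :
    ∃ (m : C((rose n).Realization, H.Realization)) (hm : IsHomotopyEquivalence m),
      (⟨H, m, hm⟩ : MarkedGraph n).Carries Γ c := by
  obtain ⟨k, h₁, h₂⟩ := isHomotopyEquivalence_iff.1 hc
  refine ⟨k.comp Γ.marking, IsHomotopyEquivalence.comp (isHomotopyEquivalence_iff.2 ⟨_, h₂, h₁⟩)
    Γ.isHomotopyEquivalence, ?_⟩
  change (c.realize.comp (k.comp Γ.marking)).Homotopic Γ.marking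
  rw [← ContinuousMap.comp_assoc]
  simpa using h₂.comp (ContinuousMap.Homotopic.refl Γ.marking)

theorem equivalent_of_same_edge {Γ Γ₁ Γ₂ : MarkedGraph n} {c₁ : Hom Γ.G Γ₁.G}
    {c₂ : Hom Γ.G Γ₂.G} {a : Γ.G.D} (h₁ : c₁.IsEdgeCollapse a) (m₁ : Γ.Carries Γ₁ c₁)
    (h₂ : c₂.IsEdgeCollapse a) (m₂ : Γ.Carries Γ₂ c₂) : Γ₁.Equivalent Γ₂ := by
  obtain ⟨f, g, hgf, hfg, rfl⟩ := h₁.exists_iso h₂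
  exact ⟨f, g, hgf, hfg, m₁.of_comp m₂⟩

/-- If `a` and `e` are different, `exists_slide` shows that the collapse of `e` is, up to homotopy,
also a collapse of `a`, and collapses of the same edge differ by an isomorphism. -/
theorem equivalent_of_bivalent {Γ Γ₁ Γ₂ : MarkedGraph n} {c₁ : Hom Γ.G Γ₁.G}
    {c₂ : Hom Γ.G Γ₂.G} {e a : Γ.G.D} (h₁ : c₁.IsEdgeCollapse e) (m₁ : Γ.Carries Γ₁ c₁)
    (h₂ : c₂.IsEdgeCollapse a) (m₂ : Γ.Carries Γ₂ c₂) (hv : Γ.G.valence (Γ.G.src e) ≤ 2)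
    (hs : Γ.G.src a = Γ.G.src e) : Γ₁.Equivalent Γ₂ := by
  by_cases hae : a = e
  · subst hae
    exact equivalent_of_same_edge h₁ m₁ h₂ m₂
  · obtain ⟨f, hf, hf'⟩ := h₁.exists_slide hs hae h₂.ne hv
    exact equivalent_of_same_edge hf (m₁.congr hf') h₂ m₂

theorem equivalent_of_bivalent' {Γ Γ₁ Γ₂ : MarkedGraph n} {c₁ : Hom Γ.G Γ₁.G}
    {c₂ : Hom Γ.G Γ₂.G} {e a : Γ.G.D} (h₁ : c₁.IsEdgeCollapse e) (m₁ : Γ.Carries Γ₁ c₁)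
    (h₂ : c₂.IsEdgeCollapse a) (m₂ : Γ.Carries Γ₂ c₂) (hv : Γ.G.valence (Γ.G.src e) ≤ 2)
    (hs : Γ.G.src e = Γ.G.src a ∨ Γ.G.src e = Γ.G.tgt a) : Γ₁.Equivalent Γ₂ := by
  rcases hs with hs | hs
  · exact equivalent_of_bivalent h₁ m₁ h₂ m₂ hv hs.symm
  · exact equivalent_of_bivalent h₁ m₁ h₂.rev m₂ hv hs.symm

/-- The removal of a vertex of valence at most `2` and the collapse of an edge commute, unless they
give the same graph. -/
theorem diamond {Γ Γ₁ Γ₂ : MarkedGraph n} {c₁ : Hom Γ.G Γ₁.G} {c₂ : Hom Γ.G Γ₂.G}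
    {e a : Γ.G.D} (h₁ : c₁.IsEdgeCollapse e) (m₁ : Γ.Carries Γ₁ c₁)
    (h₂ : c₂.IsEdgeCollapse a) (m₂ : Γ.Carries Γ₂ c₂) (hv : Γ.G.valence (Γ.G.src e) ≤ 2) :
    Γ₁.Equivalent Γ₂ ∨ ∃ Γ₃ : MarkedGraph n, Γ₂.Removes Γ₃ ∧ Γ₁.CollapsesEdge Γ₃ ∧
      (Γ.G.valence (Γ.G.src a) ≤ 2 → Γ₁.Removes Γ₃) := by
  -- If one of the two edges ends at a vertex of valence at most two from which the other is
  -- removed, the two collapses agree by sliding.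
  by_cases hs : Γ.G.src e = Γ.G.src a ∨ Γ.G.src e = Γ.G.tgt a
  · exact .inl (equivalent_of_bivalent' h₁ m₁ h₂ m₂ hv hs)
  by_cases hs' : Γ.G.valence (Γ.G.src a) ≤ 2 ∧
      (Γ.G.src a = Γ.G.src e ∨ Γ.G.src a = Γ.G.tgt e)
  · exact .inl (equivalent_of_bivalent' h₂ m₂ h₁ m₁ hs'.1 hs'.2).symm
  rw [not_or] at hs
  -- Now `a` is not incident to the initial vertex of `e`, so the collapses commute and the valence
  -- of that vertex survives the collapse of `a`.
  obtain ⟨L, c₃, c₄, a₁, e₂, ha₁, he₂, h₃, h₄, hc⟩ := h₁.exists_square h₂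
    (fun h => hs.1 (by rw [h])) (fun h => hs.2 (by rw [h, tgt_rev])) (fun h => hs.1 h.1.symm)
    (fun h => hs.2 h.2.symm)
  have m₃ : Γ₁.Carries (Γ₁.push c₃ h₃.isHomotopyEquivalence) c₃ := Γ₁.carries_push _ _
  have m₄ : Γ₂.Carries (Γ₁.push c₃ h₃.isHomotopyEquivalence) c₄ := by
    have h : Γ.Carries (Γ₁.push c₃ h₃.isHomotopyEquivalence) (c₃.comp c₁) := m₁.comp m₃
    rw [hc] at h
    exact Carries.of_comp (Γ₃ := Γ₁.push c₃ h₃.isHomotopyEquivalence) (c' := c₄) m₂ h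
  refine .inr ⟨Γ₁.push c₃ h₃.isHomotopyEquivalence, ⟨c₄, e₂, h₄, ?_, m₄⟩, ⟨c₃, a₁, h₃, m₃⟩,
    fun ha => ⟨c₃, a₁, h₃, ?_, m₃⟩⟩
  · rw [c₂.src_inr he₂, h₂.valence_of_ne hs.1 hs.2]
    exact hv
  · have := not_and.1 hs' ha
    rw [not_or] at this
    rw [c₁.src_inr ha₁, h₁.valence_of_ne this.1 this.2]
    exact ha

theorem IsReduced.of_equivalent {Γ Γ' : MarkedGraph n} (h : Γ.Equivalent Γ') (hΓ : Γ.IsReduced) :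
    Γ'.IsReduced := by
  obtain ⟨f, g, h₁, h₂, -⟩ := h
  intro w
  obtain ⟨v, rfl⟩ := (Hom.exists_equiv_of_iso h₁ h₂).1.2 w
  rw [Hom.valence_of_iso h₁ h₂]
  exact hΓ v

theorem Removes.of_equivalent {Γ Γ' Δ : MarkedGraph n} (h : Γ.Equivalent Γ')
    (hΓ : Γ.Removes Δ) : Γ'.Removes Δ := by
  obtain ⟨f, g, h₁, h₂, m⟩ := h.symm
  obtain ⟨c, a, hc, hv, hm⟩ := hΓ
  obtain ⟨b, hb, hfb⟩ := hc.comp_of_iso h₁ h₂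
  refine ⟨c.comp f, b, hb, ?_, m.comp hm⟩
  rw [← Hom.valence_of_iso h₁ h₂, ← f.src_inr hfb]
  exact hv

theorem CollapsesEdge.of_equivalent {Γ Γ' Δ : MarkedGraph n} (h : Γ.Equivalent Γ')
    (hΓ : Γ.CollapsesEdge Δ) : Γ'.CollapsesEdge Δ := by
  obtain ⟨f, g, h₁, h₂, m⟩ := h.symm
  obtain ⟨c, a, hc, hm⟩ := hΓ
  obtain ⟨b, hb, -⟩ := hc.comp_of_iso h₁ h₂
  exact ⟨c.comp f, b, hb, m.comp hm⟩

/-- Only the first step of a chain sees the starting graph, so it is enough to transport this step;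
an empty chain simply ends at `Γ'`. -/
theorem exists_chain_of_equivalent {Γ Γ' Δ : MarkedGraph n} (h : Γ.Equivalent Γ')
    (hΔ : Relation.ReflTransGen Removes Γ Δ) :
    ∃ Δ', Relation.ReflTransGen Removes Γ' Δ' ∧ Δ.Equivalent Δ' := by
  rcases hΔ.cases_head with rfl | ⟨Γ₁, h₁, h₂⟩
  · exact ⟨Γ', .refl, h⟩
  · exact ⟨Δ, .head (h₁.of_equivalent h) h₂, .refl Δ⟩

theorem IsReduced.not_removes {Γ Γ' : MarkedGraph n} (h : Γ.IsReduced) : ¬ Γ.Removes Γ' := by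
  rintro ⟨c, a, -, hv, -⟩
  have := h (Γ.G.src a)
  omega

/-- The collapse of an edge of a marked graph changes the reduced graph that it represents by at
most the collapse of an edge, and not at all if the edge starts at a vertex of valence at
most `2`. -/
theorem exists_reduced_of_collapse {Γ Δ Γ' : MarkedGraph n}
    (hΔ : Relation.ReflTransGen Removes Γ Δ) (hr : Δ.IsReduced) (h : Γ.CollapsesEdge Γ') :
    ∃ Δ', Relation.ReflTransGen Removes Γ' Δ' ∧ Δ'.IsReduced ∧
      (Δ.Equivalent Δ' ∨ Δ.CollapsesEdge Δ') ∧ (Γ.Removes Γ' → Δ.Equivalent Δ') := by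
  -- The collapse is pushed along the chain of removals, past one removal at a time, by `diamond`.
  induction hΔ using Relation.ReflTransGen.head_induction_on generalizing Γ' with
  | refl =>
    refine ⟨Γ', .refl, ?_, .inr h, fun h' => absurd h' hr.not_removes⟩
    obtain ⟨c, a, hc, -⟩ := h
    exact hc.three_le_valence hr
  | @head Γ Γ₁ h₁ hΔ ih =>
    obtain ⟨c₁, e, hc₁, hv, m₁⟩ := h₁
    have equiv_case : Γ₁.Equivalent Γ' → ∃ Δ', Relation.ReflTransGen Removes Γ' Δ' ∧
        Δ'.IsReduced ∧ (Δ.Equivalent Δ' ∨ Δ.CollapsesEdge Δ') ∧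
        (Γ.Removes Γ' → Δ.Equivalent Δ') := by
      intro heq
      obtain ⟨Δ', hΔ', he⟩ := exists_chain_of_equivalent heq hΔ
      exact ⟨Δ', hΔ', hr.of_equivalent he, .inl he, fun _ => he⟩
    -- If the collapse is itself a removal, the opposite side of the diamond is again a removal.
    -- This keeps the stronger conclusion, equivalence, alive through the induction.
    by_cases hrem : Γ.Removes Γ'
    · obtain ⟨c₂, a, hc₂, hv₂, m₂⟩ := hrem
      rcases diamond hc₁ m₁ hc₂ m₂ hv with heq | ⟨Γ₃, h₂, -, h₃⟩
      · exact equiv_case heq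
      · have h₃ := h₃ hv₂
        obtain ⟨Δ', hΔ', hr', -, he⟩ := ih ⟨_, _, h₃.choose_spec.choose_spec.1,
          h₃.choose_spec.choose_spec.2.2⟩
        exact ⟨Δ', .head h₂ hΔ', hr', .inl (he h₃), fun _ => he h₃⟩
    · obtain ⟨c₂, a, hc₂, m₂⟩ := h
      rcases diamond hc₁ m₁ hc₂ m₂ hv with heq | ⟨Γ₃, h₂, h₃, -⟩
      · exact equiv_case heq
      · obtain ⟨Δ', hΔ', hr', hor, -⟩ := ih h₃
        exact ⟨Δ', .head h₂ hΔ', hr', hor, fun h => absurd h hrem⟩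

theorem Removes.collapsesEdge {Γ Γ' : MarkedGraph n} (h : Γ.Removes Γ') : Γ.CollapsesEdge Γ' := by
  obtain ⟨c, a, hc, -, hm⟩ := h
  exact ⟨c, a, hc, hm⟩

/-- The reduced graph that a marked graph represents is unique up to equivalence. -/
theorem equivalent_of_chains {Γ Δ₁ Δ₂ : MarkedGraph n}
    (h₁ : Relation.ReflTransGen Removes Γ Δ₁) (hr₁ : Δ₁.IsReduced)
    (h₂ : Relation.ReflTransGen Removes Γ Δ₂) (hr₂ : Δ₂.IsReduced) : Δ₁.Equivalent Δ₂ := by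
  induction h₂ using Relation.ReflTransGen.head_induction_on generalizing Δ₁ with
  | refl =>
    rcases h₁.cases_head with rfl | ⟨Γ₁, h, -⟩
    · exact .refl _
    · exact absurd h hr₂.not_removes
  | head h _ ih =>
    obtain ⟨Δ', hΔ', hr', -, he⟩ := exists_reduced_of_collapse h₁ hr₁ h.collapsesEdge
    exact (he h).trans (ih hΔ' hr')

theorem Represents.unique {Γ : MarkedGraph n} {x y : SpineVertex n} (hx : Γ.Represents x)
    (hy : Γ.Represents y) : x = y := by
  obtain ⟨Δ₁, rfl, h₁⟩ := (represents_iff _ _).1 hx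
  obtain ⟨Δ₂, rfl, h₂⟩ := (represents_iff _ _).1 hy
  exact Quotient.sound (equivalent_of_chains h₁ Δ₁.2 h₂ Δ₂.2)

theorem Represents.exists_of_collapse {Γ Γ' : MarkedGraph n} {x : SpineVertex n}
    (hx : Γ.Represents x) (h : Γ.CollapsesEdge Γ') :
    ∃ x', Γ'.Represents x' ∧ (x' = x ∨ x.IsBlowup x') := by
  obtain ⟨Δ, rfl, hΔ⟩ := (represents_iff _ _).1 hx
  obtain ⟨Δ', hΔ', hr, hor, -⟩ := exists_reduced_of_collapse hΔ Δ.2 h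
  refine ⟨ReducedMarkedGraph.toVertex ⟨Δ', hr⟩, (represents_iff _ _).2 ⟨⟨Δ', hr⟩, rfl, hΔ'⟩, ?_⟩
  rcases hor with he | ⟨c, a, hc, hm⟩
  · exact .inl (Quotient.sound he.symm)
  · exact .inr ⟨Δ, ⟨Δ', hr⟩, rfl, rfl, c, a, hc, hm⟩

theorem IsReduced.represents {Γ : MarkedGraph n} (h : Γ.IsReduced) :
    Γ.Represents (ReducedMarkedGraph.toVertex ⟨Γ, h⟩) := ⟨⟨Γ, h⟩, rfl, .refl⟩

end MarkedGraph

/-! ## Every marked graph represents a vertex of the spine -/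

namespace FinGraph

variable {G : FinGraph} {n : ℕ}

theorem Hom.IsEdgeCollapse.card_lt {H : FinGraph} {c : Hom G H} {a : G.D}
    (h : c.IsEdgeCollapse a) : Nat.card H.D < Nat.card G.D := by
  have := Fintype.ofFinite G.D
  have := Fintype.ofFinite H.D
  rw [Nat.card_eq_fintype_card, Nat.card_eq_fintype_card]
  refine Fintype.card_lt_of_injective_of_notMem h.liftEdge h.liftEdge_injective (b := a) ?_
  rintro ⟨e, he⟩
  exact (h.ne_of_inr (h.onD_liftEdge e)).1 he

/-! ### Connectedness, and commuting loops as an obstruction to small graphs -/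

theorem IsEdgeWord.connectedVia {a b : G.Realization} {p : Path a b} (h : IsEdgeWord G p) :
    ∃ u v, a = G.vtx u ∧ b = G.vtx v ∧ G.ConnectedVia Set.univ u v := by
  induction h with
  | refl v => exact ⟨v, v, rfl, rfl, .refl⟩
  | edge d => exact ⟨_, _, rfl, rfl, .single ⟨d, trivial, rfl, rfl⟩⟩
  | trans _ _ h₁ h₂ =>
    obtain ⟨u, v, rfl, rfl, h⟩ := h₁
    obtain ⟨v', w, hv, rfl, h'⟩ := h₂
    obtain rfl := vtx_injective hv
    exact ⟨u, w, rfl, rfl, Relation.ReflTransGen.trans h h'⟩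
  | congr e _ h =>
    obtain ⟨rfl, rfl, -⟩ := e
    exact h

theorem nonempty_path_rose (x y : (rose n).Realization) : Nonempty (Path x y) :=
  ⟨(tail x).symm.trans (tail y)⟩

/-- A graph that is homotopy equivalent to a rose is connected. -/
theorem connectedVia_univ {f : C(G.Realization, (rose n).Realization)}
    (hf : IsHomotopyEquivalence f) (u v : G.V) : G.ConnectedVia Set.univ u v := by
  obtain ⟨r⟩ := nonempty_path_rose (f (G.vtx u)) (f (G.vtx v))
  obtain ⟨p, -⟩ := hf.exists_path r
  obtain ⟨u', v', hu, hv, h⟩ := (isEdgeWord p).connectedVia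
  rwa [vtx_injective hu, vtx_injective hv]

theorem ConnectedVia.eq_of_forall {F : Set G.D} {u v : G.V} (h : G.ConnectedVia F u v)
    (hu : ∀ d, G.src d = u → G.tgt d = u) : v = u := by
  induction h with
  | refl => rfl
  | tail _ hd ih =>
    obtain ⟨d, -, h₁, h₂⟩ := hd
    rw [← h₂, hu d (h₁.trans ih)]

/-- A loop that commutes with all edges commutes with all edge words. -/
theorem IsEdgeWord.commutes {v : G.V} {e : Path (G.vtx v) (G.vtx v)} (hv : ∀ u, u = v)
    (he : ∀ d, ∃ P : Path (G.vtx v) (G.vtx v), P ≈ₚ G.edge d ∧ e.trans P ≈ₚ P.trans e)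
    {a b : G.Realization} {p : Path a b} (hp : IsEdgeWord G p) :
    ∃ P : Path (G.vtx v) (G.vtx v), P ≈ₚ p ∧ e.trans P ≈ₚ P.trans e := by
  induction hp with
  | refl u =>
    obtain rfl := hv u
    exact ⟨_, .refl _, (HHomotopic.trans_refl _).trans (HHomotopic.refl_trans _).symm⟩
  | edge d => exact he d
  | trans _ _ h₁ h₂ =>
    obtain ⟨P, hP, hP'⟩ := h₁
    obtain ⟨Q, hQ, hQ'⟩ := h₂
    refine ⟨P.trans Q, .congr_trans hP hQ, ?_⟩
    exact (HHomotopic.assoc _ _ _).symm.trans ((HHomotopic.congr_trans hP' (.refl _)).trans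
      ((HHomotopic.assoc _ _ _).trans ((HHomotopic.congr_trans (.refl _) hQ').trans
        (HHomotopic.assoc _ _ _).symm)))
  | congr e _ h =>
    obtain ⟨P, hP, hP'⟩ := h
    exact ⟨P, hP.trans e, hP'⟩

/-- In a graph with one vertex and at most one edge all loops commute. -/
theorem commute_of_card_le_two {v : G.V} (hv : ∀ u, u = v)
    (hD : (Set.univ : Set G.D).ncard ≤ 2) (p q : Path (G.vtx v) (G.vtx v)) :
    p.trans q ≈ₚ q.trans p := by
  have hD' : ∀ d e : G.D, e = d ∨ e = G.rev d := by
    intro d e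
    have h : ({d, G.rev d} : Set G.D) = Set.univ :=
      Set.eq_of_subset_of_ncard_le (Set.subset_univ _)
        (by rwa [Set.ncard_pair (G.rev_ne d).symm])
    have he : e ∈ ({d, G.rev d} : Set G.D) := h ▸ Set.mem_univ e
    exact he
  -- The lemma on edge words is used twice: `p` is a word in one edge and its inverse, so it
  -- commutes with every edge; hence it commutes with the word `q`.
  have key : ∀ d, ∃ P : Path (G.vtx v) (G.vtx v), P ≈ₚ G.edge d ∧ p.trans P ≈ₚ P.trans p := by
    intro d
    let e : Path (G.vtx v) (G.vtx v) := (G.edge d).cast (by rw [hv (G.src d)])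
      (by rw [hv (G.tgt d)])
    have he : e ≈ₚ G.edge d := .cast_left _ _ _
    refine ⟨e, he, ?_⟩
    obtain ⟨P, hP, hP'⟩ := (isEdgeWord p).commutes (e := e) hv fun d' => by
      rcases hD' d d' with rfl | rfl
      · exact ⟨e, he, .refl _⟩
      · exact ⟨e.symm, he.congr_symm.trans (G.edge_rev d).symm,
          (HHomotopic.trans_symm e).trans (HHomotopic.symm_trans e).symm⟩
    exact (HHomotopic.congr_trans hP.symm (.refl _)).trans
      (hP'.symm.trans (HHomotopic.congr_trans (.refl _) hP))
  obtain ⟨Q, hQ, hQ'⟩ := (isEdgeWord q).commutes (e := p) hv key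
  exact (HHomotopic.congr_trans (.refl _) hQ.symm).trans
    (hQ'.trans (HHomotopic.congr_trans hQ (.refl _)))

/-- Two different petals of a rose do not commute. -/
theorem rose_not_commute (hn : 2 ≤ n) :
    ∃ p q : Path ((rose n).vtx ()) ((rose n).vtx ()), ¬ p.trans q ≈ₚ q.trans p := by
  -- The first two petals act on three sheets by transpositions that do not commute.
  let Λ : (rose n).D → Equiv.Perm (Fin 3) := fun d =>
    if d.1.val = 0 then Equiv.swap 0 1 else Equiv.swap 1 2
  have hΛ : ∀ d, Λ ((rose n).rev d) = (Λ d)⁻¹ := by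
    intro d
    change Λ d = _
    simp only [Λ]
    split_ifs <;> rw [Equiv.swap_inv]
  let a : (rose n).D := (⟨0, by omega⟩, true)
  let b : (rose n).D := (⟨1, by omega⟩, true)
  have ha : Λ a = Equiv.swap 0 1 := if_pos rfl
  have hb : Λ b = Equiv.swap 1 2 := if_neg one_ne_zero
  refine ⟨(rose n).edge a, (rose n).edge b, fun h => ?_⟩
  have h₁ := (Transports.trans (.edge hΛ a 0) (.edge hΛ b _)).congr h
  have h₂ := h₁.unique (Transports.trans (.edge hΛ b 0) (.edge hΛ a _))
  rw [ha, hb] at h₂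
  revert h₂
  decide

end FinGraph

namespace MarkedGraph

variable {n : ℕ}

theorem connectedVia_univ (Γ : MarkedGraph n) (u v : Γ.G.V) : Γ.G.ConnectedVia Set.univ u v := by
  obtain ⟨k, h₁, h₂⟩ := isHomotopyEquivalence_iff.1 Γ.isHomotopyEquivalence
  exact FinGraph.connectedVia_univ (isHomotopyEquivalence_iff.2 ⟨_, h₂, h₁⟩) u v

/-- At a vertex of valence at most two, an edge that is not a loop can be collapsed. If there is
none, connectedness leaves a single vertex with at most one geometric edge. All its loops commute,
but two petals of the rose do not. -/
theorem exists_removes (hn : 2 ≤ n) {Γ : MarkedGraph n} (h : ¬ Γ.IsReduced) :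
    ∃ Γ', Γ.Removes Γ' ∧ Nat.card Γ'.G.D < Nat.card Γ.G.D := by
  simp only [IsReduced, not_forall, not_le] at h
  obtain ⟨v, hv⟩ := h
  by_cases hl : ∀ d, Γ.G.src d = v → Γ.G.tgt d = v
  · have hV : ∀ u, u = v := fun u => (Γ.connectedVia_univ v u).eq_of_forall hl
    obtain ⟨p, q, hpq⟩ := rose_not_commute hn
    obtain ⟨κ⟩ : Nonempty (Path (Γ.marking ((rose n).vtx ())) (Γ.G.vtx v)) :=
      ⟨(tail _).symm.cast rfl (by rw [hV (tailVertex _)])⟩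
    refine absurd (Γ.isHomotopyEquivalence.injective_path ?_) hpq
    let c : Path ((rose n).vtx ()) ((rose n).vtx ()) → Path (Γ.G.vtx v) (Γ.G.vtx v) := fun r =>
      κ.symm.trans ((r.map Γ.marking.continuous).trans κ)
    have hD : (Set.univ : Set Γ.G.D).ncard ≤ 2 := by
      rw [valence_eq_ncard] at hv
      have : {d | Γ.G.src d = v} = Set.univ := Set.eq_univ_of_forall fun d => hV _
      rw [this] at hv
      omega
    have hc : ∀ r s, c (r.trans s) ≈ₚ (c r).trans (c s) := by
      intro r s
      simp only [c, Path.map_trans]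
      generalize r.map Γ.marking.continuous = r
      generalize s.map Γ.marking.continuous = s
      refine HHomotopic.trans ?_ (HHomotopic.assoc _ _ _).symm
      refine .congr_trans (.refl _) ?_
      refine (HHomotopic.assoc _ _ _).trans (HHomotopic.trans ?_ (HHomotopic.assoc _ _ _).symm)
      refine .congr_trans (.refl _) ?_
      refine HHomotopic.trans ?_ (HHomotopic.assoc _ _ _)
      exact (HHomotopic.trans_of_left (HHomotopic.trans_symm κ)).symm
    have h := (hc p q).trans ((commute_of_card_le_two hV hD (c p) (c q)).trans (hc q p).symm)
    have h := HHomotopic.cancel_left h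
    exact (HHomotopic.trans_symm_cancel _ κ).symm.trans
      ((HHomotopic.congr_trans h (.refl _)).trans (HHomotopic.trans_symm_cancel _ κ))
  · push Not at hl
    obtain ⟨a, rfl, ha⟩ := hl
    obtain ⟨H, c, hc⟩ := exists_isEdgeCollapse (Ne.symm ha)
    exact ⟨Γ.push c hc.isHomotopyEquivalence, ⟨c, a, hc, by omega, Γ.carries_push _ _⟩,
      hc.card_lt⟩

theorem exists_represents (hn : 2 ≤ n) (Γ : MarkedGraph n) : ∃ x, Γ.Represents x := by
  induction h : Nat.card Γ.G.D using Nat.strong_induction_on generalizing Γ with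
  | _ k ih =>
    by_cases hr : Γ.IsReduced
    · exact ⟨_, hr.represents⟩
    · obtain ⟨Γ', h₁, h₂⟩ := exists_removes hn hr
      obtain ⟨x, hx⟩ := ih _ (h ▸ h₂) Γ' rfl
      obtain ⟨Δ, hΔ, hc⟩ := (represents_iff _ _).1 hx
      exact ⟨x, (represents_iff _ _).2 ⟨Δ, hΔ, .head h₁ hc⟩⟩

end MarkedGraph

/-! ## Forest collapses in the spine -/

namespace FinGraph

variable {G H K : FinGraph}

theorem Hom.isForestCollapse_id (G : FinGraph) : (Hom.id G).IsForestCollapse := by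
  have hF : (Hom.id G).collapsed = ∅ := by
    ext d
    simp [Hom.collapsed, Hom.id]
  rw [Hom.IsForestCollapse, hF]
  refine ⟨fun d hd => absurd hd (Set.notMem_empty d), surjective_id, fun u v => ⟨?_, ?_⟩, fun e =>
    ⟨e, rfl, fun d hd => Sum.inr_injective hd⟩⟩
  · rintro (rfl : u = v)
    exact .refl
  · intro h
    induction h with
    | refl => rfl
    | tail _ hd _ => exact absurd hd.choose_spec.1 (Set.notMem_empty _)

theorem ConnectedVia.mono {F F' : Set G.D} (h : F ⊆ F') {u v : G.V} (huv : G.ConnectedVia F u v) :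
    G.ConnectedVia F' u v := by
  induction huv with
  | refl => exact .refl
  | tail _ hd ih =>
    obtain ⟨d, hd, h'⟩ := hd
    exact ih.tail ⟨d, h hd, h'⟩

theorem ConnectedVia.onV_eq {F : Set G.D} (f : Hom G H) (hF : ∀ d ∈ F, ∃ v, f.onD d = Sum.inl v)
    {u v : G.V} (h : G.ConnectedVia F u v) : f.onV u = f.onV v := by
  induction h with
  | refl => rfl
  | tail _ hd ih =>
    obtain ⟨d, hd, rfl, rfl⟩ := hd
    obtain ⟨x, hx⟩ := hF d hd
    rw [ih, f.src_inl hx, f.tgt_inl hx]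

/-- The composition of the collapses of two edges is a forest collapse. -/
theorem Hom.IsEdgeCollapse.isForestCollapse_comp {c : Hom G H} {c' : Hom H K} {a : G.D} {b : H.D}
    (h : c.IsEdgeCollapse a) (h' : c'.IsEdgeCollapse b) : (c'.comp c).IsForestCollapse := by
  let b' := h.liftEdge b
  have hb' : c.onD b' = Sum.inr b := h.onD_liftEdge b
  have hne := h.ne_of_inr hb'
  have hmem : ∀ d, (∃ v, (c'.comp c).onD d = Sum.inl v) ↔
      (d = a ∨ d = G.rev a) ∨ d = b' ∨ d = G.rev b' := by
    intro d
    rcases hd : c.onD d with v | e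
    · rw [Hom.comp_onD_inl c' hd]
      exact iff_of_true ⟨_, rfl⟩ (.inl ((h.inl_iff d).1 ⟨v, hd⟩))
    · rw [Hom.comp_onD_inr c' hd, h'.inl_iff]
      have h₁ := h.ne_of_inr hd
      have h₂ : e = b ↔ d = b' :=
        ⟨fun he => (h.liftEdge_eq (he ▸ hd)).symm, fun he => by
          subst he; exact Sum.inr_injective (hd.symm.trans hb')⟩
      have h₃ : e = H.rev b ↔ d = G.rev b' := by
        rw [← h.liftEdge_rev]
        exact ⟨fun he => (h.liftEdge_eq (he ▸ hd)).symm, fun he => by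
          subst he; exact Sum.inr_injective (hd.symm.trans (h.onD_liftEdge _))⟩
      rw [h₂, h₃]
      tauto
  have hF : (c'.comp c).collapsed = {a, G.rev a} ∪ {b', G.rev b'} := Set.ext hmem
  have ha : ∀ u v, c.onV u = c.onV v ↔ G.ConnectedVia {a, G.rev a} u v := fun u v => by
    rw [h.onV_eq_iff, Hom.connectedVia_pair_iff]
  have hbne : ¬ c.onV (G.src b') = c.onV (G.tgt b') := by
    rw [← c.src_inr hb', ← c.tgt_inr hb']
    exact h'.ne
  -- Without one of the two geometric edges only the other can remain in the forest. If it joined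
  -- the ends of the removed one, then in either case `c` would identify the ends of `b'`, and `b`
  -- would be a loop in `H`.
  have hba : ∀ d, d = b' ∨ d = G.rev b' → ({a, G.rev a} ∪ {b', G.rev b'}) \ {d, G.rev d} ⊆
      ({a, G.rev a} : Set G.D) := by
    rintro d (rfl | rfl) e ⟨he | he, he'⟩
    · exact he
    · exact absurd he he'
    · exact he
    · rw [G.rev_rev, Set.pair_comm] at he'
      exact absurd he he'
  have hab : ∀ d, d = a ∨ d = G.rev a → ({a, G.rev a} ∪ {b', G.rev b'}) \ {d, G.rev d} ⊆
      ({b', G.rev b'} : Set G.D) := by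
    rintro d (rfl | rfl) e ⟨he | he, he'⟩
    · exact absurd he he'
    · exact he
    · rw [G.rev_rev, Set.pair_comm] at he'
      exact absurd he he'
    · exact he
  refine ⟨?_, h'.surjective.comp h.surjective, fun u v => ?_, fun e => ?_⟩
  · rw [hF]
    rintro d (hd | hd) hcon
    · have hcon := hcon.mono (hab d hd)
      rw [Hom.connectedVia_pair_iff] at hcon
      have hne := h.ne
      have hc : c.onV (G.src a) = c.onV (G.tgt a) := (h.onV_eq_iff _ _).2 (.inr (.inl ⟨rfl, rfl⟩))
      rcases hd with rfl | rfl
      · rcases hcon with h₁ | ⟨h₁, h₂⟩ | ⟨h₁, h₂⟩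
        · exact hne h₁
        · exact hbne (by rw [← h₁, ← h₂, hc])
        · exact hbne (by rw [← h₁, ← h₂, hc])
      · rw [tgt_rev, src_rev] at hcon
        rcases hcon with h₁ | ⟨h₁, h₂⟩ | ⟨h₁, h₂⟩
        · exact hne h₁.symm
        · exact hbne (by rw [← h₁, ← h₂, hc])
        · exact hbne (by rw [← h₁, ← h₂, hc])
    · have hcon := (ha _ _).2 (hcon.mono (hba d hd))
      rcases hd with rfl | rfl
      · exact hbne hcon
      · rw [tgt_rev, src_rev] at hcon
        exact hbne hcon.symm
  · rw [hF]
    constructor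
    · intro huv
      have hsub : ∀ {x y}, c.onV x = c.onV y →
          G.ConnectedVia ({a, G.rev a} ∪ {b', G.rev b'}) x y := fun hxy =>
        ((ha _ _).1 hxy).mono Set.subset_union_left
      rcases (h'.onV_eq_iff _ _).1 huv with h₁ | ⟨h₁, h₂⟩ | ⟨h₁, h₂⟩
      · exact hsub h₁
      · rw [c.src_inr hb'] at h₁
        rw [c.tgt_inr hb'] at h₂
        exact ((hsub h₁).tail ⟨b', .inr (.inl rfl), rfl, rfl⟩).trans (hsub h₂.symm)
      · rw [c.tgt_inr hb'] at h₁
        rw [c.src_inr hb'] at h₂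
        exact ((hsub h₁).tail ⟨G.rev b', .inr (.inr rfl), rfl, G.tgt_rev b'⟩).trans (hsub h₂.symm)
    · exact fun hcon => hcon.onV_eq (c'.comp c) fun d hd => (hmem d).2 hd
  · obtain ⟨e', he', hu'⟩ := h'.existsUnique e
    refine ⟨h.liftEdge e', (Hom.comp_onD_inr c' (h.onD_liftEdge e')).trans he', fun d hd => ?_⟩
    rcases hd' : c.onD d with v | e''
    · simp only [Hom.comp_onD_inl c' hd'] at hd
      cases hd
    · simp only [Hom.comp_onD_inr c' hd'] at hd
      obtain rfl := hu' e'' hd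
      exact (h.liftEdge_eq hd').symm

end FinGraph

namespace SpineVertex

variable {n : ℕ}

theorem Collapses.refl (x : SpineVertex n) : x.Collapses x := by
  induction x using Quotient.ind with
  | _ Γ =>
    refine ⟨Γ, Γ, rfl, rfl, Hom.id _, Hom.isForestCollapse_id _, ?_⟩
    unfold MarkedGraph.Carries
    rw [Hom.realize_id, ContinuousMap.id_comp]

theorem IsBlowup.collapses {x y : SpineVertex n} (h : y.IsBlowup x) : y.Collapses x := by
  obtain ⟨Γ, Γ', h₁, h₂, c, a, hc, hm⟩ := h
  exact ⟨Γ, Γ', h₁, h₂, c, hc.1, hm⟩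

/-- The two collapses involve different representatives of `y`, so the second one is transported
along an equivalence before they are composed. -/
theorem IsBlowup.collapses_of_isBlowup {x y z : SpineVertex n} (h : z.IsBlowup y)
    (h' : y.IsBlowup x) : z.Collapses x := by
  obtain ⟨Γ₁, Γ₂, rfl, h₂, c, a, hc, hm⟩ := h
  obtain ⟨Γ₃, Γ₄, h₃, rfl, c', a', hc', hm'⟩ := h'
  obtain ⟨c', a', hc', hm'⟩ := MarkedGraph.CollapsesEdge.of_equivalent
    (Quotient.exact (h₃.trans h₂.symm)) ⟨c', a', hc', hm'⟩
  exact ⟨Γ₁, Γ₄, rfl, rfl, c'.comp c, hc.isForestCollapse_comp hc', hm.comp hm'⟩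

/-- A fold is completed by two edge collapses, each of which may be invisible in the spine. Together
they amount to one forest collapse, which may be empty. -/
theorem collapses_of_steps {x y z : SpineVertex n} (h : y = z ∨ z.IsBlowup y)
    (h' : x = y ∨ y.IsBlowup x) : z.Collapses x := by
  rcases h with rfl | h
  · rcases h' with rfl | h'
    · exact .refl _
    · exact h'.collapses
  · rcases h' with rfl | h'
    · exact h.collapses
    · exact h.collapses_of_isBlowup h'

end SpineVertex

/-! ## Folds -/

namespace FinGraph

variable {G H K L : FinGraph}

/-- The collapse of two edges `a`, `b` with the same initial vertex and distinct terminal vertices,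
one after the other, and its effect on edges and vertices. -/
theorem Hom.IsEdgeCollapse.exists_collapse_pair {a b : G.D} (hab : G.src a = G.src b)
    (ha : G.src a ≠ G.tgt a) (hb : G.src b ≠ G.tgt b) (ht : G.tgt a ≠ G.tgt b) :
    ∃ (H K : FinGraph) (c : Hom G H) (c' : Hom H K) (b' : H.D),
      c.IsEdgeCollapse a ∧ c'.IsEdgeCollapse b' ∧ c.onD b = Sum.inr b' ∧
      (∀ d, (∃ x, (c'.comp c).onD d = Sum.inl x) ↔
        (d = a ∨ d = G.rev a) ∨ d = b ∨ d = G.rev b) ∧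
      (∀ e, ∃ d, (c'.comp c).onD d = Sum.inr e) ∧
      (∀ d d' e, (c'.comp c).onD d = Sum.inr e → (c'.comp c).onD d' = Sum.inr e → d = d') ∧
      Surjective (c'.comp c).onV ∧
      ∀ u v, (c'.comp c).onV u = (c'.comp c).onV v ↔ u = v ∨
        (u = G.src a ∨ u = G.tgt a ∨ u = G.tgt b) ∧ (v = G.src a ∨ v = G.tgt a ∨ v = G.tgt b) := by
  have hba : b ≠ a := fun h => ht (by rw [h])
  have hbr : b ≠ G.rev a := fun h => ha (by rw [hab, h, src_rev])
  obtain ⟨H, c, hc⟩ := exists_isEdgeCollapse ha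
  obtain ⟨b', hb'⟩ := hc.exists_inr hba hbr
  -- After the collapse of `a`, the edge `b` is still not a loop; distinct terminal vertices are
  -- needed exactly here.
  have hne : H.src b' ≠ H.tgt b' := by
    rw [c.src_inr hb', c.tgt_inr hb', Ne, hc.onV_eq_iff]
    rintro (h | ⟨-, h⟩ | ⟨h, -⟩)
    · exact hb h
    · exact ht h.symm
    · exact ha (hab.trans h)
  obtain ⟨K, c', hc'⟩ := exists_isEdgeCollapse hne
  refine ⟨H, K, c, c', b', hc, hc', hb', fun d => ?_, fun e => ?_, fun d d' e h h' => ?_,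
    hc'.surjective.comp hc.surjective, fun u v => ?_⟩
  · rcases hd : c.onD d with v | e
    · rw [Hom.comp_onD_inl c' hd]
      exact iff_of_true ⟨_, rfl⟩ (.inl ((hc.inl_iff d).1 ⟨v, hd⟩))
    · rw [Hom.comp_onD_inr c' hd, hc'.inl_iff]
      have h₁ := hc.ne_of_inr hd
      have hb := hc.liftEdge_eq hb'
      have hd := hc.liftEdge_eq hd
      rw [← hb, ← hc.liftEdge_rev, ← hd, hc.liftEdge_injective.eq_iff,
        hc.liftEdge_injective.eq_iff, hd]
      tauto
  · exact ⟨_, (Hom.comp_onD_inr c' (hc.onD_liftEdge _)).trans (hc'.onD_liftEdge e)⟩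
  · have hu := ((hc.isForestCollapse_comp hc').2.2.2 e).unique h h'
    exact hu
  · have hs : H.src b' = c.onV (G.src a) := by rw [c.src_inr hb', hab]
    have ht' : H.tgt b' = c.onV (G.tgt b) := c.tgt_inr hb'
    rw [Hom.comp_onV, Hom.comp_onV, hc'.onV_eq_iff, hs, ht', hc.onV_eq_iff, hc.onV_eq_iff,
      hc.onV_eq_iff, hc.onV_eq_iff, hc.onV_eq_iff]
    rw [hab] at ha ⊢
    have h₁ : G.tgt b ≠ G.src b := hb.symm
    have h₂ := ht.symm
    grind

/-- Every fold of edges `a`, `b` with distinct terminal vertices is the composition of a blowup and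
of two collapses: the edges `a` and `b` are first folded in part, with the new edge `z`, and then
their remainders are collapsed. -/
theorem exists_fold {a b : G.D} (hab : G.src a = G.src b) (hba : b ≠ a) (hbr : b ≠ G.rev a)
    (ht : G.tgt a ≠ G.tgt b) :
    ∃ (H H' K : FinGraph) (c₁ : Hom H G) (z : H.D) (c₂ : Hom H H') (a' : H.D) (c₃ : Hom H' K)
      (b' : H'.D) (q : Hom G K),
      c₁.IsEdgeCollapse z ∧ c₂.IsEdgeCollapse a' ∧ c₃.IsEdgeCollapse b' ∧ q.IsFold a b ∧
      (q.comp c₁).realize.Homotopic (c₃.comp c₂).realize := by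
  classical
  -- The edges `a` and `b` are made to start at the new vertex, so the new edge `z` is their common
  -- initial piece and their lifts are the remainders.
  obtain ⟨H, c₁, z, h₁, -, hL⟩ := exists_split (G := G) (v := G.src a) (P := {a, b}) (by
    rintro d (rfl | rfl)
    · rfl
    · exact hab.symm)
  simp only [Set.mem_insert_iff, Set.mem_singleton_iff] at hL
  have hra := G.rev_ne a
  have hrb := G.rev_ne b
  have har : G.rev b ≠ a := fun h => hbr (by rw [← h, G.rev_rev])
  have hrr : G.rev b ≠ G.rev a := fun h => hba (G.rev_injective h)
  have hLV : ∀ d, c₁.onV (H.src (h₁.liftEdge d)) = G.src d := fun d =>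
    (c₁.src_inr (h₁.onD_liftEdge d)).symm
  have hLT : ∀ d, c₁.onV (H.tgt (h₁.liftEdge d)) = G.tgt d := fun d =>
    (c₁.tgt_inr (h₁.onD_liftEdge d)).symm
  have htgt : ∀ d, H.tgt (h₁.liftEdge d) = H.tgt z ↔ G.rev d = a ∨ G.rev d = b := fun d => by
    rw [← hL, h₁.liftEdge_rev]
    rfl
  have hpa : H.src (h₁.liftEdge a) = H.tgt z := (hL a).2 (.inl rfl)
  have hpb : H.src (h₁.liftEdge b) = H.tgt z := (hL b).2 (.inr rfl)
  have hta : H.tgt (h₁.liftEdge a) ≠ H.tgt z := by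
    rw [Ne, htgt, not_or]
    exact ⟨hra, hbr.symm⟩
  have htb : H.tgt (h₁.liftEdge b) ≠ H.tgt z := by
    rw [Ne, htgt, not_or]
    exact ⟨har, hrb⟩
  obtain ⟨H', K, c₂, c₃, b', h₂, h₃, -, hcol, hsur, hinj, hsurV, hV⟩ :=
    Hom.IsEdgeCollapse.exists_collapse_pair (a := h₁.liftEdge a) (b := h₁.liftEdge b)
      (hpa.trans hpb.symm) (by rw [hpa]; exact hta.symm) (by rw [hpb]; exact htb.symm)
      (fun h => ht (by rw [← hLT, ← hLT, h]))
  simp only [hpa] at hV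
  simp only [← h₁.liftEdge_rev] at hcol
  set c := c₃.comp c₂ with hc
  -- the section of the vertices that avoids the new vertex
  obtain ⟨σ, κ, -, hκ, hκz⟩ := h₁.exists_section
  have hσz : σ (c₁.onV (H.tgt z)) = H.src z := vtx_injective hκz.choose
  have hσ : ∀ u, u ≠ H.tgt z → σ (c₁.onV u) = u := fun u hu => vtx_injective (hκ u hu).choose
  have hσne : ∀ w, σ w ≠ H.tgt z := by
    intro w
    obtain ⟨u, rfl⟩ := h₁.surjective w
    by_cases hu : u = H.tgt z
    · rw [hu, hσz]
      exact h₁.ne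
    · rwa [hσ u hu]
  have hσc : ∀ w, c₁.onV (σ w) = w := by
    intro w
    obtain ⟨u, rfl⟩ := h₁.surjective w
    by_cases hu : u = H.tgt z
    · rw [hu, hσz, h₁.onV_eq_iff]
      exact .inr (.inl ⟨rfl, rfl⟩)
    · rw [hσ u hu]
  -- the edges of `H` that represent the edges of the folded graph
  let ψ : G.D → H.D := fun d =>
    if d = a ∨ d = b then z else if d = G.rev a ∨ d = G.rev b then H.rev z else h₁.liftEdge d
  have hψ₁ : ∀ d, d = a ∨ d = b → ψ d = z := fun d hd => if_pos hd
  have hψ₂ : ∀ d, d = G.rev a ∨ d = G.rev b → ψ d = H.rev z := fun d hd =>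
    (if_neg (by grind)).trans (if_pos hd)
  have hψ₃ : ∀ d, ¬ (d = a ∨ d = b) → ¬ (d = G.rev a ∨ d = G.rev b) → ψ d = h₁.liftEdge d :=
    fun d hd hd' => (if_neg hd).trans (if_neg hd')
  have hiff : ∀ d, (G.rev d = G.rev a ∨ G.rev d = G.rev b ↔ d = a ∨ d = b) ∧
      (G.rev d = a ∨ G.rev d = b ↔ d = G.rev a ∨ d = G.rev b) := fun d => by
    rw [G.rev_injective.eq_iff, G.rev_injective.eq_iff, G.rev_eq_iff, G.rev_eq_iff]
    exact ⟨Iff.rfl, Iff.rfl⟩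
  have hψrev : ∀ d, ψ (G.rev d) = H.rev (ψ d) := by
    intro d
    by_cases h : d = a ∨ d = b
    · rw [hψ₁ d h, hψ₂ _ ((hiff d).1.2 h)]
    by_cases h' : d = G.rev a ∨ d = G.rev b
    · rw [hψ₂ d h', hψ₁ _ ((hiff d).2.2 h'), H.rev_rev]
    · rw [hψ₃ d h h', hψ₃ _ (by rwa [(hiff d).2]) (by rwa [(hiff d).1]), h₁.liftEdge_rev]
  have hzL : ∀ d, h₁.liftEdge d ≠ z ∧ h₁.liftEdge d ≠ H.rev z := fun d =>
    h₁.ne_of_inr (h₁.onD_liftEdge d)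
  have hLi : ∀ d e, h₁.liftEdge d = h₁.liftEdge e ↔ d = e := fun d e =>
    h₁.liftEdge_injective.eq_iff
  have hex : ∀ d, ∃ e, c.onD (ψ d) = Sum.inr e := by
    intro d
    rcases h : c.onD (ψ d) with v | e
    · have h := (hcol _).1 ⟨v, h⟩
      by_cases hd : d = a ∨ d = b
      · rw [hψ₁ d hd] at h
        grind
      by_cases hd' : d = G.rev a ∨ d = G.rev b
      · rw [hψ₂ d hd'] at h
        grind
      · rw [hψ₃ d hd hd', hLi, hLi, hLi, hLi] at h
        tauto
    · exact ⟨e, rfl⟩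
  choose φ hφ using hex
  have hφψ : ∀ d e, φ d = φ e ↔ ψ d = ψ e := fun d e =>
    ⟨fun h => hinj _ _ _ (hφ d) (h ▸ hφ e), fun h => Sum.inr_injective
      ((hφ d).symm.trans ((congrArg c.onD h).trans (hφ e)))⟩
  have hsrc : ∀ d, c.onV (H.src (ψ d)) = c.onV (σ (G.src d)) := by
    intro d
    by_cases hd : d = a ∨ d = b
    · have hs : H.src (h₁.liftEdge d) = H.tgt z := (hL d).2 hd
      rw [hψ₁ d hd, ← hLV, hs, hσz]
    by_cases hd' : d = G.rev a ∨ d = G.rev b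
    · have hs : H.src (h₁.liftEdge d) ≠ H.tgt z := by rwa [Ne, hL]
      rw [hψ₂ d hd', ← hLV, hσ _ hs, src_rev, hV]
      refine .inr ⟨.inl rfl, .inr ?_⟩
      rcases hd' with rfl | rfl
      · exact .inl (by rw [h₁.liftEdge_rev]; rfl)
      · exact .inr (by rw [h₁.liftEdge_rev]; rfl)
    · have hs : H.src (h₁.liftEdge d) ≠ H.tgt z := by rwa [Ne, hL]
      rw [hψ₃ d hd hd', ← hLV, hσ _ hs]
  let q : Hom G K :=
    { onV := fun w => c.onV (σ w)
      onD := fun d => Sum.inr (φ d)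
      map_src := fun d => by
        change K.src (φ d) = _
        rw [c.src_inr (hφ d), hsrc]
      map_rev := fun d => by
        change Sum.inr (φ (G.rev d)) = Sum.inr (K.rev (φ d))
        rw [← hφ (G.rev d), hψrev, c.onD_rev_inr (hφ d)] }
  have hσa : σ (G.tgt a) = H.tgt (h₁.liftEdge a) := by rw [← hLT, hσ _ hta]
  have hσb : σ (G.tgt b) = H.tgt (h₁.liftEdge b) := by rw [← hLT, hσ _ htb]
  have hσi : ∀ u v, σ u = σ v ↔ u = v := fun u v =>
    ⟨fun h => by rw [← hσc u, h, hσc], fun h => by rw [h]⟩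
  refine ⟨H, H', K, c₁, z, c₂, _, c₃, b', q, h₁, h₂, h₃, ⟨hab, hba.symm, hbr, φ, fun d => rfl,
    fun e => ?_, fun w => ?_, fun u v => ?_, fun d e => ?_⟩, ?_⟩
  · obtain ⟨d, hd⟩ := hsur e
    suffices ∃ d', ψ d' = d by
      obtain ⟨d', rfl⟩ := this
      exact ⟨d', Sum.inr_injective ((hφ d').symm.trans hd)⟩
    rcases h₁.eq_or_exists_liftEdge d with rfl | rfl | ⟨d, rfl⟩
    · exact ⟨a, hψ₁ a (.inl rfl)⟩
    · exact ⟨G.rev a, hψ₂ _ (.inl rfl)⟩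
    · have hn : ¬ ((d = a ∨ d = G.rev a) ∨ d = b ∨ d = G.rev b) := by
        rw [← hLi d a, ← hLi d b, ← hLi d (G.rev a), ← hLi d (G.rev b), ← hcol, hd]
        simp
      exact ⟨d, hψ₃ d (by tauto) (by tauto)⟩
  · obtain ⟨u, rfl⟩ := hsurV w
    by_cases hu : u = H.tgt z
    · refine ⟨G.tgt a, (hV _ _).2 (.inr ⟨.inr (.inl hσa), .inl hu⟩)⟩
    · exact ⟨c₁.onV u, congrArg c.onV (hσ u hu)⟩
  · change c.onV (σ u) = c.onV (σ v) ↔ _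
    rw [hV, ← hσa, ← hσb]
    simp only [hσi, hσne, false_or]
    grind
  · rw [hφψ]
    have hzz := H.rev_ne z
    by_cases hd : d = a ∨ d = b
    · rw [hψ₁ d hd]
      by_cases he : e = a ∨ e = b
      · rw [hψ₁ e he]
        grind
      by_cases he' : e = G.rev a ∨ e = G.rev b
      · rw [hψ₂ e he']
        grind
      · rw [hψ₃ e he he']
        have := hzL e
        grind
    by_cases hd' : d = G.rev a ∨ d = G.rev b
    · rw [hψ₂ d hd']
      by_cases he : e = a ∨ e = b
      · rw [hψ₁ e he]
        grind
      by_cases he' : e = G.rev a ∨ e = G.rev b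
      · rw [hψ₂ e he']
        grind
      · rw [hψ₃ e he he']
        have := hzL e
        grind
    · rw [hψ₃ d hd hd']
      have hzd := hzL d
      by_cases he : e = a ∨ e = b
      · rw [hψ₁ e he]
        grind
      by_cases he' : e = G.rev a ∨ e = G.rev b
      · rw [hψ₂ e he']
        grind
      · rw [hψ₃ e he he', hLi]
        tauto
  · have hqe : ∀ d, (H.edge (h₁.liftEdge d)).map (q.comp c₁).realize.continuous ≈ₚ
        K.edge (φ d) := fun d =>
      Hom.map_edge_inr _ ((Hom.comp_onD_inr q (h₁.onD_liftEdge d)).trans rfl)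
    have hκm : ∀ v, v ≠ H.tgt z →
        (κ v).map c.realize.continuous ≈ₚ Path.refl (K.vtx (c.onV v)) := fun v hv =>
      (hκ v hv).map c.realize
    have hκzm : (κ (H.tgt z)).map c.realize.continuous ≈ₚ
        (H.edge z).map c.realize.continuous := hκz.map c.realize
    have hfold : ∀ d, d = a ∨ d = b → H.tgt (h₁.liftEdge d) ≠ H.tgt z →
        ((H.edge (h₁.liftEdge d)).map (q.comp c₁).realize.continuous).trans
          ((κ (H.tgt (h₁.liftEdge d))).map c.realize.continuous) ≈ₚ
        ((κ (H.src (h₁.liftEdge d))).map c.realize.continuous).trans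
          ((H.edge (h₁.liftEdge d)).map c.realize.continuous) := by
      intro d hd hd'
      have hs : H.src (h₁.liftEdge d) = H.tgt z := (hL d).2 hd
      obtain ⟨x, hx⟩ := (hcol (h₁.liftEdge d)).2 (by rcases hd with rfl | rfl <;> simp)
      refine (HHomotopic.trans_of_right (hκm _ hd')).trans ((hqe d).trans ?_)
      refine HHomotopic.trans ?_ (HHomotopic.trans_of_right (c.map_edge_inl hx)).symm
      rw [hs]
      refine HHomotopic.trans ?_ hκzm.symm
      have := hφ d
      rw [hψ₁ d hd] at this
      exact (c.map_edge_inr this).symm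
    -- The map `q ∘ c₁` shrinks `z` to a point and spreads the remainders over the folded edge,
    -- while `c` shrinks the remainders and keeps `z`. Dragging the new vertex along the image of
    -- `z` turns one into the other.
    refine homotopic_of_squares (fun v => (κ v).map c.realize.continuous) fun d => ?_
    have hz : ((H.edge z).map (q.comp c₁).realize.continuous).trans
        ((κ (H.tgt z)).map c.realize.continuous) ≈ₚ
        ((κ (H.src z)).map c.realize.continuous).trans
          ((H.edge z).map c.realize.continuous) :=
      (HHomotopic.trans_of_left (Hom.map_edge_inl _ (Hom.comp_onD_inl q h₁.onD_self))).trans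
        (hκzm.trans (HHomotopic.trans_of_left (hκm _ h₁.ne)).symm)
    rcases h₁.eq_or_exists_liftEdge d with rfl | rfl | ⟨d, rfl⟩
    · exact .inl hz
    · right
      rw [H.rev_rev]
      exact hz
    by_cases hd : d = a ∨ d = b
    · exact .inl (hfold d hd (by rcases hd with rfl | rfl <;> assumption))
    by_cases hd' : d = G.rev a ∨ d = G.rev b
    · right
      rw [← h₁.liftEdge_rev]
      refine hfold _ ((hiff d).2.2 hd') ?_
      rcases hd' with rfl | rfl <;> rwa [G.rev_rev]
    · left
      have hs : H.src (h₁.liftEdge d) ≠ H.tgt z := by rwa [Ne, hL]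
      have ht : H.tgt (h₁.liftEdge d) ≠ H.tgt z := by rwa [Ne, htgt, (hiff d).2]
      refine (HHomotopic.trans_of_right (hκm _ ht)).trans ((hqe d).trans ?_)
      refine HHomotopic.trans ?_ (HHomotopic.trans_of_left (hκm _ hs)).symm
      have := hφ d
      rw [hψ₃ d hd hd'] at this
      exact (c.map_edge_inr this).symm

namespace Hom.IsFold

variable {q : Hom G H} {a b : G.D}

theorem card_lt (h : q.IsFold a b) : Nat.card H.D < Nat.card G.D := by
  obtain ⟨-, hab, -, φ, -, hφ, -, -, hφi⟩ := h
  have := Fintype.ofFinite G.D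
  have := Fintype.ofFinite H.D
  rw [Nat.card_eq_fintype_card, Nat.card_eq_fintype_card]
  refine Fintype.card_lt_of_surjective_not_injective φ hφ fun hi => hab (hi ?_)
  rw [hφi]
  exact .inr (.inl ⟨rfl, rfl⟩)

/-- A morphism that identifies `a` and `b` factors through the fold of `a` and `b`. -/
theorem exists_factor (h : q.IsFold a b) (f : Hom G K) (hf : f.onD a = f.onD b) :
    ∃ g : Hom H K, g.comp q = f := by
  obtain ⟨-, -, -, φ, hq, hφ, hV, hVi, hφi⟩ := h
  have hfr : f.onD (G.rev a) = f.onD (G.rev b) := by rw [f.map_rev, f.map_rev, hf]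
  have hft : f.onV (G.tgt a) = f.onV (G.tgt b) := by
    rw [tgt, tgt, ← f.map_src, ← f.map_src, hfr]
  obtain ⟨s, hs⟩ := hV.hasRightInverse
  obtain ⟨t, ht⟩ := hφ.hasRightInverse
  have hsf : ∀ v, f.onV (s (q.onV v)) = f.onV v := by
    intro v
    rcases (hVi _ _).1 (hs (q.onV v)) with h | ⟨h₁, h₂⟩ | ⟨h₁, h₂⟩
    · rw [h]
    · rw [h₁, h₂, hft]
    · rw [h₁, h₂, hft]
  have htf : ∀ d, f.onD (t (φ d)) = f.onD d := by
    intro d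
    rcases (hφi _ _).1 (ht (φ d)) with h | ⟨h₁, h₂⟩ | ⟨h₁, h₂⟩ | ⟨h₁, h₂⟩ | ⟨h₁, h₂⟩
    · rw [h]
    all_goals rw [h₁, h₂]; first | rw [hf] | rw [hfr]
  refine ⟨⟨fun w => f.onV (s w), fun e => f.onD (t e), fun e => ?_, fun e => ?_⟩,
    Hom.ext (funext hsf) (funext fun d => ?_)⟩
  · obtain ⟨d, rfl⟩ := hφ e
    rw [htf, f.map_src, q.src_inr (hq d), hsf]
  · obtain ⟨d, rfl⟩ := hφ e
    have hr : H.rev (φ d) = φ (G.rev d) :=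
      Sum.inr_injective ((q.onD_rev_inr (hq d)).symm.trans (hq _))
    rw [hr, htf, htf, f.map_rev]
  · exact (Hom.comp_onD_inr _ (hq d)).trans (htf d)

end Hom.IsFold

end FinGraph

/-! ## The steps of a folding sequence -/

namespace InverseMorphism

variable {n : ℕ}

theorem isHomotopyEquivalence_map (A : InverseMorphism n) :
    IsHomotopyEquivalence A.map.realize :=
  isHomotopyEquivalence_iff.2 ⟨_, A.marking_comp_map, A.map_comp_marking⟩

/-- A left homotopy inverse of the marking that is a graph morphism. -/
def ofHom (Γ : MarkedGraph n) (f : Hom Γ.G (rose n))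
    (h : (f.realize.comp Γ.marking).Homotopic (.id _)) : InverseMorphism n :=
  ⟨Γ, f, h, Γ.isHomotopyEquivalence.right_inv_of_left_inv h⟩

/-- The result of a homotopy equivalence `q` through which the morphism of `A` factors. -/
noncomputable def factor (A : InverseMorphism n) {H : FinGraph} {q : Hom A.G H}
    (hq : IsHomotopyEquivalence q.realize) {g : Hom H (rose n)} (hg : g.comp q = A.map) :
    InverseMorphism n :=
  ofHom (A.toMarkedGraph.push q hq) g (by
    change (g.realize.comp (q.realize.comp A.marking)).Homotopic _
    rw [← ContinuousMap.comp_assoc, ← Hom.realize_comp, hg]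
    exact A.map_comp_marking)

theorem factors_factor (A : InverseMorphism n) {H : FinGraph} {q : Hom A.G H}
    (hq : IsHomotopyEquivalence q.realize) {g : Hom H (rose n)} (hg : g.comp q = A.map) :
    A.Factors (A.factor hq hg) q :=
  ⟨hg, A.toMarkedGraph.carries_push q hq⟩

theorem exists_edgeCollapseStep {A : InverseMorphism n} {x : SpineVertex n}
    (hx : A.toMarkedGraph.Represents x) {a : A.G.D} {v : (rose n).V}
    (ha : A.map.onD a = Sum.inl v) :
    ∃ B : InverseMorphism n, A.EdgeCollapseStep B ∧ Nat.card B.G.D < Nat.card A.G.D ∧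
      ∃ x', B.toMarkedGraph.Represents x' ∧ x.Collapses x' := by
  obtain ⟨H, c, hc⟩ :=
    exists_isEdgeCollapse (src_ne_tgt_of_collapsed A.isHomotopyEquivalence_map ha)
  obtain ⟨g, hg⟩ := hc.exists_factor A.map ha
  have hB := A.factors_factor hc.isHomotopyEquivalence hg
  obtain ⟨x', hx', h⟩ := hx.exists_of_collapse
    (Γ' := (A.factor hc.isHomotopyEquivalence hg).toMarkedGraph) ⟨c, a, hc, hB.2⟩
  exact ⟨_, ⟨c, a, hc, hB⟩, hc.card_lt, x', hx', SpineVertex.collapses_of_steps (.inl rfl) h⟩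

/-- The partially folded graph `H`, with the marking pulled back along the collapse of `z`,
represents the intermediate vertex `y`. One collapse leads from `H` to `A`, two others lead to the
folded graph. -/
theorem exists_foldStep (hn : 2 ≤ n) {A : InverseMorphism n} {x : SpineVertex n}
    (hx : A.toMarkedGraph.Represents x) {a b : A.G.D} {e : (rose n).D}
    (hab : A.G.src a = A.G.src b) (hba : b ≠ a) (ha : A.map.onD a = Sum.inr e)
    (hb : A.map.onD b = Sum.inr e) :
    ∃ B : InverseMorphism n, A.FoldStep B ∧ Nat.card B.G.D < Nat.card A.G.D ∧
      ∃ x', B.toMarkedGraph.Represents x' ∧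
        ∃ y, (y = x ∨ y.IsBlowup x) ∧ y.Collapses x' := by
  -- An oriented petal of the rose differs from its reverse, so an edge and its reverse are never
  -- identified.
  have hbr : b ≠ A.G.rev a := by
    rintro rfl
    rw [A.map.onD_rev_inr ha] at hb
    exact (rose n).rev_ne e (Sum.inr_injective hb)
  have ht := tgt_ne_tgt_of_identified A.isHomotopyEquivalence_map hab ha hb hba hbr
  obtain ⟨H, H', K, c₁, z, c₂, a', c₃, b', q, h₁, h₂, h₃, hq, hom⟩ := exists_fold hab hba hbr ht
  -- Since `q ∘ c₁` is homotopic to `c₃ ∘ c₂` and the three collapses are homotopy equivalences, so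
  -- is `q`.
  have hqe : IsHomotopyEquivalence q.realize := by
    have h : IsHomotopyEquivalence (c₃.comp c₂).realize := by
      rw [Hom.realize_comp]
      exact h₃.isHomotopyEquivalence.comp h₂.isHomotopyEquivalence
    have h := h.congr hom.symm
    rw [Hom.realize_comp] at h
    exact h.of_comp h₁.isHomotopyEquivalence
  obtain ⟨g, hg⟩ := hq.exists_factor A.map (ha.trans hb.symm)
  have hB := A.factors_factor hqe hg
  obtain ⟨m, hm, hΓ⟩ := A.toMarkedGraph.exists_pull c₁ h₁.isHomotopyEquivalence
  obtain ⟨y, hy⟩ := MarkedGraph.exists_represents hn ⟨H, m, hm⟩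
  obtain ⟨x₁, hx₁, hxy⟩ := hy.exists_of_collapse (Γ' := A.toMarkedGraph) ⟨c₁, z, h₁, hΓ⟩
  obtain rfl := hx₁.unique hx
  have hΓ₂ := MarkedGraph.carries_push ⟨H, m, hm⟩ c₂ h₂.isHomotopyEquivalence
  obtain ⟨x₂, hx₂, h₄⟩ := hy.exists_of_collapse
    (Γ' := MarkedGraph.push ⟨H, m, hm⟩ c₂ h₂.isHomotopyEquivalence) ⟨c₂, a', h₂, hΓ₂⟩
  have hqB : (⟨H, m, hm⟩ : MarkedGraph n).Carries (A.factor hqe hg).toMarkedGraph (q.comp c₁) :=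
    hΓ.comp hB.2
  have hqB' : (⟨H, m, hm⟩ : MarkedGraph n).Carries (A.factor hqe hg).toMarkedGraph
      (c₃.comp c₂) :=
    (hom.symm.comp (ContinuousMap.Homotopic.refl _)).trans hqB
  obtain ⟨x₃, hx₃, h₅⟩ := hx₂.exists_of_collapse (Γ' := (A.factor hqe hg).toMarkedGraph)
    ⟨c₃, b', h₃, MarkedGraph.Carries.of_comp
      (Γ₂ := MarkedGraph.push ⟨H, m, hm⟩ c₂ h₂.isHomotopyEquivalence)
      (Γ₃ := (A.factor hqe hg).toMarkedGraph) (c' := c₃) hΓ₂ hqB'⟩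
  exact ⟨_, ⟨q, a, b, hq, ht, hB⟩, hq.card_lt, x₃, hx₃, y, hxy.imp_left Eq.symm,
    SpineVertex.collapses_of_steps h₄ h₅⟩

end InverseMorphism

/-! ## Immersions into the rose -/

namespace FinGraph

variable {G H : FinGraph} {n : ℕ}

theorem Hom.isHomeomorph_of_iso {f : Hom G H} {g : Hom H G} (h₁ : g.comp f = Hom.id G)
    (h₂ : f.comp g = Hom.id H) : IsHomeomorph f.realize := by
  refine isHomeomorph_iff_exists_inverse.2 ⟨f.realize.continuous, g.realize, ?_, ?_,
    g.realize.continuous⟩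
  · intro x
    rw [← ContinuousMap.comp_apply, ← Hom.realize_comp, h₁, Hom.realize_id]
    rfl
  · intro x
    rw [← ContinuousMap.comp_apply, ← Hom.realize_comp, h₂, Hom.realize_id]
    rfl

/-- An injective map of a finite set into its double, extended to a permutation of the double. -/
theorem exists_perm_extend {V : Type} [Finite V] {h : V → V ⊕ V} (hh : Injective h) :
    ∃ σ : Equiv.Perm (V ⊕ V), ∀ v, σ (Sum.inl v) = h v := by
  classical
  let e : {x : V ⊕ V // x ∈ Set.range (Sum.inl : V → V ⊕ V)} ≃ {x : V ⊕ V // x ∈ Set.range h} :=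
    (Equiv.ofInjective _ Sum.inl_injective).symm.trans (Equiv.ofInjective h hh)
  have := Fintype.ofFinite V
  refine ⟨e.extendSubtype, fun v => ?_⟩
  rw [e.extendSubtype_apply_of_mem _ ⟨v, rfl⟩]
  have : (Equiv.ofInjective _ (Sum.inl_injective (α := V) (β := V))).symm ⟨Sum.inl v, v, rfl⟩ = v :=
    Equiv.ofInjective_symm_apply _ v
  simp only [e, Equiv.trans_apply, this, Equiv.ofInjective_apply]

section Immersion

variable {f : Hom G (rose n)} {φ : G.D → (rose n).D}

/-- If a graph morphism to the rose is an immersion and a homotopy equivalence, then there is a loop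
over every petal at every vertex. -/
theorem exists_loop_of_immersion (hf : IsHomotopyEquivalence f.realize)
    (hφ : ∀ d, f.onD d = Sum.inr (φ d))
    (hinj : ∀ a b, G.src a = G.src b → φ a = φ b → a = b) (v : G.V) (i : Fin n) :
    ∃ d, G.src d = v ∧ G.tgt d = v ∧ φ d = (i, true) := by
  classical
  have hrev : ∀ d, φ (G.rev d) = (rose n).rev (φ d) := fun d =>
    Sum.inr_injective ((hφ _).symm.trans (f.onD_rev_inr (hφ d)))
  -- A vertex with no edge over the petal `j` is sent to the second copy of the vertices. Arriving
  -- in the first copy thus proves that the edge exists. Injectivity uses that the reversed edges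
  -- are not folded either.
  let h : Fin n → G.V → G.V ⊕ G.V := fun j u =>
    if hu : ∃ d, G.src d = u ∧ φ d = (j, true) then Sum.inl (G.tgt hu.choose) else Sum.inr u
  have hh : ∀ j d, φ d = (j, true) → h j (G.src d) = Sum.inl (G.tgt d) := by
    intro j d hd
    have hu : ∃ d', G.src d' = G.src d ∧ φ d' = (j, true) := ⟨d, rfl, hd⟩
    have : hu.choose = d :=
      hinj _ _ hu.choose_spec.1 (hu.choose_spec.2.trans hd.symm)
    refine (dif_pos hu).trans ?_
    rw [this]
  have hh' : ∀ j u, (¬ ∃ d, G.src d = u ∧ φ d = (j, true)) → h j u = Sum.inr u := fun j u hu =>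
    dif_neg hu
  have hhi : ∀ j, Injective (h j) := by
    intro j u w huw
    by_cases hu : ∃ d, G.src d = u ∧ φ d = (j, true)
    · obtain ⟨d, rfl, hd⟩ := hu
      by_cases hw : ∃ d, G.src d = w ∧ φ d = (j, true)
      · obtain ⟨d', rfl, hd'⟩ := hw
        rw [hh j d hd, hh j d' hd'] at huw
        have := hinj (G.rev d) (G.rev d') (Sum.inl_injective huw)
          (by rw [hrev, hrev, hd, hd'])
        rw [G.rev_injective this]
      · rw [hh j d hd, hh' j w hw] at huw
        cases huw
    · by_cases hw : ∃ d, G.src d = w ∧ φ d = (j, true)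
      · obtain ⟨d', rfl, hd'⟩ := hw
        rw [hh' j u hu, hh j d' hd'] at huw
        cases huw
      · rw [hh' j u hu, hh' j w hw] at huw
        exact Sum.inr_injective huw
  choose σ hσ using fun j => exists_perm_extend (hhi j)
  let Λ : (rose n).D → Equiv.Perm (G.V ⊕ G.V) := fun d => if d.2 then σ d.1 else (σ d.1)⁻¹
  have hΛ : ∀ d, Λ ((rose n).rev d) = (Λ d)⁻¹ := by
    rintro ⟨j, b⟩
    cases b
    · exact (inv_inv _).symm
    · rfl
  have hΛφ : ∀ d, Λ (φ d) (Sum.inl (G.src d)) = Sum.inl (G.tgt d) := by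
    intro d
    have key : ∀ d j, φ d = (j, true) → Λ (φ d) (Sum.inl (G.src d)) = Sum.inl (G.tgt d) := by
      intro d j hd
      rw [hd]
      exact (hσ j _).trans (hh j d hd)
    rcases hd : φ d with ⟨j, b⟩
    cases b
    · have hd' : φ (G.rev d) = (j, true) := by rw [hrev, hd]; rfl
      have := key _ j hd'
      rw [hrev, hΛ, tgt_rev, Equiv.Perm.inv_eq_iff_eq, src_rev, hd] at this
      exact this.symm
    · rw [← hd]
      exact key d j hd
  -- The sheets in the first copy follow the immersion: the image of an edge path from `u` to `w`
  -- carries the sheet of `u` to that of `w`.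
  have htr : ∀ {a b : G.Realization} {p : Path a b}, IsEdgeWord G p → ∃ u w, a = G.vtx u ∧
      b = G.vtx w ∧ Transports Λ (p.map f.realize.continuous) (Sum.inl u) (Sum.inl w) := by
    intro a b p hp
    induction hp with
    | refl u => exact ⟨u, u, rfl, rfl, .refl _ _⟩
    | edge d =>
      refine ⟨_, _, rfl, rfl, Transports.congr (f.map_edge_inr (hφ d)).symm ?_⟩
      have := Transports.edge hΛ (φ d) (Sum.inl (G.src d))
      rwa [hΛφ] at this
    | trans _ _ h₁ h₂ =>
      obtain ⟨u, w, rfl, rfl, h⟩ := h₁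
      obtain ⟨w', x, hw, rfl, h'⟩ := h₂
      obtain rfl := vtx_injective hw
      refine ⟨u, x, rfl, rfl, ?_⟩
      rw [Path.map_trans]
      exact h.trans h'
    | congr e _ h =>
      obtain ⟨u, w, rfl, rfl, h⟩ := h
      have e' := e
      obtain ⟨rfl, rfl, -⟩ := e'
      exact ⟨u, w, rfl, rfl, h.congr (e.map f.realize)⟩
  -- Some closed path at `v` maps to the petal up to homotopy. It fixes the sheet of `v`, so the
  -- petal does too, which says that `h i v` is `v` in the first copy.
  obtain ⟨p, hp⟩ := hf.exists_path (a := G.vtx v) (b := G.vtx v) ((rose n).edge (i, true))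
  obtain ⟨u, w, hu, hw, ht⟩ := htr (isEdgeWord p)
  obtain rfl := vtx_injective hu
  obtain rfl := vtx_injective hw
  have h₁ := (ht.congr hp).unique (Transports.edge hΛ (i, true) _)
  have h₂ : h i v = Sum.inl v := (hσ i v).symm.trans h₁.symm
  by_cases hv : ∃ d, G.src d = v ∧ φ d = (i, true)
  · obtain ⟨d, rfl, hd⟩ := hv
    rw [hh i d hd] at h₂
    exact ⟨d, rfl, Sum.inl_injective h₂, hd⟩
  · rw [hh' i v hv] at h₂
    cases h₂

/-- A graph morphism to the rose that is an immersion and a homotopy equivalence is an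
isomorphism. -/
theorem exists_inverse_of_immersion (hf : IsHomotopyEquivalence f.realize)
    (hφ : ∀ d, f.onD d = Sum.inr (φ d))
    (hinj : ∀ a b, G.src a = G.src b → φ a = φ b → a = b) :
    ∃ g : Hom (rose n) G, g.comp f = Hom.id G ∧ f.comp g = Hom.id (rose n) := by
  have hrev : ∀ d, φ (G.rev d) = (rose n).rev (φ d) := fun d =>
    Sum.inr_injective ((hφ _).symm.trans (f.onD_rev_inr (hφ d)))
  have hloop : ∀ v (e : (rose n).D), ∃ d, G.src d = v ∧ G.tgt d = v ∧ φ d = e := by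
    rintro v ⟨i, b⟩
    obtain ⟨d, h₁, h₂, h₃⟩ := exists_loop_of_immersion hf hφ hinj v i
    cases b
    · exact ⟨G.rev d, h₂, (G.tgt_rev d).trans h₁, by rw [hrev, h₃]; rfl⟩
    · exact ⟨d, h₁, h₂, h₃⟩
  obtain ⟨v⟩ : Nonempty G.V := by
    obtain ⟨k, -, -⟩ := isHomotopyEquivalence_iff.1 hf
    exact ⟨tailVertex (k ((rose n).vtx ()))⟩
  -- By injectivity on stars, every edge at `v` is the loop found over its petal. No edge leaves
  -- `v`, and `G` is connected.
  have hV : ∀ u, u = v := fun u => (connectedVia_univ hf v u).eq_of_forall fun d hd => by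
    obtain ⟨d', h₁, h₂, h₃⟩ := hloop v (φ d)
    rwa [← hinj d' d (h₁.trans hd.symm) h₃]
  have hbij : Bijective φ :=
    ⟨fun a b => hinj a b ((hV _).trans (hV _).symm), fun e =>
      let ⟨d, _, _, h⟩ := hloop v e
      ⟨d, h⟩⟩
  let e := Equiv.ofBijective φ hbij
  have he : ∀ d, e.symm (φ d) = d := e.symm_apply_apply
  refine ⟨⟨fun _ => v, fun d => Sum.inr (e.symm d), fun d => hV _, fun d => ?_⟩, ?_, ?_⟩
  · obtain ⟨d, rfl⟩ := hbij.2 d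
    change Sum.inr (e.symm _) = Sum.inr (G.rev (e.symm _))
    rw [← hrev, he, he]
  · refine Hom.ext (funext fun u => (hV u).symm) (funext fun d => ?_)
    refine (Hom.comp_onD_inr _ (hφ d)).trans ?_
    exact congrArg Sum.inr (he d)
  · refine Hom.ext rfl (funext fun d => ?_)
    obtain ⟨d, rfl⟩ := hbij.2 d
    refine (Hom.comp_onD_inr f (e := d) (congrArg Sum.inr (he d))).trans (hφ d)

end Immersion

/-! ### Local injectivity near a vertex excludes collapses and folds -/

theorem pt_ne_vtx' (d : G.D) {t : unitInterval} (h₀ : 0 < t) (h₁ : t < 1) (v : G.V) :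
    G.pt d t ≠ G.vtx v := by
  by_cases hd : G.Pos d
  · exact pt_ne_vtx hd h₀ h₁ v
  · rw [← unitInterval.symm_symm t, ← pt_rev]
    exact pt_ne_vtx ((G.pos_rev d).2 hd) (unitInterval.lt_symm_comm.2 (by simpa using h₁))
      (unitInterval.symm_lt_comm.2 (by simpa using h₀)) v

/-- The bound `1 / 2` excludes that `b` is the reverse of `a`: the same point would have the
parameters `t` and `1 - t` on one edge. -/
theorem eq_of_pt_eq_pt {a b : G.D} {t : unitInterval} (h₀ : 0 < t) (h₁ : (t : ℝ) < 1 / 2)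
    (h : G.pt a t = G.pt b t) : a = b := by
  have h₁' : t < 1 := show (t : ℝ) < 1 by linarith
  have hs₀ : 0 < unitInterval.symm t := unitInterval.lt_symm_comm.2 (by simpa using h₁')
  have hs₁ : unitInterval.symm t < 1 := unitInterval.symm_lt_comm.2 (by simpa using h₀)
  have hne : t ≠ unitInterval.symm t := fun h => by
    have := congrArg Subtype.val h
    rw [unitInterval.coe_symm_eq] at this
    linarith
  have hr : ∀ d, G.pt d t = G.pt (G.rev d) (unitInterval.symm t) := fun d => by
    rw [pt_rev, unitInterval.symm_symm]
  by_cases ha : G.Pos a <;> by_cases hb : G.Pos b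
  · exact (pt_eq_pt ha hb h₀ h₁' h).1
  · rw [hr b] at h
    exact absurd (pt_eq_pt ha ((G.pos_rev b).2 hb) h₀ h₁' h).2 hne
  · rw [hr a] at h
    exact absurd (pt_eq_pt ((G.pos_rev a).2 ha) hb hs₀ hs₁ h).2 hne.symm
  · rw [hr a, hr b] at h
    exact G.rev_injective
      (pt_eq_pt ((G.pos_rev a).2 ha) ((G.pos_rev b).2 hb) hs₀ hs₁ h).1

theorem exists_pt_mem {U : Set G.Realization} (hU : IsOpen U) {a b : G.D}
    (hab : G.src a = G.src b) (h : G.vtx (G.src a) ∈ U) :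
    ∃ t : unitInterval, 0 < t ∧ (t : ℝ) < 1 / 2 ∧ G.pt a t ∈ U ∧ G.pt b t ∈ U := by
  have : (𝓝[>] (0 : unitInterval)).NeBot := nhdsGT_neBot_of_exists_gt ⟨1, zero_lt_one⟩
  have h₁ : ∀ᶠ t in 𝓝 (0 : unitInterval), G.pt a t ∈ U :=
    (G.continuous_pt a).continuousAt.eventually (hU.mem_nhds (by rwa [pt_zero]))
  have h₂ : ∀ᶠ t in 𝓝 (0 : unitInterval), G.pt b t ∈ U :=
    (G.continuous_pt b).continuousAt.eventually (hU.mem_nhds (by rwa [pt_zero, ← hab]))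
  have h₃ : ∀ᶠ t : unitInterval in 𝓝 0, (t : ℝ) < 1 / 2 :=
    (isOpen_lt continuous_subtype_val continuous_const).mem_nhds
      (show ((0 : unitInterval) : ℝ) < 1 / 2 by simp)
  obtain ⟨t, ht, h⟩ := ((eventually_mem_nhdsWithin (a := (0 : unitInterval))
    (s := Set.Ioi 0)).and (((h₁.and h₂).and h₃).filter_mono nhdsWithin_le_nhds)).exists
  exact ⟨t, ht, h.2, h.1.1, h.1.2⟩

/-- A locally injective graph morphism does not collapse or fold edges. -/
theorem Hom.exists_immersion_of_isLocallyInjective {f : Hom G H}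
    (hf : IsLocallyInjective f.realize) : ∃ φ : G.D → H.D, (∀ d, f.onD d = Sum.inr (φ d)) ∧
      ∀ a b, G.src a = G.src b → φ a = φ b → a = b := by
  have hex : ∀ d, ∃ e, f.onD d = Sum.inr e := by
    intro d
    rcases hd : f.onD d with v | e
    · obtain ⟨U, hU, hx, hinj⟩ := hf (G.vtx (G.src d))
      obtain ⟨t, h₀, h₁, ht, -⟩ := exists_pt_mem hU (a := d) rfl hx
      refine absurd (hinj ht hx ?_)
        (pt_ne_vtx' d h₀ (show (t : ℝ) < 1 by linarith) _)
      rw [f.realize_pt_inl hd, f.realize_vtx, f.src_inl hd]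
    · exact ⟨e, rfl⟩
  choose φ hφ using hex
  refine ⟨φ, hφ, fun a b hab he => ?_⟩
  obtain ⟨U, hU, hx, hinj⟩ := hf (G.vtx (G.src a))
  obtain ⟨t, h₀, h₁, ha, hb⟩ := exists_pt_mem hU hab hx
  refine eq_of_pt_eq_pt h₀ h₁ (hinj ha hb ?_)
  rw [f.realize_pt_inr (hφ a), f.realize_pt_inr (hφ b), he]

/-- A locally injective homotopy equivalence from a finite graph to the rose is a homeomorphism. -/
theorem isHomeomorph_of_isLocallyInjective {f : Hom G (rose n)}
    (hf : IsHomotopyEquivalence f.realize) (hl : IsLocallyInjective f.realize) :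
    IsHomeomorph f.realize := by
  obtain ⟨φ, hφ, hinj⟩ := Hom.exists_immersion_of_isLocallyInjective hl
  obtain ⟨g, h₁, h₂⟩ := exists_inverse_of_immersion hf hφ hinj
  exact Hom.isHomeomorph_of_iso h₁ h₂

end FinGraph

/-! ## Morphisms to the rose that represent a given map -/

namespace FinGraph

variable {G : FinGraph} {n : ℕ}

/-- The loop in the rose that is given by a word in the oriented petals. -/
noncomputable def wordPath : List (rose n).D → Path ((rose n).vtx ()) ((rose n).vtx ())
  | [] => Path.refl _
  | e :: l => Path.trans (y := (rose n).vtx ()) ((rose n).edge e) (wordPath l)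

/-- The formal inverse of a word. -/
def wordInv (l : List (rose n).D) : List (rose n).D := (l.map (rose n).rev).reverse

theorem wordInv_wordInv (l : List (rose n).D) : wordInv (wordInv l) = l := by
  have : (rose n).rev ∘ (rose n).rev = _root_.id := funext (rose n).rev_rev
  simp [wordInv, ← List.map_reverse, this]

theorem wordPath_append (l l' : List (rose n).D) :
    wordPath (l ++ l') ≈ₚ (wordPath l).trans (wordPath l') := by
  induction l with
  | nil => exact (HHomotopic.refl_trans _).symm
  | cons e l ih => exact (HHomotopic.congr_trans (.refl _) ih).trans (HHomotopic.assoc _ _ _).symm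

theorem wordPath_singleton (e : (rose n).D) : wordPath [e] ≈ₚ (rose n).edge e :=
  HHomotopic.trans_refl _

theorem wordPath_wordInv (l : List (rose n).D) : wordPath (wordInv l) ≈ₚ (wordPath l).symm := by
  induction l with
  | nil => exact .of_eq Path.refl_symm.symm
  | cons e l ih =>
    have h : wordInv (e :: l) = wordInv l ++ [(rose n).rev e] := by simp [wordInv]
    rw [h]
    refine (wordPath_append _ _).trans ?_
    refine HHomotopic.trans (.congr_trans ih ((wordPath_singleton _).trans
      ((rose n).edge_rev e))) ?_
    exact .of_eq (Path.trans_symm (y := (rose n).vtx ()) ((rose n).edge e) (wordPath l)).symm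

theorem IsEdgeWord.exists_wordPath {a b : (rose n).Realization} {p : Path a b}
    (h : IsEdgeWord (rose n) p) : ∃ l, wordPath l ≈ₚ p := by
  induction h with
  | refl v => exact ⟨[], .refl _⟩
  | edge d => exact ⟨[d], wordPath_singleton d⟩
  | trans _ _ h₁ h₂ =>
    obtain ⟨l, hl⟩ := h₁
    obtain ⟨l', hl'⟩ := h₂
    exact ⟨l ++ l', (wordPath_append l l').trans (.congr_trans hl hl')⟩
  | congr e _ h =>
    obtain ⟨l, hl⟩ := h
    exact ⟨l, hl.trans e⟩

/-- The map of a graph to the rose that reads given words on the edges. -/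
noncomputable def wordMap (w : G.D → List (rose n).D) : C(G.Realization, (rose n).Realization) :=
  ofPaths (fun _ => (rose n).vtx ()) fun d => wordPath (w d)

theorem edge_map_wordMap {w : G.D → List (rose n).D} (hw : ∀ d, w (G.rev d) = wordInv (w d))
    (d : G.D) : (G.edge d).map (wordMap w).continuous ≈ₚ wordPath (w d) := by
  have h := wordPath_wordInv (w d)
  rw [← hw] at h
  exact edge_map_ofPaths (y := fun _ => (rose n).vtx ()) (P := fun d => wordPath (w d)) h

/-- Every map of a graph to the rose reads words on the edges, up to homotopy. -/
theorem exists_wordMap (s : C(G.Realization, (rose n).Realization)) :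
    ∃ w : G.D → List (rose n).D, (∀ d, w (G.rev d) = wordInv (w d)) ∧
      s.Homotopic (wordMap w) := by
  classical
  -- The image of each vertex is dragged to the base vertex, so that edges become loops and hence
  -- words. The words are chosen on positive edges and inverted on the others.
  let κ : ∀ v, Path (s (G.vtx v)) ((rose n).vtx ()) := fun v => (tail _).symm
  have hl : ∀ d, ∃ l, wordPath l ≈ₚ
      ((κ (G.src d)).symm.trans (((G.edge d).map s.continuous).trans (κ (G.tgt d)))) := fun d =>
    (isEdgeWord (G := rose n) (u := ()) (v := ()) _).exists_wordPath
  choose l hl using hl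
  let w : G.D → List (rose n).D := fun d => if G.Pos d then l d else wordInv (l (G.rev d))
  have hw : ∀ d, w (G.rev d) = wordInv (w d) := by
    intro d
    by_cases hd : G.Pos d
    · have h₁ : w d = l d := if_pos hd
      have h₂ : w (G.rev d) = wordInv (l (G.rev (G.rev d))) :=
        if_neg fun h => (G.pos_rev d).1 h hd
      rw [h₁, h₂, G.rev_rev]
    · have h₁ : w d = wordInv (l (G.rev d)) := if_neg hd
      have h₂ : w (G.rev d) = l (G.rev d) := if_pos ((G.pos_rev d).2 hd)
      rw [h₁, h₂, wordInv_wordInv]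
  refine ⟨w, hw, homotopic_of_squares κ fun d => ?_⟩
  have key : ∀ d, G.Pos d → ((G.edge d).map s.continuous).trans (κ (G.tgt d)) ≈ₚ
      (κ (G.src d)).trans ((G.edge d).map (wordMap w).continuous) := by
    intro d hd
    have h₁ : w d = l d := if_pos hd
    have h₂ := edge_map_wordMap hw d
    rw [h₁] at h₂
    refine HHomotopic.trans ?_ (HHomotopic.congr_trans (.refl _) (h₂.trans (hl d))).symm
    exact ((HHomotopic.assoc _ _ _).symm.trans
      (HHomotopic.trans_of_left (HHomotopic.trans_symm (κ (G.src d))))).symm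
  by_cases hd : G.Pos d
  · exact .inl (key d hd)
  · exact .inr (key _ ((G.pos_rev d).2 hd))

/-- If the words are letters or empty, then the map that reads them is homotopic to a graph
morphism. -/
theorem exists_hom_of_length_le_one {w : G.D → List (rose n).D}
    (hw : ∀ d, w (G.rev d) = wordInv (w d)) (hl : ∀ d, (w d).length ≤ 1) :
    ∃ f : Hom G (rose n), f.realize.Homotopic (wordMap w) := by
  let g : List (rose n).D → (rose n).V ⊕ (rose n).D
    | [] => Sum.inl ()
    | e :: _ => Sum.inr e
  let f : Hom G (rose n) :=
    { onV := fun _ => ()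
      onD := fun d => g (w d)
      map_src := fun d => rfl
      map_rev := fun d => by
        rw [hw]
        have := hl d
        match w d, this with
        | [], _ => rfl
        | [e], _ => rfl }
  refine ⟨f, homotopic_of_squares (fun v => Path.refl ((rose n).vtx ())) fun d => .inl ?_⟩
  refine HHomotopic.trans (HHomotopic.trans_refl _) (HHomotopic.trans ?_
    (HHomotopic.refl_trans _).symm)
  refine HHomotopic.trans ?_ (edge_map_wordMap hw d).symm
  have hd : f.onD d = g (w d) := rfl
  have := hl d
  match h : w d, this with
  | [], _ =>
    rw [h] at hd
    exact f.map_edge_inl hd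
  | [e], _ =>
    rw [h] at hd
    exact (f.map_edge_inr hd).trans (wordPath_singleton e).symm

/-- An edge with a word that is not a letter is subdivided after the first letter. -/
theorem exists_subdivision {w : G.D → List (rose n).D} (hw : ∀ d, w (G.rev d) = wordInv (w d))
    {a : G.D} {e : (rose n).D} {l : List (rose n).D} (ha : w a = e :: l) :
    ∃ (H : FinGraph) (c : Hom H G) (z : H.D) (h : c.IsEdgeCollapse z)
      (w' : H.D → List (rose n).D), H.valence (H.tgt z) = 2 ∧
      (∀ d, w' (H.rev d) = wordInv (w' d)) ∧
      ((wordMap w).comp c.realize).Homotopic (wordMap w') ∧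
      (w' z).length = 1 ∧ (w' (H.rev z)).length = 1 ∧
      (w' (h.liftEdge a)).length = l.length ∧
      ∀ d, (w' (h.liftEdge d)).length ≤ (w d).length := by
  classical
  -- Splitting off `a` alone subdivides it: `z` will carry the first letter `e` and the lift of `a`
  -- the rest `l`.
  obtain ⟨H, c, z, h, -, hL⟩ := exists_split (G := G) (v := G.src a) (P := {a}) (by
    rintro d rfl
    rfl)
  simp only [Set.mem_singleton_iff] at hL
  have hra := G.rev_ne a
  have hzL : ∀ d, h.liftEdge d ≠ z ∧ h.liftEdge d ≠ H.rev z := fun d =>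
    h.ne_of_inr (h.onD_liftEdge d)
  have hzz := H.rev_ne z
  have hLi : ∀ d d', h.liftEdge d = h.liftEdge d' ↔ d = d' := fun d d' =>
    h.liftEdge_injective.eq_iff
  have htgt : ∀ d, H.tgt (h.liftEdge d) = H.tgt z ↔ G.rev d = a := fun d => by
    rw [← hL, h.liftEdge_rev]
    rfl
  let r : G.D → List (rose n).D := fun d =>
    if d = a then l else if d = G.rev a then wordInv l else w d
  have hr₁ : r a = l := if_pos rfl
  have hr₂ : r (G.rev a) = wordInv l := (if_neg hra).trans (if_pos rfl)
  have hr₃ : ∀ d, d ≠ a → d ≠ G.rev a → r d = w d := fun d h₁ h₂ => (if_neg h₁).trans (if_neg h₂)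
  have hr : ∀ d, r (G.rev d) = wordInv (r d) := by
    intro d
    by_cases h₁ : d = a
    · rw [h₁, hr₁, hr₂]
    by_cases h₂ : d = G.rev a
    · rw [h₂, G.rev_rev, hr₁, hr₂, wordInv_wordInv]
    · rw [hr₃ d h₁ h₂, hr₃ (G.rev d) (fun h => h₂ (G.rev_eq_iff.1 h))
        (fun h => h₁ (G.rev_injective h)), hw]
  let w' : H.D → List (rose n).D := fun d =>
    if d = z then [e] else if d = H.rev z then wordInv [e] else
      Sum.elim (fun _ => []) r (c.onD d)
  have hw₁ : w' z = [e] := if_pos rfl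
  have hw₂ : w' (H.rev z) = wordInv [e] := (if_neg hzz).trans (if_pos rfl)
  have hw₃ : ∀ d, w' (h.liftEdge d) = r d := fun d => by
    refine (if_neg (hzL d).1).trans ((if_neg (hzL d).2).trans ?_)
    rw [h.onD_liftEdge]
    rfl
  have hw' : ∀ d, w' (H.rev d) = wordInv (w' d) := by
    intro d
    rcases h.eq_or_exists_liftEdge d with rfl | rfl | ⟨d, rfl⟩
    · rw [hw₁, hw₂]
    · rw [H.rev_rev, hw₁, hw₂, wordInv_wordInv]
    · rw [← h.liftEdge_rev, hw₃, hw₃, hr]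
  have hlen : ∀ l : List (rose n).D, (wordInv l).length = l.length := fun l => by simp [wordInv]
  refine ⟨H, c, z, h, w', ?_, hw', ?_, by rw [hw₁]; rfl, by rw [hw₂]; rfl, by rw [hw₃, hr₁],
    fun d => ?_⟩
  · rw [h.valence_tgt (P := {a}) (by simpa using hL), Set.ncard_singleton]
  -- In the homotopy the subdivision point traverses the letter `e`, and all other vertices stay at
  -- the base vertex.
  · let p : ∀ v : H.V, Path ((rose n).vtx ()) ((rose n).vtx ()) := fun v =>
      if v = H.tgt z then wordPath [e] else wordPath []
    have hp₁ : p (H.tgt z) = wordPath [e] := if_pos rfl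
    have hp₂ : ∀ v, v ≠ H.tgt z → p v ≈ₚ Path.refl ((rose n).vtx ()) := fun v hv =>
      .of_eq (if_neg hv)
    have hcL : ∀ d, (H.edge (h.liftEdge d)).map ((wordMap w).comp c.realize).continuous ≈ₚ
        wordPath (w d) := fun d =>
      ((c.map_edge_inr (h.onD_liftEdge d)).map (wordMap w)).trans (edge_map_wordMap hw d)
    have hw'L : ∀ d, (H.edge (h.liftEdge d)).map (wordMap w').continuous ≈ₚ wordPath (r d) :=
      fun d => (edge_map_wordMap hw' _).trans (.of_eq (by rw [hw₃]))
    have hz : ((H.edge z).map ((wordMap w).comp c.realize).continuous).trans (p (H.tgt z)) ≈ₚ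
        (p (H.src z)).trans ((H.edge z).map (wordMap w').continuous) := by
      have h₁ : (H.edge z).map ((wordMap w).comp c.realize).continuous ≈ₚ
          Path.refl ((rose n).vtx ()) := (c.map_edge_inl h.onD_self).map (wordMap w)
      have h₂ := edge_map_wordMap hw' z
      refine (HHomotopic.trans_of_left h₁).trans (HHomotopic.trans ?_
        (HHomotopic.trans_of_left (hp₂ _ h.ne)).symm)
      rw [hp₁, ← hw₁]
      exact h₂.symm
    have ha' : ((H.edge (h.liftEdge a)).map ((wordMap w).comp c.realize).continuous).trans
          (p (H.tgt (h.liftEdge a))) ≈ₚ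
        (p (H.src (h.liftEdge a))).trans
          ((H.edge (h.liftEdge a)).map (wordMap w').continuous) := by
      have h₁ := hw'L a
      rw [hr₁] at h₁
      have h₂ := hcL a
      rw [ha] at h₂
      have hs : p (H.src (h.liftEdge a)) = wordPath [e] := if_pos ((hL a).2 rfl)
      refine (HHomotopic.trans_of_right (hp₂ _ (by rwa [Ne, htgt]))).trans (h₂.trans ?_)
      rw [hs]
      exact ((HHomotopic.congr_trans (wordPath_singleton e) h₁)).symm
    refine homotopic_of_squares p fun d => ?_
    rcases h.eq_or_exists_liftEdge d with rfl | rfl | ⟨d, rfl⟩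
    · exact .inl hz
    · right
      rw [H.rev_rev]
      exact hz
    by_cases h₁ : d = a
    · rw [h₁]
      exact .inl ha'
    by_cases h₂ : d = G.rev a
    · right
      rw [← h.liftEdge_rev, h₂, G.rev_rev]
      exact ha'
    · left
      have hs : H.src (h.liftEdge d) ≠ H.tgt z := by rwa [Ne, hL]
      have ht : H.tgt (h.liftEdge d) ≠ H.tgt z := by rwa [Ne, htgt, G.rev_eq_iff]
      have h₃ := hw'L d
      rw [hr₃ d h₁ h₂] at h₃
      exact (HHomotopic.trans_of_right (hp₂ _ ht)).trans ((hcL d).trans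
        (h₃.symm.trans (HHomotopic.trans_of_left (hp₂ _ hs)).symm))
  · rw [hw₃]
    by_cases h₁ : d = a
    · rw [h₁, hr₁, ha, List.length_cons]
      omega
    by_cases h₂ : d = G.rev a
    · rw [h₂, hr₂, hw, ha, hlen, hlen, List.length_cons]
      omega
    · rw [hr₃ d h₁ h₂]

theorem Hom.IsEdgeCollapse.sum_eq {H : FinGraph} {c : Hom G H} {a : G.D} (h : c.IsEdgeCollapse a)
    [Fintype G.D] [Fintype H.D] (g : G.D → ℕ) :
    ∑ d, g d = g a + (g (G.rev a) + ∑ e, g (h.liftEdge e)) := by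
  classical
  have hu : (Finset.univ : Finset G.D) =
      insert a (insert (G.rev a) (Finset.univ.image h.liftEdge)) := by
    ext d
    have := h.eq_or_exists_liftEdge d
    simp only [Finset.mem_univ, Finset.mem_insert, Finset.mem_image, true_and, true_iff]
    grind
  have hn := fun e => h.ne_of_inr (h.onD_liftEdge e)
  rw [hu, Finset.sum_insert, Finset.sum_insert, Finset.sum_image h.liftEdge_injective.injOn]
  · simpa using fun e => (hn e).2
  · simpa using ⟨(G.rev_ne a).symm, fun e => (hn e).1⟩

end FinGraph

namespace InverseMorphism

variable {n : ℕ}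

/-- Every marked graph has a subdivision with a graph morphism to the rose that represents a
homotopy inverse of the marking. -/
theorem exists_of_wordMap (k : ℕ) (Γ : MarkedGraph n) {w : Γ.G.D → List (rose n).D}
    (hw : ∀ d, w (Γ.G.rev d) = wordInv (w d))
    (hΓ : ((wordMap w).comp Γ.marking).Homotopic (.id _))
    (hk : ∀ [Fintype Γ.G.D], ∑ d, ((w d).length - 1) ≤ k) :
    ∃ A : InverseMorphism n, A.toMarkedGraph.IsSubdivisionOf Γ := by
  induction k using Nat.strong_induction_on generalizing Γ with
  | _ k ih =>
    by_cases hl : ∀ d, (w d).length ≤ 1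
    · obtain ⟨f, hf⟩ := exists_hom_of_length_le_one hw hl
      exact ⟨ofHom Γ f ((hf.comp (.refl _)).trans hΓ), .refl⟩
    push Not at hl
    obtain ⟨a, ha⟩ := hl
    match hwa : w a with
    | [] => simp [hwa] at ha
    | e :: l =>
      obtain ⟨H, c, z, h, w', hz, hw', hhom, h₁, h₂, h₃, h₄⟩ := exists_subdivision hw hwa
      obtain ⟨m, hm, hc⟩ := Γ.exists_pull c h.isHomotopyEquivalence
      have hmw : ((wordMap w').comp m).Homotopic (.id _) := by
        refine (hhom.symm.comp (.refl m)).trans ?_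
        rw [ContinuousMap.comp_assoc]
        exact ((ContinuousMap.Homotopic.refl _).comp hc).trans hΓ
      have := Fintype.ofFinite Γ.G.D
      -- With truncated subtraction empty words and single letters count zero, so the two
      -- orientations of `z` contribute nothing, and the word on `a` loses a letter.
      have hlt : ∑ d, ((w' (h.liftEdge d)).length - 1) < ∑ d, ((w d).length - 1) := by
        refine Finset.sum_lt_sum (fun d _ => Nat.sub_le_sub_right (h₄ d) 1)
          ⟨a, Finset.mem_univ a, ?_⟩
        rw [h₃, hwa, List.length_cons]
        rw [hwa, List.length_cons] at ha
        omega
      obtain ⟨A, hA⟩ := ih _ (hlt.trans_le hk) ⟨H, m, hm⟩ (w := w') hw' hmw (by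
        intro _
        rw [h.sum_eq, h₁, h₂]
        simp)
      -- The bivalent vertex is the terminal vertex of `z`, so the removal starts along the reverse
      -- of `z`.
      refine ⟨A, hA.tail ⟨c, H.rev z, h.rev, ?_, hc⟩⟩
      exact hz

theorem exists_isSubdivisionOf (Γ : MarkedGraph n) :
    ∃ A : InverseMorphism n, A.toMarkedGraph.IsSubdivisionOf Γ := by
  obtain ⟨s, hs, -⟩ := isHomotopyEquivalence_iff.1 Γ.isHomotopyEquivalence
  obtain ⟨w, hw, hsw⟩ := exists_wordMap s
  have := Fintype.ofFinite Γ.G.D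
  refine exists_of_wordMap (∑ d, ((w d).length - 1)) Γ hw ((hsw.symm.comp (.refl _)).trans hs) ?_
  intro _
  exact le_of_eq (by congr!)

end InverseMorphism

/-! ## Folding sequences -/

theorem MarkedGraph.IsSubdivisionOf.represents {n : ℕ} {Γ : MarkedGraph n}
    {ρ : ReducedMarkedGraph n} (h : Γ.IsSubdivisionOf ρ.1) : Γ.Represents ρ.toVertex := by
  refine (represents_iff _ _).2 ⟨ρ, rfl, ?_⟩
  unfold IsSubdivisionOf at h
  induction h using Relation.ReflTransGen.head_induction_on with
  | refl => exact .refl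
  | head h _ ih => exact .head ((removes_iff _ _).2 (.inl h)) ih

namespace InverseMorphism

variable {n : ℕ}

theorem eq_standardRose_of_iso (hn : 2 ≤ n) {A : InverseMorphism n} {x : SpineVertex n}
    (hx : A.toMarkedGraph.Represents x) {g : Hom (rose n) A.G} (h₁ : g.comp A.map = Hom.id A.G)
    (h₂ : A.map.comp g = Hom.id (rose n)) : x = (standardRose n hn).toVertex := by
  have he : A.toMarkedGraph.Equivalent (standardRose n hn).1 :=
    ⟨A.map, g, h₁, h₂, A.map_comp_marking⟩
  have hr : A.toMarkedGraph.IsReduced := (standardRose n hn).2.of_equivalent he.symm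
  exact (hx.unique hr.represents).trans (Quotient.sound he)

/-- There is a sequence of collapses and folds from `A` to a homeomorphism, together with a path of
blowups and forest collapses from `x₀` to the standard rose. -/
def HasFoldingSequence (hn : 2 ≤ n) (A : InverseMorphism n) (x₀ : SpineVertex n) : Prop :=
  ∃ (k : ℕ) (Γ : ℕ → InverseMorphism n) (x : ℕ → SpineVertex n),
    Γ 0 = A ∧ IsHomeomorph (Γ k).map.realize ∧
    x 0 = x₀ ∧ x k = (standardRose n hn).toVertex ∧
    (∀ i ≤ k, (Γ i).toMarkedGraph.Represents (x i)) ∧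
    ∀ i < k,
      ((Γ i).EdgeCollapseStep (Γ (i + 1)) ∧ (x i).Collapses (x (i + 1))) ∨
      ((Γ i).FoldStep (Γ (i + 1)) ∧
        ∃ y : SpineVertex n,
          (y = x i ∨ y.IsBlowup (x i)) ∧ y.Collapses (x (i + 1)))

theorem HasFoldingSequence.cons {hn : 2 ≤ n} {A B : InverseMorphism n} {x₀ x₁ : SpineVertex n}
    (hx : A.toMarkedGraph.Represents x₀)
    (hstep : (A.EdgeCollapseStep B ∧ x₀.Collapses x₁) ∨
      (A.FoldStep B ∧ ∃ y : SpineVertex n, (y = x₀ ∨ y.IsBlowup x₀) ∧ y.Collapses x₁))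
    (h : HasFoldingSequence hn B x₁) : HasFoldingSequence hn A x₀ := by
  obtain ⟨k, Γ, x, h₁, h₂, h₃, h₄, h₅, h₆⟩ := h
  refine ⟨k + 1, fun i => Nat.casesOn i A Γ, fun i => Nat.casesOn i x₀ x, rfl, h₂, rfl, h₄,
    fun i hi => ?_, fun i hi => ?_⟩
  · cases i with
    | zero => exact hx
    | succ i => exact h₅ i (by omega)
  · cases i with
    | zero =>
      subst h₁ h₃
      exact hstep
    | succ i => exact h₆ i (by omega)

/-- Induction on the number of oriented edges. A morphism that collapses no edge and folds no pair
of edges is an immersion, and the sequence ends. -/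
theorem hasFoldingSequence (hn : 2 ≤ n) (A : InverseMorphism n) {x₀ : SpineVertex n}
    (hx : A.toMarkedGraph.Represents x₀) : HasFoldingSequence hn A x₀ := by
  induction hN : Nat.card A.G.D using Nat.strong_induction_on generalizing A x₀ with
  | _ N ih =>
    by_cases hcol : ∃ a v, A.map.onD a = Sum.inl v
    · obtain ⟨a, v, ha⟩ := hcol
      obtain ⟨B, h₁, h₂, x₁, h₃, h₄⟩ := exists_edgeCollapseStep hx ha
      exact .cons hx (.inl ⟨h₁, h₄⟩) (ih _ (hN ▸ h₂) B h₃ rfl)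
    have hex : ∀ d, ∃ e, A.map.onD d = Sum.inr e := by
      intro d
      rcases hd : A.map.onD d with v | e
      · exact absurd ⟨d, v, hd⟩ hcol
      · exact ⟨e, rfl⟩
    choose φ hφ using hex
    by_cases hinj : ∀ a b, A.G.src a = A.G.src b → φ a = φ b → a = b
    · obtain ⟨g, h₁, h₂⟩ := exists_inverse_of_immersion A.isHomotopyEquivalence_map hφ hinj
      exact ⟨0, fun _ => A, fun _ => x₀, rfl, Hom.isHomeomorph_of_iso h₁ h₂, rfl,
        eq_standardRose_of_iso hn hx h₁ h₂, fun _ _ => hx, fun i hi => absurd hi i.not_lt_zero⟩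
    · push Not at hinj
      obtain ⟨a, b, hab, he, hne⟩ := hinj
      obtain ⟨B, h₁, h₂, x₁, h₃, h₄⟩ :=
        exists_foldStep hn hx hab hne.symm (hφ a) ((hφ b).trans (congrArg Sum.inr he.symm))
      exact .cons hx (.inr ⟨h₁, h₄⟩) (ih _ (hN ▸ h₂) B h₃ rfl)

end InverseMorphism

/-! ## Connectivity of the spine -/

namespace PreAbstractSimplicialComplex

variable {ι : Type*} {K : PreAbstractSimplicialComplex ι}

theorem Realization.support_nonempty (p : K.Realization) : p.1.support.Nonempty := by
  rw [Finset.nonempty_iff_ne_empty]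
  intro h
  have h₁ := p.2.2.2
  rw [Finsupp.sum, h, Finset.sum_empty] at h₁
  exact zero_ne_one h₁

/-- A map into the realization whose values lie in one closed simplex is continuous if its
barycentric coordinates are. -/
theorem continuous_of_support_subset {X : Type*} [TopologicalSpace X] {γ : X → K.Realization}
    {s : Finset ι} (hs : s ∈ K.faces) (hγ : ∀ t, (γ t).1.support ⊆ s)
    (h : ∀ i, Continuous fun t => (γ t).1 i) : Continuous γ := by
  refine continuous_def.2 fun U hU => ?_
  have hU := isOpen_coinduced.1 (isOpen_iSup_iff.1 hU ⟨s, hs⟩)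
  obtain ⟨V, hV, hVU⟩ := isOpen_induced_iff.1 hU
  have : γ ⁻¹' U = (fun t i => (γ t).1 i) ⁻¹' V := by
    ext t
    exact (Set.ext_iff.1 hVU ⟨γ t, hγ t⟩).symm
  rw [this]
  exact hV.preimage (continuous_pi h)

/-- Two points in a common closed simplex are joined by a path. -/
theorem joined_of_support_subset {p q : K.Realization} {s : Finset ι} (hs : s ∈ K.faces)
    (hp : p.1.support ⊆ s) (hq : q.1.support ⊆ s) : Joined p q := by
  classical
  let w : unitInterval → ι →₀ ℝ := fun t => (1 - (t : ℝ)) • p.1 + (t : ℝ) • q.1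
  have hw : ∀ t i, w t i = (1 - (t : ℝ)) * p.1 i + t * q.1 i := fun t i => rfl
  have hsub : ∀ t, (w t).support ⊆ s := fun t => Finsupp.support_add.trans
    (Finset.union_subset (Finsupp.support_smul.trans hp) (Finsupp.support_smul.trans hq))
  have hsum : ∀ t, ((w t).sum fun _ r => r) = 1 := by
    intro t
    have hone : ∀ r : K.Realization, r.1.support ⊆ s → ∑ i ∈ s, r.1 i = 1 := fun r hr => by
      exact (Finsupp.sum_of_support_subset _ hr _ fun _ _ => rfl).symm.trans r.2.2.2
    rw [Finsupp.sum_of_support_subset _ (hsub t) _ fun _ _ => rfl]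
    simp only [hw, Finset.sum_add_distrib, ← Finset.mul_sum, hone p hp, hone q hq]
    ring
  -- The coordinates sum to one, so the support is nonempty and is a face of `s`.
  have hne : ∀ t, (w t).support.Nonempty := by
    intro t
    rw [Finset.nonempty_iff_ne_empty]
    intro h
    have h₁ := hsum t
    rw [Finsupp.sum, h, Finset.sum_empty] at h₁
    exact zero_ne_one h₁
  let γ : unitInterval → K.Realization := fun t =>
    ⟨w t, (K.isRelLowerSet_faces hs).2 (hsub t) (hne t), fun i =>
      add_nonneg (mul_nonneg (sub_nonneg.2 t.2.2) (p.2.2.1 i)) (mul_nonneg t.2.1 (q.2.2.1 i)),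
      hsum t⟩
  have hγ : Continuous γ := continuous_of_support_subset hs hsub fun i => by
    change Continuous fun t : unitInterval => (1 - (t : ℝ)) * p.1 i + t * q.1 i
    fun_prop
  refine ⟨⟨⟨γ, hγ⟩, Subtype.ext (Finsupp.ext fun i => ?_), Subtype.ext (Finsupp.ext fun i => ?_)⟩⟩
  · change w 0 i = p.1 i
    rw [hw]
    simp
  · change w 1 i = q.1 i
    rw [hw]
    simp

end PreAbstractSimplicialComplex

namespace SpineVertex

variable {n : ℕ}

/-- A vertex as a point of the realization. -/
noncomputable def point (x : SpineVertex n) : (spine n).Realization :=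
  ⟨Finsupp.single x 1, by
    rw [Finsupp.support_single x one_ne_zero]
    refine ⟨Finset.singleton_nonempty x, ?_⟩
    rw [Finset.coe_singleton]
    exact Set.subsingleton_singleton.isChain, fun i => by
    classical
    rw [Finsupp.single_apply]
    split_ifs <;> norm_num, Finsupp.sum_single_index rfl⟩

theorem support_point (x : SpineVertex n) : x.point.1.support = {x} :=
  Finsupp.support_single x one_ne_zero

theorem Collapses.joined {x y : SpineVertex n} (h : x.Collapses y) : Joined x.point y.point := by
  classical
  refine PreAbstractSimplicialComplex.joined_of_support_subset (s := {x, y})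
    ⟨Finset.insert_nonempty _ _, ?_⟩ ?_ ?_
  · rw [Finset.coe_pair]
    rintro u (rfl | rfl) v (rfl | rfl) huv
    · exact absurd rfl huv
    · exact .inl h
    · exact .inr h
    · exact absurd rfl huv
  · rw [support_point]
    simp
  · rw [support_point]
    simp

/-- The subdivision and its folding sequence exist for every marked graph, whether it is a rose or
not. A blowup is traversed as a collapse in the opposite direction. -/
theorem joined_standardRose (hn : 2 ≤ n) (x : SpineVertex n) :
    Joined x.point (standardRose n hn).toVertex.point := by
  induction x using Quotient.ind with
  | _ ρ =>
    obtain ⟨A, hA⟩ := InverseMorphism.exists_isSubdivisionOf ρ.1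
    obtain ⟨k, Γ, x, -, -, h₃, h₄, -, h₆⟩ := A.hasFoldingSequence hn hA.represents
    have h : ∀ i ≤ k, Joined (x 0).point (x i).point := by
      intro i hi
      induction i with
      | zero => exact .refl _
      | succ i ih =>
        refine (ih (by omega)).trans ?_
        rcases h₆ i (by omega) with ⟨-, h⟩ | ⟨-, y, hy, h⟩
        · exact h.joined
        · rcases hy with rfl | hy
          · exact h.joined
          · exact hy.collapses.joined.symm.trans h.joined
    have := h k le_rfl
    rwa [h₃, h₄] at this

end SpineVertex

theorem pathConnectedSpace_spine {n : ℕ} (hn : 2 ≤ n) :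
    PathConnectedSpace (spine n).Realization := by
  have key : ∀ p : (spine n).Realization, Joined p (standardRose n hn).toVertex.point := by
    intro p
    obtain ⟨x, hx⟩ := p.support_nonempty
    refine Joined.trans ?_ (x.joined_standardRose hn)
    refine PreAbstractSimplicialComplex.joined_of_support_subset p.2.1 subset_rfl ?_
    rw [SpineVertex.support_point]
    simpa using hx
  exact ⟨⟨(standardRose n hn).toVertex.point⟩, fun p q => (key p).trans (key q).symm⟩

theorem mainTheorem6 (n : ℕ) (hn : 2 ≤ n) :
    -- the spine is connected
    ConnectedSpace (spine n).Realization ∧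
    -- every marked rose is joined to the standard rose by a folding path
    (∀ ρ : ReducedMarkedGraph n, ρ.1.G.IsRose n →
      (∃ A : InverseMorphism n, A.toMarkedGraph.IsSubdivisionOf ρ.1) ∧
      ∀ A : InverseMorphism n, A.toMarkedGraph.IsSubdivisionOf ρ.1 →
        ∃ (k : ℕ) (Γ : ℕ → InverseMorphism n) (x : ℕ → SpineVertex n),
          Γ 0 = A ∧ IsHomeomorph (Γ k).map.realize ∧
          x 0 = ρ.toVertex ∧ x k = (standardRose n hn).toVertex ∧
          (∀ i ≤ k, (Γ i).toMarkedGraph.Represents (x i)) ∧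
          ∀ i < k,
            ((Γ i).EdgeCollapseStep (Γ (i + 1)) ∧ (x i).Collapses (x (i + 1))) ∨
            ((Γ i).FoldStep (Γ (i + 1)) ∧
              ∃ y : SpineVertex n,
                (y = x i ∨ y.IsBlowup (x i)) ∧ y.Collapses (x (i + 1)))) ∧
    -- a locally injective homotopy equivalence onto the rose is a homeomorphism
    (∀ (G : FinGraph) (f : Hom G (rose n)),
      IsHomotopyEquivalence f.realize → IsLocallyInjective f.realize →
        IsHomeomorph f.realize) := by
  have := pathConnectedSpace_spine hn
  exact ⟨inferInstance, fun ρ _ => ⟨InverseMorphism.exists_isSubdivisionOf ρ.1, fun A hA =>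
    A.hasFoldingSequence hn hA.represents⟩, fun G f hf hl =>
    isHomeomorph_of_isLocallyInjective hf hl⟩
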